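/- Let $M$ be a Hausdorff smooth manifold (without boundary) of any dimension $n$, and let $F:TM\to[0,\infty)$ be a Finsler structure: $F$ is smooth off the zero section, $F(\lambda y)=\lambda F(y)$ for $\lambda>0$, and for every $y\neq 0$ the fundamental tensor $g_y(u,v)=\frac12\frac{\partial^2}{\partial t\,\partial s}F^2(y+tu+sv)\big|_{s=t=0}$ is positive definite. Let $d_F(p,q)$ be the infimum of the lengths $\int F(\gamma,\gamma')$ of the piecewise smooth curves from $p$ to $q$, and for $K\subset M$ put $d_F(K,q)=\inf_{a\in K}d_F(a,q)$. Assume that any point $p$ is joined to any point $q$ by a shortest (piecewise smooth) unit speed curve. Notions. The cut locus of $K$ is the set of points $q$ that are reached from $K$ by two different unit speed curves of length $d_F(K,q)$. For a wave which has front $W$ at time $0$ and has swept the region $B$ before time $0$, the wavefront at time $\tau$ is $\{p\notin B: d_F(W,p)=\tau\}$; the wavefront at time $\delta$ of a wave emitted at the point $q$ is $\phi_q(\delta)=\{p: d_F(q,p)=\delta\}$. A wave ray from $W$ to $p$ is a unit speed curve $\gamma:[0,\ell]\to M$ with $\gamma(0)\in W$, $\gamma(\ell)=p$ and length $d_F(W,p)$.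 Tangent vectors of a subset $S\subset M$ at $p$ are the velocities at time $0$ of curves through $p$ at time $0$ that are differentiable at time $0$ and lie in $S$ for all times near $0$. Two subsets are tangent at a common point if their tangent vectors there form one and the same hyperplane of $T_pM$. A nonzero $y\in T_pM$ with $p\in S$ is orthogonal to $S$ if $g_y(y,v)=0$ for all tangent vectors $v$ of $S$ at $p$. Theorem. Let $A\subset M$ be compact, $\rho(p)=d_F(A,p)$, let $U\subset M$ satisfy $\rho(U)=[s,r]$ with $0<s<r$, and suppose that no point of $\rho^{-1}([s,r])$ belongs to the cut locus of $A$. Consider the wave which has front $\rho^{-1}(s)$ at time $0$ and has swept $\{\rho<s\}$ before. Then: 1. For each $t\in[s,r]$, the wavefront at time $t-s$ is $\rho^{-1}(t)$. 2. (Huygens' envelope principle.) For $s\le t_0<t\le r$ and $\delta=t-t_0$, $\rho^{-1}(t)$ is the envelope, outside the region $\{\rho<t_0\}$ already swept, of the wavefronts $\phi_q(\delta)$, $q\in\rho^{-1}(t_0)$. That is, $\rho^{-1}(t)$ is the set of the points $p$ with $\rho(p)\ge t_0$ which lie on some $\phi_q(\delta)$ with $q\in\rho^{-1}(t_0)$ and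 on no $\phi_q(\tau)$ with $q\in\rho^{-1}(t_0)$ and $\tau<\delta$; and $\rho^{-1}(t)$ is tangent at each of its points to every $\phi_q(\delta)$, $q\in\rho^{-1}(t_0)$, through that point. 3. For each $t\in[s,r]$, the tangent vectors of $\rho^{-1}(t)$ at each of its points form a hyperplane of the tangent space of $M$. 4. For each $t\in(s,r]$ and $p\in\rho^{-1}(t)$ there is a wave ray from $\rho^{-1}(s)$ to $p$. Every such wave ray $\gamma$ is defined on $[0,t-s]$ and is a geodesic of $F$, that is, a smooth unit speed curve which minimizes length between any two of its points; and for every $u\in[0,t-s]$, $\gamma(u)\in\rho^{-1}(s+u)$ and $\gamma'(u)$ is orthogonal to the wavefront $\rho^{-1}(s+u)$. -/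

import Mathlib

open Set Filter Topology MeasureTheory
open scoped Manifold ContDiff

namespace Finsler

/-- The fundamental tensor `g_y(u, v) = 1/2 ∂²/∂t∂s N²(y + t u + s v)` at `t = s = 0` of a function
`N` on a real vector space. -/
noncomputable def fundamentalTensor {V : Type*} [AddCommGroup V] [Module ℝ V] (N : V → ℝ)
    (y u v : V) : ℝ :=
  (1 / 2) * deriv (fun t : ℝ => deriv (fun s : ℝ => (N (y + t • u + s • v)) ^ 2) 0) 0

section

variable {n : ℕ} {M : Type*} [TopologicalSpace M] [ChartedSpace (EuclideanSpace ℝ (Fin n)) M]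

/-- Finsler structures on a smooth `n`-manifold `M`: nonnegative functions on `TM`, smooth off the
zero section, which restrict to a Minkowski norm on each tangent space (smoothness of the
restriction to a punctured fibre is contained in smoothness on `TM` off the zero section). -/
structure IsFinslerStructure [IsManifold (𝓡 n) ∞ M] (F : TangentBundle (𝓡 n) M → ℝ) : Prop where
  nonneg : ∀ v, 0 ≤ F v
  smooth : ContMDiffOn (𝓡 n).tangent 𝓘(ℝ, ℝ) ∞ F {v | v.2 ≠ 0}
  homogeneous : ∀ (x : M) (y : TangentSpace (𝓡 n) x) (c : ℝ), 0 < c →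
    F ⟨x, c • y⟩ = c * F ⟨x, y⟩
  posDef : ∀ (x : M) (y : TangentSpace (𝓡 n) x), y ≠ 0 → ∀ u : TangentSpace (𝓡 n) x, u ≠ 0 →
    0 < fundamentalTensor (fun w : TangentSpace (𝓡 n) x => F ⟨x, w⟩) y u u

/-- The velocity of a curve, as a point of `TM`. -/
noncomputable def velocity (γ : ℝ → M) (x : ℝ) : TangentBundle (𝓡 n) M :=
  ⟨γ x, mfderiv 𝓘(ℝ, ℝ) (𝓡 n) γ x (1 : ℝ)⟩

/-- The velocity of a curve defined on a set `J` of times; it is one-sided at the endpoints of an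
interval `J`. -/
noncomputable def velocityWithin (γ : ℝ → M) (J : Set ℝ) (x : ℝ) : TangentBundle (𝓡 n) M :=
  ⟨γ x, mfderivWithin 𝓘(ℝ, ℝ) (𝓡 n) γ J x (1 : ℝ)⟩

/-- `γ` is a piecewise smooth curve on `[a, b]`: it is continuous there, and smooth on each closed
subinterval with no point of a suitable finite set `P` in its interior. -/
def IsPiecewiseSmooth (n : ℕ) {M : Type*} [TopologicalSpace M]
    [ChartedSpace (EuclideanSpace ℝ (Fin n)) M] (γ : ℝ → M) (a b : ℝ) : Prop :=
  ContinuousOn γ (Icc a b) ∧ ∃ P : Finset ℝ, ∀ c d : ℝ, a ≤ c → c < d → d ≤ b →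
    (∀ x ∈ P, x ∉ Ioo c d) → ContMDiffOn 𝓘(ℝ, ℝ) (𝓡 n) ∞ γ (Icc c d)

/-- The length `∫ F(γ, γ')` of `γ` on `[a, b]`. -/
noncomputable def length (F : TangentBundle (𝓡 n) M → ℝ) (γ : ℝ → M) (a b : ℝ) : ℝ :=
  ∫ x in a..b, F (velocity γ x)

/-- The (not necessarily symmetric) distance `d_F(p, q)`: the infimum of the lengths of the
piecewise smooth curves from `p` to `q`. -/
noncomputable def fdist (F : TangentBundle (𝓡 n) M → ℝ) (p q : M) : ℝ :=
  sInf {L : ℝ | ∃ (a b : ℝ) (γ : ℝ → M), a ≤ b ∧ IsPiecewiseSmooth n γ a b ∧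
    γ a = p ∧ γ b = q ∧ L = length F γ a b}

/-- The distance `d_F(K, q)` from a set `K` to a point `q`. -/
noncomputable def fdistFrom (F : TangentBundle (𝓡 n) M → ℝ) (K : Set M) (q : M) : ℝ :=
  sInf ((fun a => fdist F a q) '' K)

/-- `γ` has unit speed on `[a, b]`; nothing is asked at the corners of `γ`. -/
def IsUnitSpeed (F : TangentBundle (𝓡 n) M → ℝ) (γ : ℝ → M) (a b : ℝ) : Prop :=
  ∀ x ∈ Ioo a b, MDifferentiableAt 𝓘(ℝ, ℝ) (𝓡 n) γ x → F (velocity γ x) = 1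

/-- `γ : [0, ℓ] → M` is a shortest unit speed curve from the set `K` to the point `q`. -/
structure IsShortest (F : TangentBundle (𝓡 n) M → ℝ) (K : Set M) (q : M) (γ : ℝ → M)
    (ℓ : ℝ) : Prop where
  nonneg : 0 ≤ ℓ
  piecewiseSmooth : IsPiecewiseSmooth n γ 0 ℓ
  unitSpeed : IsUnitSpeed F γ 0 ℓ
  source : γ 0 ∈ K
  target : γ ℓ = q
  length_eq : length F γ 0 ℓ = fdistFrom F K q

/-- The cut locus of `K`: the points reached from `K` by two different shortest unit speed
curves. -/
def cutLocus (F : TangentBundle (𝓡 n) M → ℝ) (K : Set M) : Set M :=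
  {q | ∃ (ℓ : ℝ) (γ₁ γ₂ : ℝ → M), IsShortest F K q γ₁ ℓ ∧ IsShortest F K q γ₂ ℓ ∧
    ¬ EqOn γ₁ γ₂ (Icc 0 ℓ)}

/-- `γ : [0, ℓ] → M` is a unit speed geodesic of `F`: a smooth unit speed curve which minimizes
length between any two of its points. -/
structure IsGeodesic (F : TangentBundle (𝓡 n) M → ℝ) (γ : ℝ → M) (ℓ : ℝ) : Prop where
  smooth : ContMDiffOn 𝓘(ℝ, ℝ) (𝓡 n) ∞ γ (Icc 0 ℓ)
  unitSpeed : ∀ u ∈ Icc 0 ℓ, F (velocityWithin γ (Icc 0 ℓ) u) = 1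
  minimizing : ∀ u v : ℝ, 0 ≤ u → u ≤ v → v ≤ ℓ → length F γ u v = fdist F (γ u) (γ v)

/-- The vectors at `p` tangent to a subset `S` of `M`: the velocities at time `0` of the curves
lying in `S`. -/
def tangentVectors (S : Set M) (p : M) : Set (TangentSpace (𝓡 n) p) :=
  {v | ∃ c : ℝ → M, MDifferentiableAt 𝓘(ℝ, ℝ) (𝓡 n) c 0 ∧ (∀ᶠ u in 𝓝 (0 : ℝ), c u ∈ S) ∧
    velocity c 0 = (⟨p, v⟩ : TangentBundle (𝓡 n) M)}

/-- The vectors tangent to `S` at `p` form the hyperplane `H` of the tangent space of `M`. -/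
def HasTangentHyperplane (S : Set M) (p : M) (H : Submodule ℝ (TangentSpace (𝓡 n) p)) : Prop :=
  Module.finrank ℝ H + 1 = n ∧ tangentVectors S p = (H : Set (TangentSpace (𝓡 n) p))

/-- The hypersurfaces `S` and `S'` are tangent to each other at the common point `p`. -/
def AreTangentAt (n : ℕ) {M : Type*} [TopologicalSpace M]
    [ChartedSpace (EuclideanSpace ℝ (Fin n)) M] (S S' : Set M) (p : M) : Prop :=
  p ∈ S ∧ p ∈ S' ∧ ∃ H : Submodule ℝ (TangentSpace (𝓡 n) p),
    HasTangentHyperplane S p H ∧ HasTangentHyperplane S' p H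

/-- The nonzero tangent vector `y` is orthogonal to `S` at its base point: `g_y(y, v) = 0` for all
`v` tangent to `S`. -/
def IsOrthogonalTo (F : TangentBundle (𝓡 n) M → ℝ) (y : TangentBundle (𝓡 n) M) (S : Set M) :
    Prop :=
  y.2 ≠ 0 ∧ y.1 ∈ S ∧ ∀ v ∈ tangentVectors S y.1,
    fundamentalTensor (fun w : TangentSpace (𝓡 n) y.1 => F ⟨y.1, w⟩) y.2 y.2 v = 0

/-- A wave has front `W` at time `0` and has swept the region `B` before time `0`. Its front after
time `τ` consists of the points outside `B` at distance `τ` from `W`: the infimum of the travel times, at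
unit speed, from `W` to the point is `τ`. With `B = ∅` and `W = {q}` this is the front of a wave emitted at `q`. -/
def wavefront (F : TangentBundle (𝓡 n) M → ℝ) (B W : Set M) (τ : ℝ) : Set M :=
  {p | p ∉ B ∧ fdistFrom F W p = τ}

/-- `E` is the envelope, outside the swept region `B`, of the fronts after time `δ` of the waves
emitted at the points of `W`: it is the set of the points which lie on one of these fronts and
which none of these waves reaches before time `δ`, and it is tangent at each of its points to the
fronts through that point. -/
def IsEnvelope (F : TangentBundle (𝓡 n) M → ℝ) (B W : Set M) (δ : ℝ) (E : Set M) : Prop :=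
  E = {p | p ∉ B ∧ (∃ q ∈ W, p ∈ wavefront F ∅ {q} δ) ∧
    ∀ q ∈ W, ∀ τ < δ, p ∉ wavefront F ∅ {q} τ} ∧
  ∀ p ∈ E, ∀ q ∈ W, p ∈ wavefront F ∅ {q} δ → AreTangentAt n (wavefront F ∅ {q} δ) E p

end

end Finsler

/-
Let `ρ` be the distance from `A`. Shortest curves from `A` cross the levels of `ρ` at unit speed, so
that `d(ρ⁻¹(t₀), p) = ρ(p) - t₀`; the wavefronts and the points of the envelope are read off this.

Off the cut locus `ρ` is strictly differentiable. Indeed, let `γ` be the shortest curve from `A` to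
`p` and `v` its terminal velocity. By uniqueness and compactness the shortest curves to points `x`
near `p` end close to `γ`, so moving their end point to `y` in a chart shows that
`ρ(y) - ρ(x) ≤ dF_p(v)(y - x) + o(|y - x|)`, and exchanging `x` and `y` gives the reverse bound.
Hence `dρ_p = dF_p(v) ≠ 0`, and the implicit function theorem yields the tangent hyperplanes. As
`g_y(y, w) = F(y) dF(y)(w)`, the gradient `v` is orthogonal to the level of `ρ`.

Along a ray `ρ` grows at unit speed. By the equality case of `dF(v)(w) ≤ F(w)` the velocity of the
ray is the gradient of `ρ`, so it depends continuously on time. A translate of the ray in a chart is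
at least as long as the increment of `ρ` between its ends, with equality for the ray itself; the
derivative of the difference in the direction of the translation is the Euler–Lagrange equation in
integral form. As the Legendre transformation is a local diffeomorphism, its solutions are smooth.

The ray from `A` to `p` through a point `q` is also a ray from `q`, so that the distances from `A`
and from `q` have the same gradient at `p`, and their level sets are tangent there.
-/

namespace Finsler

/-! ### Minkowski norms -/

theorem fundamentalTensor_comp_linear {V W : Type*} [AddCommGroup V] [Module ℝ V]
    [AddCommGroup W] [Module ℝ W] (N : W → ℝ) (T : V →ₗ[ℝ] W) (y u v : V) :
    fundamentalTensor (fun w => N (T w)) y u v = fundamentalTensor N (T y) (T u) (T v) := by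
  simp only [fundamentalTensor, map_add, map_smul]

theorem fundamentalTensor_line {V : Type*} [AddCommGroup V] [Module ℝ V] (N : V → ℝ) (y u : V)
    (t : ℝ) : fundamentalTensor N (y + t • u) u u =
      1 / 2 * deriv (deriv fun τ : ℝ => N (y + τ • u) ^ 2) t := by
  set ψ : ℝ → ℝ := fun τ => N (y + τ • u) ^ 2 with hψ
  have hshift (τ σ : ℝ) : N (y + t • u + τ • u + σ • u) ^ 2 = ψ (t + τ + σ) := by
    simp only [hψ, add_smul, add_assoc]
  simp only [fundamentalTensor, hshift, deriv_comp_const_add, add_zero]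

section MinkowskiNorm

/-- Minkowski norms: the restrictions of Finsler structures to the tangent spaces. -/
structure IsMinkowski {V : Type*} [NormedAddCommGroup V] [NormedSpace ℝ V] (N : V → ℝ) :
    Prop where
  nonneg : ∀ y, 0 ≤ N y
  smooth : ContDiffOn ℝ ∞ N {0}ᶜ
  homogeneous : ∀ (y : V) (c : ℝ), 0 < c → N (c • y) = c * N y
  posDef : ∀ y : V, y ≠ 0 → ∀ u : V, u ≠ 0 → 0 < fundamentalTensor N y u u

namespace IsMinkowski

variable {V : Type*} [NormedAddCommGroup V] [NormedSpace ℝ V] {N : V → ℝ} (hN : IsMinkowski N)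
include hN

theorem map_zero : N 0 = 0 := by
  have h := hN.homogeneous 0 2 two_pos
  rw [smul_zero] at h
  linarith

theorem ne_zero_of_unit {y : V} (hy : N y = 1) : y ≠ 0 := by
  rintro rfl
  exact zero_ne_one (hN.map_zero.symm.trans hy)

theorem contDiffAt {y : V} (hy : y ≠ 0) : ContDiffAt ℝ ∞ N y :=
  hN.smooth.contDiffAt (isOpen_compl_singleton.mem_nhds hy)

theorem hasFDerivAt {y : V} (hy : y ≠ 0) : HasFDerivAt N (fderiv ℝ N y) y :=
  ((hN.contDiffAt hy).differentiableAt (by simp)).hasFDerivAt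

theorem hasDerivAt_line {y u : V} {t : ℝ} (h : y + t • u ≠ 0) :
    HasDerivAt (fun τ : ℝ => N (y + τ • u)) (fderiv ℝ N (y + t • u) u) t := by
  have hline : HasDerivAt (fun τ : ℝ => y + τ • u) u t := by
    simpa using ((hasDerivAt_id t).smul_const u).const_add y
  exact (hN.hasFDerivAt h).comp_hasDerivAt t hline

theorem map_add_smul_self (y : V) {t : ℝ} (ht : -1 < t) : N (y + t • y) = (1 + t) * N y := by
  rw [← hN.homogeneous y (1 + t) (by linarith), add_smul, one_smul]

theorem pos {y : V} (hy : y ≠ 0) : 0 < N y := by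
  refine (hN.nonneg y).lt_of_ne' fun h0 => ?_
  have hflat : (fun t : ℝ => N (y + t • y) ^ 2) =ᶠ[𝓝 0] fun _ => 0 := by
    filter_upwards [lt_mem_nhds neg_one_lt_zero] with t ht
    rw [hN.map_add_smul_self y ht, h0, mul_zero, zero_pow two_ne_zero]
  have htensor : fundamentalTensor N y y y = 0 := by
    have h := fundamentalTensor_line N y y 0
    rw [hflat.deriv.deriv_eq, zero_smul, add_zero] at h
    simpa only [deriv_const', deriv_const, mul_zero] using h
  exact (hN.posDef y hy y hy).ne' htensor

theorem map_inv_smul {y : V} (hy : y ≠ 0) : N ((N y)⁻¹ • y) = 1 := by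
  rw [hN.homogeneous _ _ (inv_pos.2 (hN.pos hy)), inv_mul_cancel₀ (hN.pos hy).ne']

theorem fderiv_self {y : V} (hy : y ≠ 0) : fderiv ℝ N y y = N y := by
  have hline : HasDerivAt (fun t : ℝ => N (y + t • y)) (fderiv ℝ N y y) 0 := by
    simpa only [zero_smul, add_zero] using
      hN.hasDerivAt_line (y := y) (u := y) (t := 0) (by simpa using hy)
  have hlin : HasDerivAt (fun t : ℝ => N (y + t • y)) (1 * N y) 0 := by
    refine (((hasDerivAt_id (0 : ℝ)).const_add 1).mul_const (N y)).congr_of_eventuallyEq ?_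
    filter_upwards [lt_mem_nhds neg_one_lt_zero] with t ht using hN.map_add_smul_self y ht
  rw [hline.unique hlin, one_mul]

theorem fderiv_smul {y : V} (hy : y ≠ 0) {c : ℝ} (hc : 0 < c) :
    fderiv ℝ N (c • y) = fderiv ℝ N y := by
  have hinner : HasFDerivAt (fun z : V => N (c • z)) (c • fderiv ℝ N (c • y)) y := by
    refine ((hN.hasFDerivAt (smul_ne_zero hc.ne' hy)).comp y
      ((hasFDerivAt_id y).const_smul c)).congr_fderiv ?_
    ext v
    simp
  have houter : HasFDerivAt (fun z : V => N (c • z)) (c • fderiv ℝ N y) y :=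
    ((hN.hasFDerivAt hy).const_smul c).congr_of_eventuallyEq
      (Eventually.of_forall fun z => hN.homogeneous z c hc)
  exact smul_right_injective _ hc.ne' (hinner.unique houter)

theorem fundamentalTensor_left_self {y : V} (hy : y ≠ 0) (v : V) :
    fundamentalTensor N y y v = N y * fderiv ℝ N y v := by
  have hinner : (fun t : ℝ => deriv (fun s : ℝ => N (y + t • y + s • v) ^ 2) 0) =ᶠ[𝓝 0]
      fun t => (1 + t) * (2 * N y * fderiv ℝ N y v) := by
    filter_upwards [lt_mem_nhds neg_one_lt_zero] with t ht
    have ht' : 0 < 1 + t := by linarith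
    have hty : y + t • y = (1 + t) • y := by rw [add_smul, one_smul]
    have hline : HasDerivAt (fun s : ℝ => N (y + t • y + s • v)) (fderiv ℝ N y v) 0 := by
      have h := hN.hasDerivAt_line (y := y + t • y) (u := v) (t := 0)
      rw [zero_smul, add_zero, hty, hN.fderiv_smul hy ht'] at h
      simpa only [hty] using h (smul_ne_zero ht'.ne' hy)
    rw [(hline.fun_pow 2).deriv, zero_smul, add_zero, hN.map_add_smul_self y ht]
    push_cast
    ring
  have houter : HasDerivAt (fun t : ℝ => (1 + t) * (2 * N y * fderiv ℝ N y v))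
      (1 * (2 * N y * fderiv ℝ N y v)) 0 := ((hasDerivAt_id (0 : ℝ)).const_add 1).mul_const _
  rw [fundamentalTensor, hinner.deriv_eq, houter.deriv]
  ring

theorem strictConvexOn_sq_line {y u : V} (hu : u ≠ 0) {s : Set ℝ} (hs : Convex ℝ s)
    (h : ∀ t ∈ s, y + t • u ≠ 0) : StrictConvexOn ℝ s fun t : ℝ => N (y + t • u) ^ 2 := by
  refine strictConvexOn_of_deriv2_pos hs (fun t ht => ?_) fun t ht => ?_
  · exact (((hN.hasDerivAt_line (h t ht)).pow 2).continuousAt).continuousWithinAt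
  · have hpos := hN.posDef _ (h t (interior_subset ht)) u hu
    rw [fundamentalTensor_line] at hpos
    change 0 < deriv (deriv fun t : ℝ => N (y + t • u) ^ 2) t
    linarith

theorem fderiv_neg_of_antipodal {v w : V} (hv : v ≠ 0) {a b : ℝ} (ha : 0 < a) (hb : 0 < b)
    (h : a • v + b • w = 0) : fderiv ℝ N v w < 0 := by
  have hsum : a * N v + b * fderiv ℝ N v w = 0 := by
    simpa only [map_add, _root_.map_smul, smul_eq_mul, hN.fderiv_self hv, _root_.map_zero] using
      congrArg (fderiv ℝ N v) h
  have hav : 0 < a * N v := mul_pos ha (hN.pos hv)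
  by_contra! hw
  linarith [mul_nonneg hb.le hw]

theorem fderiv_lt_one {v w : V} (hv : N v = 1) (hw : N w = 1) (hvw : w ≠ v) :
    fderiv ℝ N v w < 1 := by
  have hv0 := hN.ne_zero_of_unit hv
  have hw0 := hN.ne_zero_of_unit hw
  by_cases hseg : ∃ t ∈ Icc (0 : ℝ) 1, v + t • (w - v) = 0
  · obtain ⟨t, ⟨ht0, ht1⟩, h⟩ := hseg
    have hcomb : (1 - t) • v + t • w = 0 := by rw [← h]; module
    refine (hN.fderiv_neg_of_antipodal hv0 (sub_pos.2 (ht1.lt_of_ne ?_)) (ht0.lt_of_ne' ?_)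
      hcomb).trans one_pos <;> rintro rfl
    · exact hw0 (by simpa using h)
    · exact hv0 (by simpa using h)
  · push Not at hseg
    have hconv := hN.strictConvexOn_sq_line (sub_ne_zero.2 hvw) (convex_Icc 0 1) hseg
    have hderiv : HasDerivAt (fun t : ℝ => N (v + t • (w - v)) ^ 2)
        (2 * (fderiv ℝ N v w - 1)) 0 := by
      refine ((hN.hasDerivAt_line (hseg 0 (left_mem_Icc.2 zero_le_one))).fun_pow 2).congr_deriv ?_
      simp [hv, hN.fderiv_self hv0]
    have hslope := hconv.lt_slope_of_hasDerivAt (left_mem_Icc.2 zero_le_one)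
      (right_mem_Icc.2 zero_le_one) one_pos hderiv
    simp only [slope_def_field, one_smul, zero_smul, add_zero, add_sub_cancel, hv, hw] at hslope
    linarith

theorem fderiv_le {v : V} (hv : v ≠ 0) (w : V) : fderiv ℝ N v w ≤ N w := by
  rcases eq_or_ne w 0 with rfl | hw
  · rw [_root_.map_zero, hN.map_zero]
  have hNv := inv_pos.2 (hN.pos hv)
  have hunit : fderiv ℝ N ((N v)⁻¹ • v) ((N w)⁻¹ • w) ≤ 1 := by
    by_cases h : (N w)⁻¹ • w = (N v)⁻¹ • v
    · rw [h, hN.fderiv_self (smul_ne_zero hNv.ne' hv), hN.map_inv_smul hv]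
    · exact (hN.fderiv_lt_one (hN.map_inv_smul hv) (hN.map_inv_smul hw) h).le
  rwa [hN.fderiv_smul hv hNv, _root_.map_smul, smul_eq_mul, inv_mul_le_iff₀ (hN.pos hw),
    mul_one] at hunit

theorem eq_of_fderiv_eq_one {v w : V} (hv : N v = 1) (hw : N w = 1) (h : fderiv ℝ N v w = 1) :
    w = v := by
  by_contra hvw
  exact (hN.fderiv_lt_one hv hw hvw).ne h

theorem sub_fderiv_le {v w : V} (hv : N v = 1) {ε B : ℝ} (h : ‖w - ε • v‖ ≤ B) :
    ε - fderiv ℝ N v w ≤ ‖fderiv ℝ N v‖ * B := by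
  have hle := (neg_le_abs _).trans ((fderiv ℝ N v).le_opNorm_of_le h)
  rw [map_sub, _root_.map_smul, hN.fderiv_self (hN.ne_zero_of_unit hv), hv, smul_eq_mul,
    mul_one] at hle
  linarith

end IsMinkowski

end MinkowskiNorm

section LocalFinsler

/-- The expressions of Finsler structures in a chart with image `Ω`. -/
structure IsLocalFinsler {V : Type*} [NormedAddCommGroup V] [NormedSpace ℝ V] (Ω : Set V)
    (f : V → V → ℝ) : Prop where
  isOpen : IsOpen Ω
  smooth : ContDiffOn ℝ ∞ (Function.uncurry f) (Ω ×ˢ {0}ᶜ)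
  isMinkowski : ∀ x ∈ Ω, IsMinkowski (f x)

namespace IsLocalFinsler

variable {V : Type*} [NormedAddCommGroup V] [NormedSpace ℝ V] {Ω : Set V} {f : V → V → ℝ}
  (hf : IsLocalFinsler Ω f)
include hf

theorem ne_zero_of_unit {x w : V} (hx : x ∈ Ω) (hw : f x w = 1) : w ≠ 0 :=
  (hf.isMinkowski x hx).ne_zero_of_unit hw

theorem isOpen_slit : IsOpen (Ω ×ˢ ({0}ᶜ : Set V)) := hf.isOpen.prod isOpen_compl_singleton

theorem contDiffAt {x y : V} (hx : x ∈ Ω) (hy : y ≠ 0) :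
    ContDiffAt ℝ ∞ (Function.uncurry f) (x, y) :=
  hf.smooth.contDiffAt (hf.isOpen_slit.mem_nhds ⟨hx, hy⟩)

theorem hasFDerivAt {x y : V} (hx : x ∈ Ω) (hy : y ≠ 0) :
    HasFDerivAt (Function.uncurry f) (fderiv ℝ (Function.uncurry f) (x, y)) (x, y) :=
  ((hf.contDiffAt hx hy).differentiableAt (by simp)).hasFDerivAt

theorem fderiv_fibre {x y : V} (hx : x ∈ Ω) (hy : y ≠ 0) :
    fderiv ℝ (f x) y =
      (fderiv ℝ (Function.uncurry f) (x, y)).comp (ContinuousLinearMap.inr ℝ V V) :=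
  ((hf.hasFDerivAt hx hy).comp y (hasFDerivAt_prodMk_right x y)).fderiv

theorem fderiv_apply {x y : V} (hx : x ∈ Ω) (hy : y ≠ 0) (k₁ k₂ : V) :
    fderiv ℝ (Function.uncurry f) (x, y) (k₁, k₂) =
      fderiv ℝ (Function.uncurry f) (x, y) (k₁, 0) + fderiv ℝ (f x) y k₂ := by
  rw [hf.fderiv_fibre hx hy, ContinuousLinearMap.comp_apply, ContinuousLinearMap.inr_apply,
    ← map_add, Prod.mk_add_mk, add_zero, zero_add]

theorem continuousOn_fderiv :
    ContinuousOn (fderiv ℝ (Function.uncurry f)) (Ω ×ˢ {0}ᶜ) :=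
  hf.smooth.continuousOn_fderiv_of_isOpen hf.isOpen_slit (by simp)

theorem continuousOn_fderiv_fibre :
    ContinuousOn (fun z : V × V => fderiv ℝ (f z.1) z.2) (Ω ×ˢ {0}ᶜ) :=
  (hf.continuousOn_fderiv.clm_comp continuousOn_const).congr fun _ hz => hf.fderiv_fibre hz.1 hz.2

variable [FiniteDimensional ℝ V]

theorem exists_bounds {K : Set V} (hK : IsCompact K) (hKΩ : K ⊆ Ω) :
    ∃ m > 0, ∃ M > 0, ∀ x ∈ K, ∀ y, m * ‖y‖ ≤ f x y ∧ f x y ≤ M * ‖y‖ := by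
  have := FiniteDimensional.proper_real V
  have hsphere : ∀ y ∈ Metric.sphere (0 : V) 1, y ≠ 0 := fun y hy =>
    ne_zero_of_mem_unit_sphere ⟨y, hy⟩
  have hcompact : IsCompact (K ×ˢ Metric.sphere (0 : V) 1) := hK.prod (isCompact_sphere _ _)
  have hcont : ContinuousOn (Function.uncurry f) (K ×ˢ Metric.sphere (0 : V) 1) :=
    hf.smooth.continuousOn.mono (prod_mono hKΩ hsphere)
  obtain ⟨m, hm, hmf⟩ := hcompact.exists_forall_le' hcont (a := 0) fun z hz =>
    (hf.isMinkowski _ (hKΩ hz.1)).pos (hsphere _ hz.2)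
  obtain ⟨M, hMf⟩ := hcompact.exists_bound_of_continuousOn hcont
  refine ⟨m, hm, max M 1, by positivity, fun x hx y => ?_⟩
  have hN := hf.isMinkowski x (hKΩ hx)
  rcases eq_or_ne y 0 with rfl | hy
  · simp [hN.map_zero]
  have hy' : 0 < ‖y‖ := norm_pos_iff.2 hy
  have hmem : (x, ‖y‖⁻¹ • y) ∈ K ×ˢ Metric.sphere (0 : V) 1 :=
    ⟨hx, by simp [norm_smul, inv_mul_cancel₀ hy'.ne']⟩
  have hscale : f x y = f x (‖y‖⁻¹ • y) * ‖y‖ := by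
    rw [hN.homogeneous _ _ (inv_pos.2 hy'), mul_comm, mul_inv_cancel_left₀ hy'.ne']
  rw [hscale]
  exact ⟨by gcongr; exact hmf _ hmem,
    by gcongr; exact (le_abs_self _).trans ((hMf _ hmem).trans (le_max_left _ _))⟩

theorem exists_bounds_closedBall {x₀ : V} (hx₀ : x₀ ∈ Ω) : ∃ R > 0, ∃ m > 0, ∃ M > 0,
    Metric.closedBall x₀ R ⊆ Ω ∧ ∀ x ∈ Metric.closedBall x₀ R, ∀ y,
      m * ‖y‖ ≤ f x y ∧ f x y ≤ M * ‖y‖ := by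
  have := FiniteDimensional.proper_real V
  obtain ⟨R, hR, hRΩ⟩ := Metric.nhds_basis_closedBall.mem_iff.1 (hf.isOpen.mem_nhds hx₀)
  obtain ⟨m, hm, M, hM, hb⟩ := hf.exists_bounds (isCompact_closedBall x₀ R) hRΩ
  exact ⟨R, hR, m, hm, M, hM, hRΩ, hb⟩

theorem continuousOn_uncurry : ContinuousOn (Function.uncurry f) (Ω ×ˢ univ) := by
  rintro ⟨x, y⟩ ⟨hx, -⟩
  apply ContinuousAt.continuousWithinAt
  rcases eq_or_ne y 0 with rfl | hy
  · obtain ⟨R, hR, _, -, M, -, hRΩ, hb⟩ := hf.exists_bounds_closedBall hx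
    have hbound : Tendsto (fun z : V × V => M * ‖z.2‖) (𝓝 (x, 0)) (𝓝 0) := by
      have hc : Continuous fun z : V × V => M * ‖z.2‖ := by fun_prop
      simpa using hc.tendsto (x, 0)
    have hnear : ∀ᶠ z : V × V in 𝓝 (x, 0), z.1 ∈ Metric.closedBall x R :=
      continuous_fst.continuousAt.eventually_mem (Metric.closedBall_mem_nhds x hR)
    rw [ContinuousAt, Function.uncurry_apply_pair, (hf.isMinkowski x hx).map_zero]
    refine tendsto_of_tendsto_of_tendsto_of_le_of_le' tendsto_const_nhds hbound ?_ ?_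
    · filter_upwards [hnear] with z hz using (hf.isMinkowski _ (hRΩ hz)).nonneg _
    · filter_upwards [hnear] with z hz using (hb _ hz _).2
  · exact (hf.contDiffAt hx hy).continuousAt

theorem isCompact_unit {K : Set V} (hK : IsCompact K) (hKΩ : K ⊆ Ω) :
    IsCompact {z : V × V | z.1 ∈ K ∧ f z.1 z.2 = 1} := by
  have := FiniteDimensional.proper_real V
  obtain ⟨m, hm, _, -, hb⟩ := hf.exists_bounds hK hKΩ
  have hclosed : IsClosed (K ×ˢ (univ : Set V) ∩ Function.uncurry f ⁻¹' {1}) :=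
    (hf.continuousOn_uncurry.mono (prod_mono hKΩ subset_rfl)).preimage_isClosed_of_isClosed
      (hK.isClosed.prod isClosed_univ) isClosed_singleton
  have hset : {z : V × V | z.1 ∈ K ∧ f z.1 z.2 = 1} =
      K ×ˢ (univ : Set V) ∩ Function.uncurry f ⁻¹' {1} := by
    ext z
    simp [Function.uncurry]
  rw [hset]
  refine (hK.prod (isCompact_closedBall (0 : V) m⁻¹)).of_isClosed_subset hclosed ?_
  rintro ⟨x, w⟩ ⟨⟨hx, -⟩, hw : f x w = 1⟩
  refine ⟨hx, ?_⟩
  rw [mem_closedBall_zero_iff, ← one_div, le_div_iff₀' hm, ← hw]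
  exact (hb x hx w).1

theorem isCompact_unit_fibre {x : V} (hx : x ∈ Ω) : IsCompact {w | f x w = 1} := by
  have himage := (hf.isCompact_unit isCompact_singleton (singleton_subset_iff.2 hx)).image
    continuous_snd
  convert himage using 1
  ext w
  simp

end IsLocalFinsler

end LocalFinsler

/-! ### Unit speed paths and the first variation -/

section PiecewiseDifferentiable

theorem ae_restrict_Ioc_of_forall_notMem {a b : ℝ} (P : Finset ℝ) {p : ℝ → Prop}
    (h : ∀ x ∈ Ioo a b, x ∉ P → p x) : ∀ᵐ x ∂(volume.restrict (Ioc a b)), p x := by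
  rw [ae_restrict_iff' measurableSet_Ioc]
  filter_upwards [(P.countable_toSet).ae_notMem volume,
    (countable_singleton b).ae_notMem volume] with x hx hxb hxab
  exact h x ⟨hxab.1, hxab.2.lt_of_ne hxb⟩ hx

variable {V : Type*} [NormedAddCommGroup V] [NormedSpace ℝ V] [CompleteSpace V]
  {c : ℝ → V} {a b B : ℝ}

theorem intervalIntegrable_deriv (hab : a ≤ b) (P : Finset ℝ)
    (hB : ∀ x ∈ Ioo a b, x ∉ P → ‖deriv c x‖ ≤ B) :
    IntervalIntegrable (deriv c) volume a b := by
  rw [intervalIntegrable_iff_integrableOn_Ioc_of_le hab]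
  exact Integrable.of_bound (aestronglyMeasurable_deriv c _) B
    (ae_restrict_Ioc_of_forall_notMem P hB)

theorem integral_deriv_of_piecewise (hab : a ≤ b) (hc : ContinuousOn c (Icc a b)) (P : Finset ℝ)
    (hd : ∀ x ∈ Ioo a b, x ∉ P → DifferentiableAt ℝ c x)
    (hB : ∀ x ∈ Ioo a b, x ∉ P → ‖deriv c x‖ ≤ B) :
    ∫ x in a..b, deriv c x = c b - c a :=
  integral_eq_of_hasDerivAt_off_countable_of_le c (deriv c) hab P.countable_toSet hc
    (fun x hx => (hd x hx.1 hx.2).hasDerivAt) (intervalIntegrable_deriv hab P hB)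

theorem norm_sub_le_of_piecewise (hab : a ≤ b) (hc : ContinuousOn c (Icc a b)) (P : Finset ℝ)
    (hd : ∀ x ∈ Ioo a b, x ∉ P → DifferentiableAt ℝ c x)
    (hB : ∀ x ∈ Ioo a b, x ∉ P → ‖deriv c x‖ ≤ B) :
    ‖c b - c a‖ ≤ B * (b - a) := by
  rw [← integral_deriv_of_piecewise hab hc P hd hB, ← abs_of_nonneg (sub_nonneg.2 hab)]
  refine intervalIntegral.norm_integral_le_of_norm_le_const_ae ?_
  rw [uIoc_of_le hab, ← ae_restrict_iff' measurableSet_Ioc]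
  exact ae_restrict_Ioc_of_forall_notMem P hB

end PiecewiseDifferentiable

section UnitPath

/-- Unit speed paths `c : [a, b] → V` for a family `f` of norms on the tangent spaces of `V`, with
corners only at the points of `P`. -/
structure IsUnitPath {V : Type*} [NormedAddCommGroup V] [NormedSpace ℝ V] (f : V → V → ℝ)
    (c : ℝ → V) (P : Finset ℝ) (a b : ℝ) : Prop where
  continuousOn : ContinuousOn c (Icc a b)
  differentiableAt : ∀ x ∈ Ioo a b, x ∉ P → DifferentiableAt ℝ c x
  unit : ∀ x ∈ Ioo a b, x ∉ P → f (c x) (deriv c x) = 1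

namespace IsUnitPath

variable {V : Type*} [NormedAddCommGroup V] [NormedSpace ℝ V] {f : V → V → ℝ} {c : ℝ → V}
  {P : Finset ℝ} {a b : ℝ} (hc : IsUnitPath f c P a b)
include hc

variable {B : Set V} (hB : MapsTo c (Icc a b) B) {m : ℝ} (hm : 0 < m)
  (hmf : ∀ x ∈ B, ∀ y, m * ‖y‖ ≤ f x y)
include hB hm hmf

theorem norm_deriv_le : ∀ x ∈ Ioo a b, x ∉ P → ‖deriv c x‖ ≤ m⁻¹ := by
  intro x hx hxP
  rw [← one_div, le_div_iff₀' hm, ← hc.unit x hx hxP]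
  exact hmf _ (hB (Ioo_subset_Icc_self hx)) _

variable [CompleteSpace V] (hab : a ≤ b)
include hab

theorem norm_sub_le : ‖c b - c a‖ ≤ m⁻¹ * (b - a) :=
  norm_sub_le_of_piecewise hab hc.continuousOn P hc.differentiableAt (hc.norm_deriv_le hB hm hmf)

theorem intervalIntegrable_clm (ξ : V →L[ℝ] ℝ) :
    IntervalIntegrable (fun x => ξ (deriv c x)) volume a b :=
  have h := intervalIntegrable_deriv hab P (hc.norm_deriv_le hB hm hmf)
  ⟨ξ.integrable_comp h.1, ξ.integrable_comp h.2⟩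

theorem integral_clm (ξ : V →L[ℝ] ℝ) : ∫ x in a..b, ξ (deriv c x) = ξ (c b - c a) := by
  have h := hc.norm_deriv_le hB hm hmf
  rw [ξ.intervalIntegral_comp_comm (intervalIntegrable_deriv hab P h),
    integral_deriv_of_piecewise hab hc.continuousOn P hc.differentiableAt h]

theorem integral_le_of_le_defect (ξ : V →L[ℝ] ℝ) {g : ℝ → ℝ} (hg_nonneg : ∀ x ∈ Icc a b, 0 ≤ g x)
    {A κ : ℝ} (hg : ∀ x ∈ Ioo a b, x ∉ P → g x ≤ A + κ * (1 - ξ (deriv c x))) :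
    ∫ x in a..b, g x ≤ (b - a) * A + κ * (b - a - ξ (c b - c a)) := by
  have hξ := hc.intervalIntegrable_clm hB hm hmf hab ξ
  have hdefect := (intervalIntegrable_const (c := (1 : ℝ))).sub hξ
  calc ∫ x in a..b, g x
      ≤ ∫ x in a..b, (A + κ * (1 - ξ (deriv c x))) := by
        rw [intervalIntegral.integral_of_le hab, intervalIntegral.integral_of_le hab]
        exact integral_mono_of_nonneg
          (ae_restrict_Ioc_of_forall_notMem P fun x hx _ => hg_nonneg x (Ioo_subset_Icc_self hx))
          (intervalIntegrable_const.add (hdefect.const_mul κ)).1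
          (ae_restrict_Ioc_of_forall_notMem P hg)
    _ = (b - a) * A + κ * (b - a - ξ (c b - c a)) := by
        rw [intervalIntegral.integral_add intervalIntegrable_const (hdefect.const_mul κ),
          intervalIntegral.integral_const_mul,
          intervalIntegral.integral_sub intervalIntegrable_const hξ,
          intervalIntegral.integral_const, intervalIntegral.integral_const,
          hc.integral_clm hB hm hmf hab, smul_eq_mul, smul_eq_mul, mul_one]

end IsUnitPath

end UnitPath

section Variation

theorem exists_forall_norm_sub_fderiv_le {E G : Type*} [NormedAddCommGroup E] [NormedSpace ℝ E]
    [NormedAddCommGroup G] [NormedSpace ℝ G] {U K : Set E} {g : E → G} (hU : IsOpen U)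
    (hg : ContDiffOn ℝ 1 g U) (hK : IsCompact K) (hKU : K ⊆ U) {η : ℝ} (hη : 0 < η) :
    ∃ r > 0, ∀ z ∈ K, ∀ k, ‖k‖ < r → ‖g (z + k) - g z - fderiv ℝ g z k‖ ≤ η * ‖k‖ := by
  have hlocal : ∀ᶠ k : E in 𝓝 0, ∀ z ∈ K, ‖g (z + k) - g z - fderiv ℝ g z k‖ ≤ η * ‖k‖ := by
    refine hK.eventually_forall_of_forall_eventually fun z hz => ?_
    have hpair : Tendsto (fun q : E × E => (q.2 + q.1, q.2)) (𝓝 (0, z)) (𝓝 (z, z)) := by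
      have h : Continuous fun q : E × E => (q.2 + q.1, q.2) := by fun_prop
      simpa using h.tendsto (0, z)
    have hstrict := ((hg.contDiffAt (hU.mem_nhds (hKU hz))).hasStrictFDerivAt (by simp)).isLittleO
    have hfderiv : ∀ᶠ z' in 𝓝 z, ‖fderiv ℝ g z - fderiv ℝ g z'‖ < η / 2 := by
      have h := (hg.continuousOn_fderiv_of_isOpen hU le_rfl).continuousAt (hU.mem_nhds (hKU hz))
      simpa [dist_eq_norm'] using Metric.continuousAt_iff'.1 h (η / 2) (half_pos hη)
    filter_upwards [hpair.eventually (hstrict.bound (half_pos hη)),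
      (continuous_snd.tendsto (0, z)).eventually hfderiv] with ⟨k, z'⟩ hz' hk
    rw [add_sub_cancel_left] at hz'
    calc ‖g (z' + k) - g z' - fderiv ℝ g z' k‖
        = ‖(g (z' + k) - g z' - fderiv ℝ g z k) + (fderiv ℝ g z - fderiv ℝ g z') k‖ := by
          rw [_root_.sub_apply]; congr 1; abel
      _ ≤ η / 2 * ‖k‖ + ‖fderiv ℝ g z - fderiv ℝ g z'‖ * ‖k‖ :=
          norm_add_le_of_le hz' (ContinuousLinearMap.le_opNorm _ _)
      _ ≤ η / 2 * ‖k‖ + η / 2 * ‖k‖ := by gcongr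
      _ = η * ‖k‖ := by ring
  obtain ⟨r, hr, hball⟩ := Metric.eventually_nhds_iff.1 hlocal
  exact ⟨r, hr, fun z hz k hk => hball (by rwa [dist_zero_right]) z hz⟩

theorem exists_norm_lt_add_mul {X E : Type*} [TopologicalSpace X] [NormedAddCommGroup E]
    {S : Set X} (hS : IsCompact S) {D : X → E} {φ : X → ℝ} (hD : ContinuousOn D S)
    (hφ : ContinuousOn φ S) (hφ_nonneg : ∀ w ∈ S, 0 ≤ φ w) (hzero : ∀ w ∈ S, φ w = 0 → D w = 0)
    {η : ℝ} (hη : 0 < η) : ∃ C ≥ 0, ∀ w ∈ S, ‖D w‖ < η + C * φ w := by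
  suffices h : ∃ C ≥ 0, ∀ w ∈ S ∩ S, ‖D w‖ < η + C * φ w by rwa [inter_self] at h
  refine hS.induction_on (p := fun T => ∃ C ≥ 0, ∀ w ∈ T ∩ S, ‖D w‖ < η + C * φ w)
    ⟨0, le_rfl, by simp⟩
    (fun T T' hT ⟨C, hC, h⟩ => ⟨C, hC, fun w hw => h w ⟨hT hw.1, hw.2⟩⟩) ?_ fun w hw => ?_
  · rintro T T' ⟨C, hC, h⟩ ⟨C', -, h'⟩
    refine ⟨max C C', hC.trans (le_max_left _ _), fun w ⟨hwT, hwS⟩ => ?_⟩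
    have hφw := hφ_nonneg w hwS
    rcases hwT with hwT | hwT
    · exact (h w ⟨hwT, hwS⟩).trans_le (by gcongr; exact le_max_left _ _)
    · exact (h' w ⟨hwT, hwS⟩).trans_le (by gcongr; exact le_max_right _ _)
  · obtain ⟨C, hC, h⟩ : ∃ C ≥ 0, ‖D w‖ < η + C * φ w := by
      rcases (hφ_nonneg w hw).eq_or_lt' with h0 | hpos
      · exact ⟨0, le_rfl, by simpa [hzero w hw h0] using hη⟩
      · refine ⟨‖D w‖ / φ w, by positivity, ?_⟩
        rw [div_mul_cancel₀ _ hpos.ne']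
        linarith
    have hnear : ∀ᶠ w' in 𝓝[S] w, ‖D w'‖ < η + C * φ w' :=
      ((hD w hw).norm).eventually_lt (continuousWithinAt_const.add
        (continuousWithinAt_const.mul (hφ w hw))) h
    exact ⟨_, hnear, C, hC, fun w' hw' => hw'.1⟩

theorem add_smul_mem_closedBall {E : Type*} [SeminormedAddCommGroup E] [NormedSpace ℝ E]
    {x₀ x h : E} {R t : ℝ} (hx : ‖x - x₀‖ ≤ R / 2) (hh : ‖h‖ ≤ R / 2) (ht : t ∈ Icc 0 1) :
    x + t • h ∈ Metric.closedBall x₀ R := by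
  have hR : 0 ≤ R / 2 := (norm_nonneg h).trans hh
  refine (convex_closedBall x₀ R).add_smul_mem ?_ ?_ ht <;> rw [mem_closedBall_iff_norm]
  · linarith
  · rw [add_sub_right_comm, ← add_halves R]
    exact norm_add_le_of_le hx hh

namespace IsLocalFinsler

variable {V : Type*} [NormedAddCommGroup V] [NormedSpace ℝ V] [FiniteDimensional ℝ V] {Ω : Set V}
  {f : V → V → ℝ} (hf : IsLocalFinsler Ω f) {x₀ v : V} (hx₀ : x₀ ∈ Ω)
include hf hx₀

theorem exists_unit_expansion {η : ℝ} (hη : 0 < η) : ∃ C ≥ 0, ∃ r > 0, ∀ᶠ x in 𝓝 x₀, ∀ w,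
    f x w = 1 → ∀ h k : V, ‖h‖ < r → ‖k‖ < r →
      f (x + h) (w + k) ≤ 1 + fderiv ℝ (f x) w k + C * ‖h‖ + η * max ‖h‖ ‖k‖ := by
  have := FiniteDimensional.proper_real V
  obtain ⟨R, hR, hRΩ⟩ := Metric.nhds_basis_closedBall.mem_iff.1 (hf.isOpen.mem_nhds hx₀)
  have hK := hf.isCompact_unit (isCompact_closedBall x₀ R) hRΩ
  have hsub : {z : V × V | z.1 ∈ Metric.closedBall x₀ R ∧ f z.1 z.2 = 1} ⊆ Ω ×ˢ {0}ᶜ :=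
    fun z hz => ⟨hRΩ hz.1, hf.ne_zero_of_unit (hRΩ hz.1) hz.2⟩
  obtain ⟨C, hC⟩ := hK.exists_bound_of_continuousOn (hf.continuousOn_fderiv.mono hsub)
  obtain ⟨r, hr, hexp⟩ := exists_forall_norm_sub_fderiv_le hf.isOpen_slit
    (hf.smooth.of_le (by simp)) hK hsub hη
  refine ⟨max C 0, le_max_right _ _, r, hr, ?_⟩
  filter_upwards [Metric.closedBall_mem_nhds x₀ hR] with x hx w hw h k hh hk
  have hremainder := (Real.le_norm_self _).trans (hexp (x, w) ⟨hx, hw⟩ (h, k) (max_lt hh hk))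
  have hbase : fderiv ℝ (Function.uncurry f) (x, w) (h, 0) ≤ max C 0 * ‖h‖ := by
    refine (Real.le_norm_self _).trans ((ContinuousLinearMap.le_opNorm _ _).trans ?_)
    rw [Prod.norm_mk, norm_zero, max_eq_left (norm_nonneg h)]
    gcongr
    exact (hC (x, w) ⟨hx, hw⟩).trans (le_max_left _ _)
  rw [hf.fderiv_apply (hRΩ hx) (hf.ne_zero_of_unit (hRΩ hx) hw), Prod.mk_add_mk, Prod.norm_mk]
    at hremainder
  simp only [Function.uncurry_apply_pair, hw] at hremainder
  linarith

variable (hv : f x₀ v = 1)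
include hv

-- By strict convexity the defect `1 - ξ w` of a unit vector `w` vanishes only at `w = v`.
theorem exists_fderiv_close {η : ℝ} (hη : 0 < η) :
    ∃ C ≥ 0, ∀ᶠ x in 𝓝 x₀, ∀ w, f x w = 1 →
      ‖fderiv ℝ (f x) w - fderiv ℝ (f x₀) v‖ < η + C * (1 - fderiv ℝ (f x₀) v w) := by
  have := FiniteDimensional.proper_real V
  set ξ := fderiv ℝ (f x₀) v with hξ
  have hN := hf.isMinkowski x₀ hx₀
  obtain ⟨R, hR, hRΩ⟩ := Metric.nhds_basis_closedBall.mem_iff.1 (hf.isOpen.mem_nhds hx₀)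
  set S := {z : V × V | z.1 ∈ Metric.closedBall x₀ R ∧ f z.1 z.2 = 1}
  have hS : IsCompact S := hf.isCompact_unit (isCompact_closedBall x₀ R) hRΩ
  have hcont : ContinuousOn (fun z : V × V => fderiv ℝ (f z.1) z.2 - ξ) S :=
    (hf.continuousOn_fderiv_fibre.mono fun z hz =>
      ⟨hRΩ hz.1, hf.ne_zero_of_unit (hRΩ hz.1) hz.2⟩).sub continuousOn_const
  obtain ⟨C, hC, hclose⟩ := exists_norm_lt_add_mul (hf.isCompact_unit_fibre hx₀)
    (D := fun w => fderiv ℝ (f x₀) w - ξ) (φ := fun w => 1 - ξ w)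
    (hcont.comp (f := fun w : V => (x₀, w)) (by fun_prop)
      fun w hw => ⟨Metric.mem_closedBall_self hR.le, hw⟩)
    (by fun_prop)
    (fun w hw => sub_nonneg.2 ((hN.fderiv_le (hN.ne_zero_of_unit hv) w).trans_eq hw))
    (fun w hw h => by
      rw [hN.eq_of_fderiv_eq_one hv hw (sub_eq_zero.1 h).symm, hξ, sub_self]) hη
  refine ⟨C, hC, ?_⟩
  -- the unit vectors which violate the bound form a compact set, with no element over `x₀`
  set T := S ∩ (fun z => η + C * (1 - ξ z.2) - ‖fderiv ℝ (f z.1) z.2 - ξ‖) ⁻¹' Iic 0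
  have hT : IsCompact T := hS.of_isClosed_subset (ContinuousOn.preimage_isClosed_of_isClosed
    (ContinuousOn.sub (by fun_prop) hcont.norm) hS.isClosed isClosed_Iic) inter_subset_left
  have hx₀T : x₀ ∉ Prod.fst '' T := by
    rintro ⟨⟨x, w⟩, ⟨⟨-, hw⟩, hviol⟩, rfl⟩
    exact (sub_pos.2 (hclose w hw)).not_ge hviol
  filter_upwards [Metric.closedBall_mem_nhds x₀ hR,
    (hT.image continuous_fst).isClosed.isOpen_compl.mem_nhds hx₀T] with x hx hxT w hw
  by_contra! hviol
  exact hxT ⟨(x, w), ⟨⟨hx, hw⟩, sub_nonpos.2 hviol⟩, rfl⟩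

theorem exists_perturbed_speed_le {η : ℝ} (hη : 0 < η) : ∃ C₁ ≥ 0, ∃ C₂ ≥ 0, ∃ r > 0,
    ∀ᶠ x in 𝓝 x₀, ∀ w, f x w = 1 → ∀ (h : V) (t ε : ℝ), t ∈ Icc 0 1 → 0 < ε → ε ≤ 1 →
      ‖h‖ < ε * r → f (x + t • h) (w + (1 / ε) • h) ≤
        1 + 1 / ε * (fderiv ℝ (f x₀) v h +
          (η + C₁ * ε + C₂ * (1 - fderiv ℝ (f x₀) v w)) * ‖h‖) := by
  set ξ := fderiv ℝ (f x₀) v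
  obtain ⟨C₁, hC₁, r, hr, hexp⟩ := hf.exists_unit_expansion hx₀ (half_pos hη)
  obtain ⟨C₂, hC₂, hclose⟩ := hf.exists_fderiv_close hx₀ hv (half_pos hη)
  refine ⟨C₁, hC₁, C₂, hC₂, r, hr, ?_⟩
  filter_upwards [hexp, hclose] with x hexpx hclosex w hw h t ε ht hε hε1 hh
  have hscale : ‖(1 / ε) • h‖ = 1 / ε * ‖h‖ := by
    rw [norm_smul, Real.norm_of_nonneg (one_div_pos.2 hε).le]
  have hth : ‖t • h‖ ≤ ‖h‖ := by
    rw [norm_smul, Real.norm_of_nonneg ht.1]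
    exact mul_le_of_le_one_left (norm_nonneg _) ht.2
  have hth' : ‖t • h‖ ≤ 1 / ε * ‖h‖ :=
    hth.trans (le_mul_of_one_le_left (norm_nonneg _) (one_le_one_div hε hε1))
  have hhr : 1 / ε * ‖h‖ < r := by rwa [one_div_mul_eq_div, div_lt_iff₀' hε]
  have hspeed := hexpx w hw (t • h) ((1 / ε) • h) (hth'.trans_lt hhr) (hscale ▸ hhr)
  rw [hscale, max_eq_right hth', _root_.map_smul, smul_eq_mul] at hspeed
  have hfibre : fderiv ℝ (f x) w h ≤ ξ h + (η / 2 + C₂ * (1 - ξ w)) * ‖h‖ := by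
    have hdiff := (Real.le_norm_self _).trans
      (ContinuousLinearMap.le_of_opNorm_le _ (hclosex w hw).le h)
    rw [_root_.sub_apply] at hdiff
    linarith
  calc f (x + t • h) (w + (1 / ε) • h)
      ≤ 1 + 1 / ε * fderiv ℝ (f x) w h + C₁ * ‖t • h‖ + η / 2 * (1 / ε * ‖h‖) := hspeed
    _ ≤ 1 + 1 / ε * (ξ h + (η / 2 + C₂ * (1 - ξ w)) * ‖h‖) + C₁ * ‖h‖ +
        η / 2 * (1 / ε * ‖h‖) := by gcongr
    _ = 1 + 1 / ε * (ξ h + (η + C₁ * ε + C₂ * (1 - ξ w)) * ‖h‖) := by field_simp; ring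

-- First variation: moving the end of a short unit speed path, whose average velocity is near `v`,
-- by a small vector `h` makes it longer by about `ξ h` at most, because the defect `1 - ξ c'`
-- has a small integral.
theorem exists_variation {η : ℝ} (hη : 0 < η) : ∃ δ > 0, ∀ ε, 0 < ε → ε < δ → ∃ δ' > 0,
    ∀ (c : ℝ → V) (a b : ℝ) (P : Finset ℝ), b = a + ε → IsUnitPath f c P a b →
      MapsTo c (Icc a b) (Metric.ball x₀ δ) → ‖c b - c a - ε • v‖ ≤ δ * ε → ∀ h : V, ‖h‖ < δ' →
      (∀ x ∈ Icc a b, c x + ((x - a) / ε) • h ∈ Ω) ∧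
      ∫ x in a..b, f (c x + ((x - a) / ε) • h) (deriv c x + (1 / ε) • h) ≤
        ε + fderiv ℝ (f x₀) v h + η * ‖h‖ := by
  set ξ := fderiv ℝ (f x₀) v
  obtain ⟨R, hR, m, hm, _, -, hRΩ, hb⟩ := hf.exists_bounds_closedBall hx₀
  obtain ⟨C₁, hC₁, C₂, hC₂, r, hr, hev⟩ := hf.exists_perturbed_speed_le hx₀ hv (half_pos hη)
  obtain ⟨R', hR', hspeed⟩ := Metric.eventually_nhds_iff_ball.1 hev
  obtain ⟨δ₀, hδ₀, hCδ₀⟩ := exists_pos_mul_lt (half_pos hη) (C₁ + C₂ * ‖ξ‖)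
  set δ := min (min (R / 2) R') (min 1 δ₀)
  have hδR : δ ≤ R / 2 := (min_le_left _ _).trans (min_le_left _ _)
  have hCδ : (C₁ + C₂ * ‖ξ‖) * δ ≤ η / 2 := le_trans (by gcongr; simp [δ]) hCδ₀.le
  refine ⟨δ, by positivity, fun ε hε hεδ => ⟨min (R / 2) (ε * r), by positivity, ?_⟩⟩
  rintro c a b P rfl hc hcδ havg h hh
  have hcR : MapsTo c (Icc a (a + ε)) (Metric.closedBall x₀ R) := fun x hx =>
    Metric.ball_subset_closedBall (Metric.ball_subset_ball (by linarith) (hcδ hx))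
  have ht : ∀ x ∈ Icc a (a + ε), (x - a) / ε ∈ Icc (0 : ℝ) 1 := fun x hx =>
    ⟨div_nonneg (by linarith [hx.1]) hε.le, (div_le_one hε).2 (by linarith [hx.2])⟩
  have hΩ : ∀ x ∈ Icc a (a + ε), c x + ((x - a) / ε) • h ∈ Ω := fun x hx =>
    hRΩ (add_smul_mem_closedBall ((mem_ball_iff_norm.1 (hcδ hx)).le.trans hδR)
      (hh.le.trans (min_le_left _ _)) (ht x hx))
  refine ⟨hΩ, ?_⟩
  have hdefect : ε - ξ (c (a + ε) - c a) ≤ ‖ξ‖ * (δ * ε) :=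
    (hf.isMinkowski x₀ hx₀).sub_fderiv_le hv havg
  have hint := hc.integral_le_of_le_defect hcR hm (fun x hx y => (hb x hx y).1) (by linarith) ξ
    (A := 1 + 1 / ε * (ξ h + (η / 2 + C₁ * ε) * ‖h‖)) (κ := 1 / ε * (C₂ * ‖h‖))
    (fun x hx => (hf.isMinkowski _ (hΩ x hx)).nonneg (deriv c x + (1 / ε) • h)) fun x hx hxP => by
      have hxI := Ioo_subset_Icc_self hx
      refine (hspeed (c x) (Metric.ball_subset_ball (by simp [δ]) (hcδ hxI)) _ (hc.unit x hx hxP)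
        h _ ε (ht x hxI) hε (hεδ.le.trans (by simp [δ])) (hh.trans_le (min_le_right _ _))).trans_eq
        ?_
      ring
  rw [add_sub_cancel_left] at hint
  calc _ ≤ ε * (1 + 1 / ε * (ξ h + (η / 2 + C₁ * ε) * ‖h‖)) +
        1 / ε * (C₂ * ‖h‖) * (ε - ξ (c (a + ε) - c a)) := hint
    _ ≤ ε * (1 + 1 / ε * (ξ h + (η / 2 + C₁ * ε) * ‖h‖)) +
        1 / ε * (C₂ * ‖h‖) * (‖ξ‖ * (δ * ε)) := by gcongr
    _ = ε + ξ h + (η / 2 + C₁ * ε + C₂ * ‖ξ‖ * δ) * ‖h‖ := by field_simp; ring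
    _ ≤ ε + ξ h + η * ‖h‖ := by
        gcongr
        linarith [mul_le_mul_of_nonneg_left hεδ.le hC₁]

end IsLocalFinsler

end Variation

/-! ### Charts -/

section Charts

variable {n : ℕ} {M : Type*} [TopologicalSpace M] [ChartedSpace (EuclideanSpace ℝ (Fin n)) M]

/-- The expression of a function on `TM` in the chart at `p₀`. -/
noncomputable def localExpr (F : TangentBundle (𝓡 n) M → ℝ) (p₀ : M)
    (x y : EuclideanSpace ℝ (Fin n)) : ℝ :=
  F ⟨(extChartAt (𝓡 n) p₀).symm x,
    mfderiv 𝓘(ℝ, EuclideanSpace ℝ (Fin n)) (𝓡 n) (extChartAt (𝓡 n) p₀).symm x y⟩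

/-- The derivative of the chart at `p₀`, on the tangent space at `p`. -/
noncomputable def chartDeriv (p₀ p : M) :
    TangentSpace (𝓡 n) p →L[ℝ] EuclideanSpace ℝ (Fin n) :=
  mfderiv (𝓡 n) 𝓘(ℝ, EuclideanSpace ℝ (Fin n)) (extChartAt (𝓡 n) p₀) p

variable {F : TangentBundle (𝓡 n) M → ℝ} {p₀ p : M}

theorem extChartAt_target_mem_nhds_of_mem {x : EuclideanSpace ℝ (Fin n)}
    (hx : x ∈ (extChartAt (𝓡 n) p₀).target) : (extChartAt (𝓡 n) p₀).target ∈ 𝓝 x :=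
  (isOpen_extChartAt_target p₀).mem_nhds hx

variable [IsManifold (𝓡 n) ∞ M]

theorem isManifold_one : IsManifold (𝓡 n) 1 M :=
  IsManifold.of_le (n := ∞) (by exact_mod_cast le_top)

theorem hasMFDerivAt_chart (hp : p ∈ (extChartAt (𝓡 n) p₀).source) :
    HasMFDerivAt (𝓡 n) 𝓘(ℝ, EuclideanSpace ℝ (Fin n)) (extChartAt (𝓡 n) p₀) p
      (chartDeriv p₀ p) := by
  have := isManifold_one (n := n) (M := M)
  rw [extChartAt_source] at hp
  exact (mdifferentiableAt_extChartAt hp).hasMFDerivAt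

theorem mdifferentiableAt_chart_symm {x : EuclideanSpace ℝ (Fin n)}
    (hx : x ∈ (extChartAt (𝓡 n) p₀).target) :
    MDifferentiableAt 𝓘(ℝ, EuclideanSpace ℝ (Fin n)) (𝓡 n) (extChartAt (𝓡 n) p₀).symm x := by
  have := isManifold_one (n := n) (M := M)
  have h := mdifferentiableWithinAt_extChartAt_symm hx
  simpa [mdifferentiableWithinAt_univ] using h

theorem chartDeriv_symm_apply {x : EuclideanSpace ℝ (Fin n)}
    (hx : x ∈ (extChartAt (𝓡 n) p₀).target) (y : EuclideanSpace ℝ (Fin n)) :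
    chartDeriv p₀ ((extChartAt (𝓡 n) p₀).symm x)
      (mfderiv 𝓘(ℝ, EuclideanSpace ℝ (Fin n)) (𝓡 n) (extChartAt (𝓡 n) p₀).symm x y) = y := by
  have := isManifold_one (n := n) (M := M)
  have h := mfderiv_extChartAt_comp_mfderivWithin_extChartAt_symm hx
  simp only [modelWithCornersSelf_coe, range_id, mfderivWithin_univ] at h
  exact congrArg (fun T => T y) h

theorem symm_chartDeriv_apply {x : EuclideanSpace ℝ (Fin n)}
    (hx : x ∈ (extChartAt (𝓡 n) p₀).target)
    (v : TangentSpace (𝓡 n) ((extChartAt (𝓡 n) p₀).symm x)) :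
    mfderiv 𝓘(ℝ, EuclideanSpace ℝ (Fin n)) (𝓡 n) (extChartAt (𝓡 n) p₀).symm x
      (chartDeriv p₀ ((extChartAt (𝓡 n) p₀).symm x) v) = v := by
  have := isManifold_one (n := n) (M := M)
  have h := mfderivWithin_extChartAt_symm_comp_mfderiv_extChartAt hx
  simp only [modelWithCornersSelf_coe, range_id, mfderivWithin_univ] at h
  exact congrArg (fun T => T v) h

theorem localExpr_chartDeriv (hp : p ∈ (extChartAt (𝓡 n) p₀).source)
    (v : TangentSpace (𝓡 n) p) :
    localExpr F p₀ (extChartAt (𝓡 n) p₀ p) (chartDeriv p₀ p v) = F ⟨p, v⟩ := by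
  obtain ⟨x, hx, rfl⟩ : ∃ x ∈ (extChartAt (𝓡 n) p₀).target, (extChartAt (𝓡 n) p₀).symm x = p :=
    ⟨_, (extChartAt (𝓡 n) p₀).map_source hp, (extChartAt (𝓡 n) p₀).left_inv hp⟩
  rw [(extChartAt (𝓡 n) p₀).right_inv hx, localExpr, symm_chartDeriv_apply hx]

theorem chartDeriv_bijective (hp : p ∈ (extChartAt (𝓡 n) p₀).source) :
    Function.Bijective (chartDeriv (n := n) p₀ p) := by
  obtain ⟨x, hx, rfl⟩ : ∃ x ∈ (extChartAt (𝓡 n) p₀).target, (extChartAt (𝓡 n) p₀).symm x = p :=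
    ⟨_, (extChartAt (𝓡 n) p₀).map_source hp, (extChartAt (𝓡 n) p₀).left_inv hp⟩
  exact ⟨Function.LeftInverse.injective (symm_chartDeriv_apply hx),
    Function.RightInverse.surjective (chartDeriv_symm_apply hx)⟩

theorem fundamentalTensor_chart (hp : p ∈ (extChartAt (𝓡 n) p₀).source)
    (y u v : TangentSpace (𝓡 n) p) :
    fundamentalTensor (fun w : TangentSpace (𝓡 n) p => F ⟨p, w⟩) y u v =
      fundamentalTensor (localExpr F p₀ (extChartAt (𝓡 n) p₀ p)) (chartDeriv p₀ p y)
        (chartDeriv p₀ p u) (chartDeriv p₀ p v) := by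
  have h := fundamentalTensor_comp_linear (localExpr F p₀ (extChartAt (𝓡 n) p₀ p))
    (chartDeriv p₀ p).toLinearMap y u v
  rw [ContinuousLinearMap.coe_coe] at h
  rw [← h]
  congr 1
  funext w
  exact (localExpr_chartDeriv hp w).symm

theorem contMDiffOn_chart_symm :
    ContMDiffOn 𝓘(ℝ, EuclideanSpace ℝ (Fin n)) (𝓡 n) ∞ (extChartAt (𝓡 n) p₀).symm
      (extChartAt (𝓡 n) p₀).target := contMDiffOn_extChartAt_symm p₀

theorem mfderiv_chart_symm_ne_zero {x y : EuclideanSpace ℝ (Fin n)}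
    (hx : x ∈ (extChartAt (𝓡 n) p₀).target) (hy : y ≠ 0) :
    mfderiv 𝓘(ℝ, EuclideanSpace ℝ (Fin n)) (𝓡 n) (extChartAt (𝓡 n) p₀).symm x y ≠ 0 := by
  intro h
  have hback := chartDeriv_symm_apply hx y
  rw [h] at hback
  exact hy (hback.symm.trans (_root_.map_zero _))

theorem contMDiff_toTangentBundle (E : Type*) [NormedAddCommGroup E] [NormedSpace ℝ E] :
    ContMDiff 𝓘(ℝ, E × E) 𝓘(ℝ, E).tangent ∞
      (fun z : E × E => (⟨z.1, z.2⟩ : TangentBundle 𝓘(ℝ, E) E)) := by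
  intro z
  rw [Bundle.contMDiffAt_totalSpace]
  refine ⟨contDiff_fst.contMDiff z, ?_⟩
  simpa only [trivializationAt_model_space_apply] using contDiff_snd.contMDiff z

theorem contDiffOn_localExpr (hF : ContMDiffOn (𝓡 n).tangent 𝓘(ℝ, ℝ) ∞ F {v | v.2 ≠ 0})
    (p₀ : M) :
    ContDiffOn ℝ ∞ (Function.uncurry (localExpr F p₀))
      ((extChartAt (𝓡 n) p₀).target ×ˢ {0}ᶜ) := by
  have hsymm : ContMDiffOn (𝓡 n).tangent (𝓡 n).tangent ∞
      (tangentMapWithin 𝓘(ℝ, EuclideanSpace ℝ (Fin n)) (𝓡 n) (extChartAt (𝓡 n) p₀).symm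
        (extChartAt (𝓡 n) p₀).target) _ :=
    contMDiffOn_chart_symm.contMDiffOn_tangentMapWithin (m := ∞) le_rfl
      (isOpen_extChartAt_target p₀).uniqueMDiffOn
  have hcomp := hF.comp (hsymm.comp (contMDiff_toTangentBundle _).contMDiffOn
    (s := (extChartAt (𝓡 n) p₀).target ×ˢ {0}ᶜ) fun z hz => hz.1) fun z hz => ?_
  · rw [contMDiffOn_iff_contDiffOn] at hcomp
    refine hcomp.congr fun z hz => ?_
    simp only [Function.comp_apply, tangentMapWithin, Function.uncurry, localExpr]
    rw [mfderivWithin_of_mem_nhds (extChartAt_target_mem_nhds_of_mem hz.1)]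
  · simp only [Function.comp_apply, tangentMapWithin, mem_preimage, mem_ofPred_eq]
    rw [mfderivWithin_of_mem_nhds (extChartAt_target_mem_nhds_of_mem hz.1)]
    exact mfderiv_chart_symm_ne_zero hz.1 hz.2

theorem IsFinslerStructure.isLocalFinsler (hF : IsFinslerStructure F) (p₀ : M) :
    IsLocalFinsler (extChartAt (𝓡 n) p₀).target (localExpr F p₀) where
  isOpen := isOpen_extChartAt_target p₀
  smooth := contDiffOn_localExpr hF.smooth p₀
  isMinkowski x hx :=
    { nonneg := fun y => hF.nonneg _
      smooth := (contDiffOn_localExpr hF.smooth p₀).comp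
        (f := fun y : EuclideanSpace ℝ (Fin n) => (x, y)) (by fun_prop) fun y hy => ⟨hx, hy⟩
      homogeneous := fun y c hc => by
        rw [localExpr, localExpr, ← hF.homogeneous _ _ c hc]
        congr 2
        exact _root_.map_smul _ c y
      posDef := fun y hy u hu =>
        (hF.posDef _ _ (mfderiv_chart_symm_ne_zero hx hy) _
          (mfderiv_chart_symm_ne_zero hx hu)).trans_eq
          (fundamentalTensor_comp_linear
            (fun w : TangentSpace (𝓡 n) ((extChartAt (𝓡 n) p₀).symm x) => F ⟨_, w⟩)
            (mfderiv 𝓘(ℝ, EuclideanSpace ℝ (Fin n)) (𝓡 n)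
              (extChartAt (𝓡 n) p₀).symm x).toLinearMap y u u).symm }

theorem hasDerivWithinAt_chart_comp {γ : ℝ → M} {J : Set ℝ} {x : ℝ}
    (hγ : MDifferentiableWithinAt 𝓘(ℝ, ℝ) (𝓡 n) γ J x)
    (hx : γ x ∈ (extChartAt (𝓡 n) p₀).source) :
    HasDerivWithinAt (fun t => extChartAt (𝓡 n) p₀ (γ t))
      (chartDeriv p₀ (γ x) (mfderivWithin 𝓘(ℝ, ℝ) (𝓡 n) γ J x (1 : ℝ))) J x := by
  have h := (hasMFDerivAt_chart hx).comp_hasMFDerivWithinAt x hγ.hasMFDerivWithinAt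
  have h' : HasFDerivWithinAt (fun t => extChartAt (𝓡 n) p₀ (γ t))
      ((chartDeriv p₀ (γ x)).comp (mfderivWithin 𝓘(ℝ, ℝ) (𝓡 n) γ J x) :
        ℝ →L[ℝ] EuclideanSpace ℝ (Fin n)) J x := h.hasFDerivWithinAt
  exact h'.hasDerivWithinAt

theorem hasDerivAt_chart_comp {γ : ℝ → M} {x : ℝ}
    (hγ : MDifferentiableAt 𝓘(ℝ, ℝ) (𝓡 n) γ x)
    (hx : γ x ∈ (extChartAt (𝓡 n) p₀).source) :
    HasDerivAt (fun t => extChartAt (𝓡 n) p₀ (γ t))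
      (chartDeriv p₀ (γ x) (mfderiv 𝓘(ℝ, ℝ) (𝓡 n) γ x (1 : ℝ))) x := by
  rw [← hasDerivWithinAt_univ, ← mfderivWithin_univ]
  exact hasDerivWithinAt_chart_comp hγ.mdifferentiableWithinAt hx

theorem localExpr_derivWithin {γ : ℝ → M} {J : Set ℝ} {x : ℝ}
    (hγ : MDifferentiableWithinAt 𝓘(ℝ, ℝ) (𝓡 n) γ J x)
    (hx : γ x ∈ (extChartAt (𝓡 n) p₀).source) (hJ : UniqueDiffWithinAt ℝ J x) :
    localExpr F p₀ (extChartAt (𝓡 n) p₀ (γ x))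
      (derivWithin (fun t => extChartAt (𝓡 n) p₀ (γ t)) J x) = F (velocityWithin γ J x) := by
  rw [(hasDerivWithinAt_chart_comp hγ hx).derivWithin hJ, localExpr_chartDeriv hx]
  rfl

theorem localExpr_deriv {γ : ℝ → M} {x : ℝ}
    (hγ : MDifferentiableAt 𝓘(ℝ, ℝ) (𝓡 n) γ x)
    (hx : γ x ∈ (extChartAt (𝓡 n) p₀).source) :
    localExpr F p₀ (extChartAt (𝓡 n) p₀ (γ x)) (deriv (fun t => extChartAt (𝓡 n) p₀ (γ t)) x) =
      F (velocity γ x) := by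
  rw [← derivWithin_univ,
    localExpr_derivWithin hγ.mdifferentiableWithinAt hx uniqueDiffWithinAt_univ, velocityWithin,
    mfderivWithin_univ, velocity]

theorem mdifferentiableAt_chart_symm_comp {c : ℝ → EuclideanSpace ℝ (Fin n)} {x : ℝ}
    (hc : DifferentiableAt ℝ c x) (hx : c x ∈ (extChartAt (𝓡 n) p₀).target) :
    MDifferentiableAt 𝓘(ℝ, ℝ) (𝓡 n) (fun t => (extChartAt (𝓡 n) p₀).symm (c t)) x :=
  (mdifferentiableAt_chart_symm hx).comp x hc.mdifferentiableAt

theorem velocity_chart_symm_comp {c : ℝ → EuclideanSpace ℝ (Fin n)} {x : ℝ}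
    (hc : DifferentiableAt ℝ c x) (hx : c x ∈ (extChartAt (𝓡 n) p₀).target) :
    F (velocity (fun t => (extChartAt (𝓡 n) p₀).symm (c t)) x) =
      localExpr F p₀ (c x) (deriv c x) := by
  rw [← localExpr_deriv (F := F) (p₀ := p₀) (mdifferentiableAt_chart_symm_comp hc hx)
    ((extChartAt (𝓡 n) p₀).map_target hx), (extChartAt (𝓡 n) p₀).right_inv hx]
  congr 1
  refine Filter.EventuallyEq.deriv_eq ?_
  filter_upwards [hc.continuousAt (extChartAt_target_mem_nhds_of_mem hx)] with t ht
  exact (extChartAt (𝓡 n) p₀).right_inv ht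

theorem continuousOn_chart_prod_chartDeriv (p₀ : M) :
    ContinuousOn (fun v : TangentBundle (𝓡 n) M =>
      (extChartAt (𝓡 n) p₀ v.1, chartDeriv p₀ v.1 v.2))
      {v | v.1 ∈ (chartAt (EuclideanSpace ℝ (Fin n)) p₀).source} := by
  have hsource := (chartAt (EuclideanSpace ℝ (Fin n)) p₀).open_source
  have htangent := (contMDiffOn_extChartAt (I := 𝓡 n) (n := ∞)
    (x := p₀)).continuousOn_tangentMapWithin (by simp) hsource.uniqueMDiffOn
  refine ((tangentBundleModelSpaceHomeomorph
    𝓘(ℝ, EuclideanSpace ℝ (Fin n))).continuous.comp_continuousOn htangent).congr fun v hv => ?_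
  have hderiv := mfderivWithin_of_mem_nhds (I := 𝓡 n) (I' := 𝓘(ℝ, EuclideanSpace ℝ (Fin n)))
    (f := extChartAt (𝓡 n) p₀) (hsource.mem_nhds hv)
  exact congrArg (Prod.mk _) (congrArg (fun T => T v.2) hderiv).symm

theorem IsFinslerStructure.continuous (hF : IsFinslerStructure F) : Continuous F := by
  refine continuous_iff_continuousAt.2 fun v => ?_
  have hopen := (chartAt (EuclideanSpace ℝ (Fin n)) v.1).open_source.preimage
    (FiberBundle.continuous_proj (EuclideanSpace ℝ (Fin n)) (TangentSpace (𝓡 n)))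
  refine ContinuousOn.continuousAt ?_ (hopen.mem_nhds (mem_chart_source _ v.1))
  have hchart {w : TangentBundle (𝓡 n) M}
      (hw : w.1 ∈ (chartAt (EuclideanSpace ℝ (Fin n)) v.1).source) :
      w.1 ∈ (extChartAt (𝓡 n) v.1).source := (extChartAt_source (𝓡 n) v.1).symm ▸ hw
  exact ((hF.isLocalFinsler v.1).continuousOn_uncurry.comp (continuousOn_chart_prod_chartDeriv v.1)
    fun w hw => ⟨(extChartAt (𝓡 n) v.1).map_source (hchart hw), mem_univ _⟩).congr
    fun w hw => (localExpr_chartDeriv (hchart hw) w.2).symm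

theorem IsUnitSpeed.velocityWithin_Icc (hF : IsFinslerStructure F) {γ : ℝ → M} {a b : ℝ}
    (hab : a < b) (hγ : ContMDiffOn 𝓘(ℝ, ℝ) (𝓡 n) ∞ γ (Icc a b)) (hu : IsUnitSpeed F γ a b)
    {x : ℝ} (hx : x ∈ Icc a b) : F (velocityWithin γ (Icc a b) x) = 1 := by
  have hvelocity : ContinuousOn (velocityWithin (n := n) γ (Icc a b)) (Icc a b) :=
    (hγ.continuousOn_tangentMapWithin (by simp) (uniqueDiffOn_Icc hab).uniqueMDiffOn).comp
      ((contMDiff_toTangentBundle ℝ).continuous.comp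
        (Continuous.prodMk_left (1 : ℝ))).continuousOn fun t ht => ht
  refine EqOn.of_subset_closure (fun t ht => ?_) (hF.continuous.comp_continuousOn hvelocity)
    (continuousOn_const (c := (1 : ℝ))) Ioo_subset_Icc_self (closure_Ioo hab.ne).symm.subset hx
  rw [Function.comp_apply, velocityWithin, mfderivWithin_of_mem_nhds (Icc_mem_nhds ht.1 ht.2)]
  exact hu t ht ((hγ.contMDiffAt (Icc_mem_nhds ht.1 ht.2)).mdifferentiableAt (by simp))

end Charts

/-! ### Curves and distances -/

/-- The curve `γ₁` on `[0, ℓ]`, followed by `γ₂`. -/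
noncomputable def concat {X : Type*} (γ₁ γ₂ : ℝ → X) (ℓ : ℝ) (x : ℝ) : X :=
  if x ≤ ℓ then γ₁ x else γ₂ (x - ℓ)

theorem concat_of_le {X : Type*} {γ₁ γ₂ : ℝ → X} {ℓ x : ℝ} (h : x ≤ ℓ) :
    concat γ₁ γ₂ ℓ x = γ₁ x :=
  if_pos h

theorem concat_of_ge {X : Type*} {γ₁ γ₂ : ℝ → X} {ℓ x : ℝ} (h0 : γ₁ ℓ = γ₂ 0) (h : ℓ ≤ x) :
    concat γ₁ γ₂ ℓ x = γ₂ (x - ℓ) := by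
  rcases h.eq_or_lt with rfl | h
  · rw [concat_of_le le_rfl, h0, sub_self]
  · exact if_neg h.not_ge

theorem compl_sdiff_singleton_mem_nhds (P : Finset ℝ) (x : ℝ) : ((P : Set ℝ) \ {x})ᶜ ∈ 𝓝 x :=
  (P.finite_toSet.subset sdiff_subset).isClosed.isOpen_compl.mem_nhds fun h => h.2 rfl

section Curves

variable {n : ℕ} {M : Type*} [TopologicalSpace M] [ChartedSpace (EuclideanSpace ℝ (Fin n)) M]

theorem IsPiecewiseSmooth.exists_left {γ : ℝ → M} {a b x : ℝ}
    (hγ : IsPiecewiseSmooth n γ a b) (ha : a < x) (hb : x ≤ b) :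
    ∃ c, a ≤ c ∧ c < x ∧ ContMDiffOn 𝓘(ℝ, ℝ) (𝓡 n) ∞ γ (Icc c x) := by
  obtain ⟨-, P, hP⟩ := hγ
  obtain ⟨c, hc, hsub⟩ := mem_nhdsLE_iff_exists_Icc_subset.1 (mem_nhdsWithin_of_mem_nhds
    (inter_mem (compl_sdiff_singleton_mem_nhds P x) (Ici_mem_nhds ha)))
  have hc' : c < x := hc
  refine ⟨c, (hsub ⟨le_rfl, hc'.le⟩).2, hc, hP c x (hsub ⟨le_rfl, hc'.le⟩).2 hc hb ?_⟩
  exact fun y hy hyI => (hsub (Ioo_subset_Icc_self hyI)).1 ⟨hy, hyI.2.ne⟩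

theorem IsPiecewiseSmooth.exists_finset {γ : ℝ → M} {a b : ℝ} (hγ : IsPiecewiseSmooth n γ a b) :
    ∃ P : Finset ℝ, ∀ x ∈ Ioo a b, x ∉ P → MDifferentiableAt 𝓘(ℝ, ℝ) (𝓡 n) γ x := by
  obtain ⟨-, P, hP⟩ := hγ
  refine ⟨P, fun x hx hxP => ?_⟩
  obtain ⟨r, hr, hsub⟩ := (nhds_basis_Icc_pos x).mem_iff.1
    (inter_mem (Ioo_mem_nhds hx.1 hx.2) (P.finite_toSet.isClosed.isOpen_compl.mem_nhds hxP))
  have hleft := (hsub ⟨le_rfl, by linarith⟩).1.1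
  have hright := (hsub ⟨by linarith, le_rfl⟩).1.2
  have hsmooth := hP (x - r) (x + r) hleft.le (by linarith) hright.le
    fun y hy hyI => (hsub (Ioo_subset_Icc_self hyI)).2 hy
  exact (hsmooth.contMDiffAt (Icc_mem_nhds (by linarith) (by linarith))).mdifferentiableAt (by simp)

theorem IsPiecewiseSmooth.mono {γ : ℝ → M} {a b a' b' : ℝ} (hγ : IsPiecewiseSmooth n γ a b)
    (ha : a ≤ a') (hb : b' ≤ b) : IsPiecewiseSmooth n γ a' b' := by
  obtain ⟨hc, P, hP⟩ := hγ
  exact ⟨hc.mono (Icc_subset_Icc ha hb), P, fun c d h1 h2 h3 =>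
    hP c d (ha.trans h1) h2 (h3.trans hb)⟩

theorem IsPiecewiseSmooth.comp_add {γ : ℝ → M} {a b τ : ℝ}
    (hγ : IsPiecewiseSmooth n γ (a + τ) (b + τ)) :
    IsPiecewiseSmooth n (fun x => γ (x + τ)) a b := by
  obtain ⟨hc, P, hP⟩ := hγ
  refine ⟨hc.comp (by fun_prop) fun x hx => ⟨by linarith [hx.1], by linarith [hx.2]⟩,
    P.image (fun x => x - τ), fun c d hac hcd hdb hcorner => ?_⟩
  have hsmooth := hP (c + τ) (d + τ) (by linarith) (by linarith) (by linarith) fun y hy hyI =>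
    hcorner (y - τ) (Finset.mem_image_of_mem _ hy) ⟨by linarith [hyI.1], by linarith [hyI.2]⟩
  have hshift : ContMDiff 𝓘(ℝ, ℝ) 𝓘(ℝ, ℝ) ∞ (fun x : ℝ => x + τ) :=
    (contDiff_id.add contDiff_const).contMDiff
  exact hsmooth.comp hshift.contMDiffOn fun x hx => ⟨by linarith [hx.1], by linarith [hx.2]⟩

theorem IsPiecewiseSmooth.concat {γ₁ γ₂ : ℝ → M} {ℓ₁ ℓ₂ : ℝ} (h₁ : IsPiecewiseSmooth n γ₁ 0 ℓ₁)
    (h₂ : IsPiecewiseSmooth n γ₂ 0 ℓ₂) (hℓ₁ : 0 ≤ ℓ₁) (hℓ₂ : 0 ≤ ℓ₂) (h0 : γ₁ ℓ₁ = γ₂ 0) :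
    IsPiecewiseSmooth n (concat γ₁ γ₂ ℓ₁) 0 (ℓ₁ + ℓ₂) := by
  have h₂' : IsPiecewiseSmooth n (fun x => γ₂ (x + -ℓ₁)) ℓ₁ (ℓ₁ + ℓ₂) :=
    IsPiecewiseSmooth.comp_add (by simpa using h₂)
  obtain ⟨hc₁, P₁, hP₁⟩ := h₁
  obtain ⟨hc₂, P₂, hP₂⟩ := h₂'
  refine ⟨?_, insert ℓ₁ (P₁ ∪ P₂), fun c d hc hcd hd hP => ?_⟩
  · rw [← Icc_union_Icc_eq_Icc hℓ₁ (by linarith : ℓ₁ ≤ ℓ₁ + ℓ₂)]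
    refine ContinuousOn.union_of_isClosed ?_ ?_ isClosed_Icc isClosed_Icc
    · exact hc₁.congr fun x hx => concat_of_le hx.2
    · exact hc₂.congr fun x hx => concat_of_ge h0 hx.1
  · have hℓ := hP ℓ₁ (Finset.mem_insert_self _ _)
    rcases le_or_gt d ℓ₁ with hdℓ | hdℓ
    · refine (hP₁ c d hc hcd hdℓ fun x hx => hP x (by simp [hx])).congr fun x hx =>
        concat_of_le (hx.2.trans hdℓ)
    · have hcℓ : ℓ₁ ≤ c := by
        by_contra h
        exact hℓ ⟨not_le.1 h, hdℓ⟩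
      exact (hP₂ c d hcℓ hcd hd fun x hx => hP x (by simp [hx])).congr fun x hx =>
        concat_of_ge h0 (hcℓ.trans hx.1)

variable {F : TangentBundle (𝓡 n) M → ℝ}

theorem velocity_congr {γ₁ γ₂ : ℝ → M} {x : ℝ} (h : γ₁ =ᶠ[𝓝 x] γ₂) :
    velocity (n := n) γ₁ x = velocity γ₂ x :=
  Bundle.TotalSpace.ext h.self_of_nhds <| heq_of_eq <|
    congrArg (fun T : ℝ →L[ℝ] EuclideanSpace ℝ (Fin n) => T 1) h.mfderiv_eq

theorem velocity_comp_add {γ : ℝ → M} {x τ : ℝ}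
    (hγ : MDifferentiableAt 𝓘(ℝ, ℝ) (𝓡 n) γ (x + τ)) :
    velocity (n := n) (fun x => γ (x + τ)) x = velocity γ (x + τ) := by
  have hshift := ((hasDerivAt_id x).add_const τ).hasFDerivAt.hasMFDerivAt
  have hcomp := (HasMFDerivAt.comp x hγ.hasMFDerivAt hshift).mfderiv
  refine Bundle.TotalSpace.ext rfl (heq_of_eq ((congrArg (fun T => T (1 : ℝ)) hcomp).trans ?_))
  exact congrArg (mfderiv 𝓘(ℝ, ℝ) (𝓡 n) γ (x + τ)) (one_smul ℝ (1 : ℝ))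

theorem mdifferentiableAt_comp_add_iff {γ : ℝ → M} {x τ : ℝ} :
    MDifferentiableAt 𝓘(ℝ, ℝ) (𝓡 n) (fun x => γ (x + τ)) x ↔
      MDifferentiableAt 𝓘(ℝ, ℝ) (𝓡 n) γ (x + τ) := by
  have hshift (σ y : ℝ) : MDifferentiableAt 𝓘(ℝ, ℝ) 𝓘(ℝ, ℝ) (fun x : ℝ => x + σ) y :=
    (differentiableAt_id.add_const σ).mdifferentiableAt
  refine ⟨fun h => ?_, fun h => h.comp x (hshift τ x)⟩
  have hback : MDifferentiableAt 𝓘(ℝ, ℝ) (𝓡 n) (fun x => γ (x + τ)) (x + τ + -τ) := by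
    simpa only [add_neg_cancel_right] using h
  simpa only [Function.comp_def, neg_add_cancel_right] using
    hback.comp (x + τ) (hshift (-τ) (x + τ))

theorem IsUnitSpeed.comp_add {γ : ℝ → M} {a b τ : ℝ} (hγ : IsUnitSpeed F γ (a + τ) (b + τ)) :
    IsUnitSpeed F (fun x => γ (x + τ)) a b := by
  intro x hx h
  rw [mdifferentiableAt_comp_add_iff] at h
  rw [velocity_comp_add h]
  exact hγ _ ⟨by linarith [hx.1], by linarith [hx.2]⟩ h

/-- Piecewise smooth unit speed curves on `[0, ℓ]`. -/
structure IsUnitCurve (F : TangentBundle (𝓡 n) M → ℝ) (γ : ℝ → M) (ℓ : ℝ) : Prop where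
  nonneg : 0 ≤ ℓ
  piecewiseSmooth : IsPiecewiseSmooth n γ 0 ℓ
  unitSpeed : IsUnitSpeed F γ 0 ℓ

theorem IsShortest.isUnitCurve {K : Set M} {q : M} {γ : ℝ → M} {ℓ : ℝ}
    (h : IsShortest F K q γ ℓ) : IsUnitCurve F γ ℓ :=
  ⟨h.nonneg, h.piecewiseSmooth, h.unitSpeed⟩

theorem IsUnitCurve.segment {γ : ℝ → M} {ℓ u v : ℝ} (h : IsUnitCurve F γ ℓ) (hu : 0 ≤ u)
    (huv : u ≤ v) (hv : v ≤ ℓ) : IsUnitCurve F (fun x => γ (x + u)) (v - u) := by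
  refine ⟨by linarith, ?_, ?_⟩
  · exact IsPiecewiseSmooth.comp_add (h.piecewiseSmooth.mono (by linarith) (by linarith))
  · exact IsUnitSpeed.comp_add fun x hx => h.unitSpeed x ⟨by linarith [hx.1], by linarith [hx.2]⟩

theorem IsUnitCurve.length_eq {γ : ℝ → M} {ℓ u v : ℝ} (h : IsUnitCurve F γ ℓ) (hu : 0 ≤ u)
    (huv : u ≤ v) (hv : v ≤ ℓ) : length F γ u v = v - u := by
  obtain ⟨P, hP⟩ := h.piecewiseSmooth.exists_finset
  calc length F γ u v = ∫ _ in u..v, (1 : ℝ) := by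
        rw [length, intervalIntegral.integral_of_le huv, intervalIntegral.integral_of_le huv]
        refine integral_congr_ae (ae_restrict_Ioc_of_forall_notMem P fun x hx hxP => ?_)
        have hx' : x ∈ Ioo 0 ℓ := ⟨hu.trans_lt hx.1, hx.2.trans_le hv⟩
        exact h.unitSpeed x hx' (hP x hx' hxP)
    _ = v - u := by rw [intervalIntegral.integral_const, smul_eq_mul, mul_one]

theorem unit_velocity_of_contMDiffOn_left [IsManifold (𝓡 n) ∞ M] (hF : IsFinslerStructure F)
    {γ : ℝ → M} {a x : ℝ} (hax : a < x) (hγ : ContMDiffOn 𝓘(ℝ, ℝ) (𝓡 n) ∞ γ (Icc a x))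
    (hu : IsUnitSpeed F γ a x) (hd : MDifferentiableAt 𝓘(ℝ, ℝ) (𝓡 n) γ x) :
    F (velocity γ x) = 1 := by
  have hunit := hu.velocityWithin_Icc hF hax hγ (right_mem_Icc.2 hax.le)
  rwa [velocityWithin, mfderivWithin_eq_mfderiv
    ((uniqueDiffOn_Icc hax).uniqueMDiffOn _ (right_mem_Icc.2 hax.le)) hd] at hunit

theorem IsUnitCurve.concat [IsManifold (𝓡 n) ∞ M] (hF : IsFinslerStructure F) {γ₁ γ₂ : ℝ → M}
    {ℓ₁ ℓ₂ : ℝ} (h₁ : IsUnitCurve F γ₁ ℓ₁) (h₂ : IsUnitCurve F γ₂ ℓ₂) (h0 : γ₁ ℓ₁ = γ₂ 0) :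
    IsUnitCurve F (concat γ₁ γ₂ ℓ₁) (ℓ₁ + ℓ₂) := by
  refine ⟨add_nonneg h₁.nonneg h₂.nonneg,
    h₁.piecewiseSmooth.concat h₂.piecewiseSmooth h₁.nonneg h₂.nonneg h0, fun x hx hd => ?_⟩
  rcases lt_trichotomy x ℓ₁ with hxℓ | rfl | hxℓ
  · have heq : Finsler.concat γ₁ γ₂ ℓ₁ =ᶠ[𝓝 x] γ₁ := by
      filter_upwards [gt_mem_nhds hxℓ] with y hy using concat_of_le hy.le
    rw [velocity_congr heq]
    exact h₁.unitSpeed x ⟨hx.1, hxℓ⟩ (hd.congr_of_eventuallyEq heq.symm)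
  · obtain ⟨c, hc, hcx, hsmooth⟩ := h₁.piecewiseSmooth.exists_left hx.1 le_rfl
    refine unit_velocity_of_contMDiffOn_left hF hcx
      (hsmooth.congr fun y hy => concat_of_le hy.2) (fun y hy hdy => ?_) hd
    have heq : Finsler.concat γ₁ γ₂ x =ᶠ[𝓝 y] γ₁ := by
      filter_upwards [gt_mem_nhds hy.2] with z hz using concat_of_le hz.le
    rw [velocity_congr heq]
    exact h₁.unitSpeed y ⟨hc.trans_lt hy.1, hy.2⟩ (hdy.congr_of_eventuallyEq heq.symm)
  · have heq : Finsler.concat γ₁ γ₂ ℓ₁ =ᶠ[𝓝 x] fun y => γ₂ (y + -ℓ₁) := by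
      filter_upwards [lt_mem_nhds hxℓ] with y hy using concat_of_ge h0 hy.le
    rw [velocity_congr heq]
    refine IsUnitSpeed.comp_add (a := ℓ₁) (b := ℓ₁ + ℓ₂) ?_ x ⟨hxℓ, hx.2⟩
      (hd.congr_of_eventuallyEq heq.symm)
    simpa only [add_neg_cancel, add_neg_cancel_comm] using h₂.unitSpeed

end Curves

section Distance

variable {n : ℕ} {M : Type*} [TopologicalSpace M] [ChartedSpace (EuclideanSpace ℝ (Fin n)) M]
  {F : TangentBundle (𝓡 n) M → ℝ}

@[simp]
theorem fdistFrom_singleton (p q : M) : fdistFrom F {p} q = fdist F p q := by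
  simp [fdistFrom]

theorem le_fdistFrom {K : Set M} (hK : K.Nonempty) {q : M} {L : ℝ}
    (h : ∀ a ∈ K, L ≤ fdist F a q) : L ≤ fdistFrom F K q := by
  refine le_csInf (hK.image _) ?_
  rintro _ ⟨a, ha, rfl⟩
  exact h a ha

theorem nonempty_of_fdistFrom_pos {K : Set M} {q : M} (h : 0 < fdistFrom F K q) :
    K.Nonempty := by
  rw [nonempty_iff_ne_empty]
  rintro rfl
  simp [fdistFrom] at h

theorem IsShortest.length_eq_fdistFrom {K : Set M} {q : M} {γ : ℝ → M} {ℓ : ℝ}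
    (h : IsShortest F K q γ ℓ) : ℓ = fdistFrom F K q := by
  rw [← h.length_eq, h.isUnitCurve.length_eq le_rfl h.nonneg le_rfl, sub_zero]

theorem IsUnitCurve.isShortest {K : Set M} {γ : ℝ → M} {ℓ : ℝ} (h : IsUnitCurve F γ ℓ)
    (h0 : γ 0 ∈ K) {q : M} (hq : γ ℓ = q) (hℓ : ℓ = fdistFrom F K q) : IsShortest F K q γ ℓ :=
  ⟨h.nonneg, h.piecewiseSmooth, h.unitSpeed, h0, hq, by
    rw [h.length_eq le_rfl h.nonneg le_rfl, sub_zero, hℓ]⟩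

/-- Any two points are joined by a shortest unit speed curve. -/
def HasShortestCurves (F : TangentBundle (𝓡 n) M → ℝ) : Prop :=
  ∀ p q : M, ∃ (γ : ℝ → M) (ℓ : ℝ), IsShortest F {p} q γ ℓ

theorem HasShortestCurves.exists_unitCurve (hmin : HasShortestCurves F) (p q : M) :
    ∃ γ : ℝ → M, IsUnitCurve F γ (fdist F p q) ∧ γ 0 = p ∧ γ (fdist F p q) = q := by
  obtain ⟨γ, ℓ, h⟩ := hmin p q
  have hℓ := h.length_eq_fdistFrom
  rw [fdistFrom_singleton] at hℓ
  exact ⟨γ, hℓ ▸ h.isUnitCurve, h.source, hℓ ▸ h.target⟩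

theorem notMem_cutLocus_iff {K : Set M} {q : M} : q ∉ cutLocus F K ↔ ∀ (ℓ : ℝ) (γ₁ γ₂ : ℝ → M),
    IsShortest F K q γ₁ ℓ → IsShortest F K q γ₂ ℓ → EqOn γ₁ γ₂ (Icc 0 ℓ) := by
  simp only [cutLocus, mem_ofPred_eq, not_exists, not_and, not_not]

/-- The rays of the waves emitted from `K`: unit speed curves, not necessarily starting in `K`,
along which the distance from `K` grows by the whole length of the curve. -/
structure IsRay (F : TangentBundle (𝓡 n) M → ℝ) (K : Set M) (γ : ℝ → M) (ℓ : ℝ) : Prop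
    extends IsUnitCurve F γ ℓ where
  growth : fdistFrom F K (γ ℓ) = fdistFrom F K (γ 0) + ℓ

variable [IsManifold (𝓡 n) ∞ M]

theorem length_nonneg (hF : IsFinslerStructure F) (γ : ℝ → M) {a b : ℝ} (hab : a ≤ b) :
    0 ≤ length F γ a b :=
  intervalIntegral.integral_nonneg hab fun _ _ => hF.nonneg _

theorem fdist_nonneg (hF : IsFinslerStructure F) (p q : M) : 0 ≤ fdist F p q := by
  refine Real.sInf_nonneg ?_
  rintro _ ⟨a, b, γ, hab, -, -, -, rfl⟩
  exact length_nonneg hF γ hab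

theorem fdist_le_length (hF : IsFinslerStructure F) {γ : ℝ → M} {a b : ℝ} (hab : a ≤ b)
    (hγ : IsPiecewiseSmooth n γ a b) : fdist F (γ a) (γ b) ≤ length F γ a b := by
  refine csInf_le ⟨0, ?_⟩ ⟨a, b, γ, hab, hγ, rfl, rfl, rfl⟩
  rintro _ ⟨a, b, γ, hab, -, -, -, rfl⟩
  exact length_nonneg hF γ hab

theorem IsUnitCurve.fdist_le (hF : IsFinslerStructure F) {γ : ℝ → M} {ℓ u v : ℝ}
    (h : IsUnitCurve F γ ℓ) (hu : 0 ≤ u) (huv : u ≤ v) (hv : v ≤ ℓ) :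
    fdist F (γ u) (γ v) ≤ v - u :=
  (fdist_le_length hF huv (h.piecewiseSmooth.mono hu hv)).trans_eq (h.length_eq hu huv hv)

theorem fdist_self (hF : IsFinslerStructure F) (p : M) : fdist F p p = 0 := by
  have hp : IsPiecewiseSmooth n (fun _ : ℝ => p) 0 0 :=
    ⟨continuousOn_const, ∅, fun _ _ _ _ _ _ => contMDiffOn_const⟩
  have h := fdist_le_length hF le_rfl hp
  rw [length, intervalIntegral.integral_same] at h
  exact h.antisymm (fdist_nonneg hF p p)

theorem fdistFrom_nonneg (hF : IsFinslerStructure F) (K : Set M) (q : M) :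
    0 ≤ fdistFrom F K q := by
  refine Real.sInf_nonneg ?_
  rintro _ ⟨a, -, rfl⟩
  exact fdist_nonneg hF a q

theorem fdistFrom_le (hF : IsFinslerStructure F) {K : Set M} {a : M} (ha : a ∈ K) (q : M) :
    fdistFrom F K q ≤ fdist F a q := by
  refine csInf_le ⟨0, ?_⟩ ⟨a, ha, rfl⟩
  rintro _ ⟨a, -, rfl⟩
  exact fdist_nonneg hF a q

theorem fdist_triangle (hF : IsFinslerStructure F) (hmin : HasShortestCurves F) (p q r : M) :
    fdist F p r ≤ fdist F p q + fdist F q r := by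
  obtain ⟨γ₁, h₁, h₁0, h₁ℓ⟩ := hmin.exists_unitCurve p q
  obtain ⟨γ₂, h₂, h₂0, h₂ℓ⟩ := hmin.exists_unitCurve q r
  have h0 : γ₁ (fdist F p q) = γ₂ 0 := h₁ℓ.trans h₂0.symm
  have h := (h₁.concat hF h₂ h0).fdist_le hF le_rfl (h₁.concat hF h₂ h0).nonneg le_rfl
  rw [concat_of_le h₁.nonneg, concat_of_ge h0 (by linarith [h₂.nonneg]), add_sub_cancel_left, h₁0,
    h₂ℓ, sub_zero] at h
  exact h

theorem fdistFrom_triangle (hF : IsFinslerStructure F) (hmin : HasShortestCurves F) {K : Set M}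
    (hK : K.Nonempty) (p q : M) : fdistFrom F K q ≤ fdistFrom F K p + fdist F p q := by
  rw [← sub_le_iff_le_add]
  refine le_fdistFrom hK fun a ha => ?_
  linarith [fdistFrom_le hF ha q, fdist_triangle hF hmin a p q]

theorem IsPiecewiseSmooth.chart_symm {p₀ : M} {c : ℝ → EuclideanSpace ℝ (Fin n)} {a b : ℝ}
    (hc : IsPiecewiseSmooth n c a b) (hs : MapsTo c (Icc a b) (extChartAt (𝓡 n) p₀).target) :
    IsPiecewiseSmooth n (fun x => (extChartAt (𝓡 n) p₀).symm (c x)) a b := by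
  obtain ⟨hcont, P, hP⟩ := hc
  refine ⟨(continuousOn_extChartAt_symm p₀).comp hcont hs, P, fun a' b' ha hab hb hcorner => ?_⟩
  exact contMDiffOn_chart_symm.comp (hP a' b' ha hab hb hcorner) fun x hx =>
    hs ⟨ha.trans hx.1, hx.2.trans hb⟩

theorem fdist_le_integral (hF : IsFinslerStructure F) {p₀ : M}
    {c : ℝ → EuclideanSpace ℝ (Fin n)} {a b : ℝ} (hab : a ≤ b) (hc : IsPiecewiseSmooth n c a b)
    (hs : MapsTo c (Icc a b) (extChartAt (𝓡 n) p₀).target) :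
    fdist F ((extChartAt (𝓡 n) p₀).symm (c a)) ((extChartAt (𝓡 n) p₀).symm (c b)) ≤
      ∫ x in a..b, localExpr F p₀ (c x) (deriv c x) := by
  refine (fdist_le_length hF hab (hc.chart_symm hs)).trans_eq ?_
  obtain ⟨P, hP⟩ := hc.exists_finset
  rw [length, intervalIntegral.integral_of_le hab, intervalIntegral.integral_of_le hab]
  refine integral_congr_ae (ae_restrict_Ioc_of_forall_notMem P fun x hx hxP => ?_)
  exact velocity_chart_symm_comp (hP x hx hxP).differentiableAt (hs (Ioo_subset_Icc_self hx))

theorem exists_fdist_le_mul (hF : IsFinslerStructure F) {p₀ : M}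
    {x₀ : EuclideanSpace ℝ (Fin n)} (hx₀ : x₀ ∈ (extChartAt (𝓡 n) p₀).target) :
    ∃ R > 0, ∃ C > 0, Metric.closedBall x₀ R ⊆ (extChartAt (𝓡 n) p₀).target ∧
      ∀ x ∈ Metric.closedBall x₀ R, ∀ y ∈ Metric.closedBall x₀ R,
        fdist F ((extChartAt (𝓡 n) p₀).symm x) ((extChartAt (𝓡 n) p₀).symm y) ≤ C * ‖y - x‖ := by
  obtain ⟨R, hR, _, -, C, hC, hRΩ, hbound⟩ := (hF.isLocalFinsler p₀).exists_bounds_closedBall hx₀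
  refine ⟨R, hR, C, hC, hRΩ, fun x hx y hy => ?_⟩
  let c (t : ℝ) : EuclideanSpace ℝ (Fin n) := x + t • (y - x)
  have hmem : MapsTo c (Icc 0 1) (Metric.closedBall x₀ R) := fun t ht =>
    (convex_closedBall x₀ R).add_smul_sub_mem hx hy ht
  have hderiv (t : ℝ) : HasDerivAt c (y - x) t := by
    simpa only [id_eq, one_smul] using ((hasDerivAt_id t).smul_const (y - x)).const_add x
  have hc : ContDiff ℝ ∞ c := by fun_prop
  have hps : IsPiecewiseSmooth n c 0 1 :=
    ⟨hc.continuous.continuousOn, ∅, fun _ _ _ _ _ _ => hc.contMDiff.contMDiffOn⟩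
  have hspeed : ∀ t ∈ uIoc (0 : ℝ) 1, ‖localExpr F p₀ (c t) (deriv c t)‖ ≤ C * ‖y - x‖ := by
    intro t ht
    rw [uIoc_of_le zero_le_one] at ht
    rw [(hderiv t).deriv, Real.norm_of_nonneg (show 0 ≤ localExpr F p₀ _ _ from hF.nonneg _)]
    exact (hbound _ (hmem (Ioc_subset_Icc_self ht)) _).2
  calc fdist F ((extChartAt (𝓡 n) p₀).symm x) ((extChartAt (𝓡 n) p₀).symm y)
      ≤ ∫ t in (0 : ℝ)..1, localExpr F p₀ (c t) (deriv c t) := by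
        simpa [c] using fdist_le_integral hF zero_le_one hps (hmem.mono_right hRΩ)
    _ ≤ C * ‖y - x‖ := (Real.le_norm_self _).trans <| by
        simpa using intervalIntegral.norm_integral_le_of_norm_le_const hspeed

theorem exists_fdist_eventually_le (hF : IsFinslerStructure F) (p : M) :
    ∃ C > 0, ∀ᶠ q in 𝓝 p,
      fdist F p q ≤ C * ‖extChartAt (𝓡 n) p q - extChartAt (𝓡 n) p p‖ ∧
      fdist F q p ≤ C * ‖extChartAt (𝓡 n) p q - extChartAt (𝓡 n) p p‖ := by
  obtain ⟨R, hR, C, hC, -, h⟩ := exists_fdist_le_mul hF (mem_extChartAt_target (I := 𝓡 n) p)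
  refine ⟨C, hC, ?_⟩
  have hnear : ∀ᶠ q in 𝓝 p, extChartAt (𝓡 n) p q ∈ Metric.closedBall (extChartAt (𝓡 n) p p) R :=
    continuousAt_extChartAt p (Metric.closedBall_mem_nhds _ hR)
  filter_upwards [hnear, extChartAt_source_mem_nhds (I := 𝓡 n) p] with q hq hqs
  have hpq := h _ (Metric.mem_closedBall_self hR.le) _ hq
  have hqp := h _ hq _ (Metric.mem_closedBall_self hR.le)
  rw [extChartAt_to_inv, (extChartAt (𝓡 n) p).left_inv hqs] at hpq hqp
  exact ⟨hpq, norm_sub_rev (extChartAt (𝓡 n) p p) _ ▸ hqp⟩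

theorem tendsto_fdist_left_right (hF : IsFinslerStructure F) (p : M) :
    Tendsto (fun q => fdist F p q + fdist F q p) (𝓝 p) (𝓝 0) := by
  obtain ⟨C, -, h⟩ := exists_fdist_eventually_le hF p
  have hlim : Tendsto (fun q => 2 * (C * ‖extChartAt (𝓡 n) p q - extChartAt (𝓡 n) p p‖)) (𝓝 p)
      (𝓝 0) := by
    have hcont : ContinuousAt
        (fun q => 2 * (C * ‖extChartAt (𝓡 n) p q - extChartAt (𝓡 n) p p‖)) p :=
      (((continuousAt_extChartAt p).sub continuousAt_const).norm.const_mul C).const_mul 2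
    simpa [ContinuousAt] using hcont
  refine tendsto_of_tendsto_of_tendsto_of_le_of_le' tendsto_const_nhds hlim ?_ ?_
  · exact Eventually.of_forall fun q => add_nonneg (fdist_nonneg hF _ _) (fdist_nonneg hF _ _)
  · filter_upwards [h] with q hq
    linarith [hq.1, hq.2]

theorem continuous_of_abs_sub_le (hF : IsFinslerStructure F) {g : M → ℝ}
    (hg : ∀ p q, |g q - g p| ≤ fdist F p q + fdist F q p) : Continuous g := by
  rw [continuous_iff_continuousAt]
  intro p
  rw [ContinuousAt, tendsto_iff_norm_sub_tendsto_zero]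
  exact squeeze_zero (fun _ => norm_nonneg _) (fun q => hg p q) (tendsto_fdist_left_right hF p)

theorem continuous_fdistFrom (hF : IsFinslerStructure F) (hmin : HasShortestCurves F) {K : Set M}
    (hK : K.Nonempty) : Continuous (fdistFrom F K) := by
  refine continuous_of_abs_sub_le hF fun p q => ?_
  rw [abs_le]
  constructor <;> linarith [fdistFrom_triangle hF hmin hK p q, fdistFrom_triangle hF hmin hK q p,
    fdist_nonneg hF p q, fdist_nonneg hF q p]

theorem continuous_fdist_left (hF : IsFinslerStructure F) (hmin : HasShortestCurves F) (r : M) :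
    Continuous fun p => fdist F p r := by
  refine continuous_of_abs_sub_le hF fun p q => ?_
  rw [abs_le]
  constructor <;> linarith [fdist_triangle hF hmin p q r, fdist_triangle hF hmin q p r,
    fdist_nonneg hF p q, fdist_nonneg hF q p]

theorem exists_isShortest (hF : IsFinslerStructure F) (hmin : HasShortestCurves F) {K : Set M}
    (hK : IsCompact K) (hne : K.Nonempty) (q : M) :
    ∃ γ : ℝ → M, IsShortest F K q γ (fdistFrom F K q) := by
  obtain ⟨a, ha, hmina⟩ := hK.exists_isMinOn hne (continuous_fdist_left hF hmin q).continuousOn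
  have he : fdist F a q = fdistFrom F K q :=
    (le_fdistFrom hne fun b hb => hmina hb).antisymm (fdistFrom_le hF ha q)
  obtain ⟨γ, h, h0, hℓ⟩ := hmin.exists_unitCurve a q
  rw [he] at h hℓ
  exact ⟨γ, h.isShortest (h0 ▸ ha) hℓ rfl⟩

theorem IsRay.fdistFrom_eq (hF : IsFinslerStructure F) (hmin : HasShortestCurves F)
    {K : Set M} (hK : K.Nonempty) {γ : ℝ → M} {ℓ u : ℝ} (h : IsRay F K γ ℓ) (hu : u ∈ Icc 0 ℓ) :
    fdistFrom F K (γ u) = fdistFrom F K (γ 0) + u := by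
  linarith [h.growth, h.fdist_le hF le_rfl hu.1 hu.2, h.fdist_le hF hu.1 hu.2 le_rfl,
    fdistFrom_triangle hF hmin hK (γ 0) (γ u), fdistFrom_triangle hF hmin hK (γ u) (γ ℓ)]

theorem IsRay.fdist_eq (hF : IsFinslerStructure F) (hmin : HasShortestCurves F)
    {K : Set M} (hK : K.Nonempty) {γ : ℝ → M} {ℓ u v : ℝ} (h : IsRay F K γ ℓ) (hu : 0 ≤ u)
    (huv : u ≤ v) (hv : v ≤ ℓ) : fdist F (γ u) (γ v) = v - u := by
  linarith [h.fdistFrom_eq hF hmin hK ⟨hu, huv.trans hv⟩, h.fdist_le hF hu huv hv,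
    h.fdistFrom_eq hF hmin hK ⟨hu.trans huv, hv⟩, fdistFrom_triangle hF hmin hK (γ u) (γ v)]

theorem fdistFrom_of_mem (hF : IsFinslerStructure F) {K : Set M} {q : M} (hq : q ∈ K) :
    fdistFrom F K q = 0 :=
  ((fdistFrom_le hF hq q).trans_eq (fdist_self hF q)).antisymm (fdistFrom_nonneg hF K q)

theorem IsShortest.isRay (hF : IsFinslerStructure F) {K : Set M} {q : M} {γ : ℝ → M} {ℓ : ℝ}
    (h : IsShortest F K q γ ℓ) : IsRay F K γ ℓ where
  toIsUnitCurve := h.isUnitCurve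
  growth := by
    rw [h.target, fdistFrom_of_mem hF h.source, zero_add, ← h.length_eq_fdistFrom]

theorem IsShortest.fdistFrom_eq (hF : IsFinslerStructure F) (hmin : HasShortestCurves F)
    {K : Set M} {q : M} {γ : ℝ → M} {ℓ u : ℝ} (h : IsShortest F K q γ ℓ) (hu : u ∈ Icc 0 ℓ) :
    fdistFrom F K (γ u) = u := by
  rw [(h.isRay hF).fdistFrom_eq hF hmin ⟨_, h.source⟩ hu, fdistFrom_of_mem hF h.source, zero_add]

theorem IsShortest.concat (hF : IsFinslerStructure F) {K : Set M} {z q : M} {γ₁ γ₂ : ℝ → M}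
    {ℓ₁ ℓ₂ : ℝ} (h₁ : IsShortest F K z γ₁ ℓ₁) (h₂ : IsUnitCurve F γ₂ ℓ₂) (h0 : γ₂ 0 = z)
    (hq : γ₂ ℓ₂ = q) (hℓ : fdistFrom F K q = fdistFrom F K z + ℓ₂) :
    IsShortest F K q (concat γ₁ γ₂ ℓ₁) (ℓ₁ + ℓ₂) := by
  have hjoin : γ₁ ℓ₁ = γ₂ 0 := h₁.target.trans h0.symm
  refine (h₁.isUnitCurve.concat hF h₂ hjoin).isShortest ?_ ?_ ?_
  · rw [concat_of_le h₁.nonneg]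
    exact h₁.source
  · rw [concat_of_ge hjoin (by linarith [h₂.nonneg]), add_sub_cancel_left, hq]
  · rw [hℓ, ← h₁.length_eq_fdistFrom]

theorem IsShortest.eq_of_between (hF : IsFinslerStructure F) (hmin : HasShortestCurves F)
    {K : Set M} (hK : IsCompact K) {q z : M} {γ : ℝ → M} {ℓ : ℝ} (h : IsShortest F K q γ ℓ)
    (hcut : q ∉ cutLocus F K) (hz : fdistFrom F K z + fdist F z q = fdistFrom F K q) :
    z = γ (fdistFrom F K z) := by
  obtain ⟨γ₁, h₁⟩ := exists_isShortest hF hmin hK ⟨_, h.source⟩ z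
  obtain ⟨γ₂, h₂, h₂0, h₂ℓ⟩ := hmin.exists_unitCurve z q
  have hconcat := h₁.concat hF h₂ h₂0 h₂ℓ hz.symm
  have hℓ : fdistFrom F K z + fdist F z q = ℓ := hz.trans h.length_eq_fdistFrom.symm
  rw [hℓ] at hconcat
  have heq := notMem_cutLocus_iff.1 hcut ℓ _ _ hconcat h
    (x := fdistFrom F K z) ⟨h₁.nonneg, by linarith [h₂.nonneg]⟩
  rw [← heq, concat_of_le le_rfl, h₁.target]

theorem notMem_cutLocus_singleton (hF : IsFinslerStructure F) (hmin : HasShortestCurves F)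
    {K : Set M} (hK : IsCompact K) (hne : K.Nonempty) {q z : M}
    (hcut : q ∉ cutLocus F K) (hz : fdistFrom F K z + fdist F z q = fdistFrom F K q) :
    q ∉ cutLocus F {z} := by
  rw [notMem_cutLocus_iff] at hcut ⊢
  intro ℓ γ₁ γ₂ h₁ h₂ u hu
  obtain ⟨γ, h⟩ := exists_isShortest hF hmin hK hne z
  have hℓ : ℓ = fdist F z q := by rw [h₁.length_eq_fdistFrom, fdistFrom_singleton]
  have hconcat₁ := h.concat hF h₁.isUnitCurve h₁.source h₁.target (by rw [hℓ, hz])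
  have hconcat₂ := h.concat hF h₂.isUnitCurve h₂.source h₂.target (by rw [hℓ, hz])
  have heq := hcut _ _ _ hconcat₁ hconcat₂ (x := fdistFrom F K z + u)
    ⟨by linarith [h.nonneg, hu.1], by linarith [hu.2]⟩
  rwa [concat_of_ge (h.target.trans (Eq.symm h₁.source)) (by linarith [hu.1]),
    concat_of_ge (h.target.trans (Eq.symm h₂.source)) (by linarith [hu.1]),
    add_sub_cancel_left] at heq

end Distance

/-! ### The gradient of the distance function -/

section Differentiability

/-- `v` is a unit vector for the norm `f x` whose Legendre transform is the derivative of `g`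
at `x`: the gradient of `g` is `v`, and in particular it has unit length. -/
structure IsUnitGradient {V : Type*} [NormedAddCommGroup V] [NormedSpace ℝ V] (f : V → V → ℝ)
    (g : V → ℝ) (x v : V) : Prop where
  unit : f x v = 1
  hasStrictFDerivAt : HasStrictFDerivAt g (fderiv ℝ (f x) v) x

theorem exists_last_exit {X : Type*} [TopologicalSpace X] {γ : ℝ → X} {O : Set X} {a b : ℝ}
    (hab : a ≤ b) (hγ : ContinuousOn γ (Icc a b)) (hO : IsOpen O) (ha : γ a ∉ O) (hb : γ b ∈ O) :
    ∃ t ∈ Ico a b, γ t ∉ O ∧ MapsTo γ (Ioc t b) O := by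
  have hclosed : IsClosed (Icc a b ∩ γ ⁻¹' Oᶜ) :=
    hγ.preimage_isClosed_of_isClosed isClosed_Icc hO.isClosed_compl
  obtain ⟨t, ⟨htI, htO⟩, hmax⟩ := (isCompact_Icc.of_isClosed_subset hclosed
    inter_subset_left).exists_isGreatest ⟨a, ⟨le_rfl, hab⟩, ha⟩
  refine ⟨t, ⟨htI.1, htI.2.lt_of_ne fun h => htO (h ▸ hb)⟩, htO, fun x hx => ?_⟩
  by_contra hxO
  exact hx.1.not_ge (hmax ⟨⟨htI.1.trans hx.1.le, hx.2⟩, hxO⟩)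

theorem eventually_norm_sub_smul_le_of_hasDerivWithinAt {V : Type*} [NormedAddCommGroup V]
    [NormedSpace ℝ V] {c : ℝ → V} {v : V} {b : ℝ} (hc : HasDerivWithinAt c v (Iic b) b) {η : ℝ}
    (hη : 0 < η) : ∀ᶠ ε in 𝓝[>] (0 : ℝ), ‖c b - c (b - ε) - ε • v‖ ≤ η * ε := by
  have hshift : Tendsto (fun ε : ℝ => b - ε) (𝓝[>] 0) (𝓝[Iic b] b) := by
    refine tendsto_nhdsWithin_iff.2 ⟨?_, ?_⟩
    · exact Tendsto.mono_left (Continuous.tendsto' (by fun_prop) _ _ (sub_zero b))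
        nhdsWithin_le_nhds
    · filter_upwards [self_mem_nhdsWithin] with ε hε
      exact (sub_lt_self b hε).le
  filter_upwards [hshift.eventually ((hasDerivWithinAt_iff_isLittleO.1 hc).def hη),
    self_mem_nhdsWithin] with ε hε hpos
  rw [sub_sub_cancel_left, norm_neg, Real.norm_of_nonneg (le_of_lt hpos)] at hε
  rwa [← norm_neg, show -(c b - c (b - ε) - ε • v) = c (b - ε) - c b - (-ε) • v by module]

variable {n : ℕ} {M : Type*} [TopologicalSpace M] [ChartedSpace (EuclideanSpace ℝ (Fin n)) M]
  {F : TangentBundle (𝓡 n) M → ℝ} {p₀ p : M}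

/-- The part of `M` which the chart at `p₀` maps to the ball of radius `r` around `x₀`. -/
def chartBall (p₀ : M) (x₀ : EuclideanSpace ℝ (Fin n)) (r : ℝ) : Set M :=
  (extChartAt (𝓡 n) p₀).source ∩ extChartAt (𝓡 n) p₀ ⁻¹' Metric.ball x₀ r

theorem isOpen_chartBall (p₀ : M) (x₀ : EuclideanSpace ℝ (Fin n)) (r : ℝ) :
    IsOpen (chartBall p₀ x₀ r) :=
  (continuousOn_extChartAt p₀).isOpen_inter_preimage (isOpen_extChartAt_source p₀)
    Metric.isOpen_ball

theorem mem_chartBall_self (hp : p ∈ (extChartAt (𝓡 n) p₀).source) {r : ℝ} (hr : 0 < r) :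
    p ∈ chartBall p₀ (extChartAt (𝓡 n) p₀ p) r :=
  ⟨hp, Metric.mem_ball_self hr⟩

theorem chartBall_mem_nhds (hp : p ∈ (extChartAt (𝓡 n) p₀).source) {r : ℝ} (hr : 0 < r) :
    chartBall p₀ (extChartAt (𝓡 n) p₀ p) r ∈ 𝓝 p :=
  (isOpen_chartBall _ _ _).mem_nhds (mem_chartBall_self hp hr)

theorem chartBall_mono {x₀ : EuclideanSpace ℝ (Fin n)} {r r' : ℝ} (h : r ≤ r') :
    chartBall p₀ x₀ r ⊆ chartBall p₀ x₀ r' :=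
  inter_subset_inter_right _ (preimage_mono (Metric.ball_subset_ball h))

theorem isCompact_symm_image_closedBall {x₀ : EuclideanSpace ℝ (Fin n)} {r : ℝ}
    (hr : Metric.closedBall x₀ r ⊆ (extChartAt (𝓡 n) p₀).target) :
    IsCompact ((extChartAt (𝓡 n) p₀).symm '' Metric.closedBall x₀ r) :=
  (isCompact_closedBall _ _).image_of_continuousOn ((continuousOn_extChartAt_symm p₀).mono hr)

theorem chartBall_subset_symm_image {x₀ : EuclideanSpace ℝ (Fin n)} {r : ℝ} :
    chartBall p₀ x₀ r ⊆ (extChartAt (𝓡 n) p₀).symm '' Metric.closedBall x₀ r := fun _ hq =>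
  ⟨_, Metric.ball_subset_closedBall hq.2, (extChartAt (𝓡 n) p₀).left_inv hq.1⟩

theorem closure_chartBall_subset [T2Space M] {x₀ : EuclideanSpace ℝ (Fin n)} {r : ℝ}
    (hr : Metric.closedBall x₀ r ⊆ (extChartAt (𝓡 n) p₀).target) :
    closure (chartBall p₀ x₀ r) ⊆
      (extChartAt (𝓡 n) p₀).source ∩ extChartAt (𝓡 n) p₀ ⁻¹' Metric.closedBall x₀ r := by
  refine (closure_minimal chartBall_subset_symm_image
    (isCompact_symm_image_closedBall hr).isClosed).trans ?_
  rintro _ ⟨x, hx, rfl⟩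
  exact ⟨(extChartAt (𝓡 n) p₀).map_target (hr hx), by
    rwa [mem_preimage, (extChartAt (𝓡 n) p₀).right_inv (hr hx)]⟩

variable [IsManifold (𝓡 n) ∞ M]

theorem IsPiecewiseSmooth.chart {γ : ℝ → M} {a b : ℝ} (hγ : IsPiecewiseSmooth n γ a b)
    (hs : MapsTo γ (Icc a b) (extChartAt (𝓡 n) p₀).source) :
    IsPiecewiseSmooth n (fun x => extChartAt (𝓡 n) p₀ (γ x)) a b := by
  obtain ⟨hc, P, hP⟩ := hγ
  refine ⟨(continuousOn_extChartAt p₀).comp hc hs, P, fun a' b' ha hab hb hcorner => ?_⟩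
  refine (contMDiffOn_extChartAt (n := ∞)).comp (hP a' b' ha hab hb hcorner) fun x hx => ?_
  simpa using hs ⟨ha.trans hx.1, hx.2.trans hb⟩

theorem IsUnitCurve.exists_isUnitPath_chart {γ : ℝ → M} {ℓ a b : ℝ} (h : IsUnitCurve F γ ℓ)
    (ha : 0 ≤ a) (hb : b ≤ ℓ) (hs : MapsTo γ (Icc a b) (extChartAt (𝓡 n) p₀).source) :
    ∃ P, IsUnitPath (localExpr F p₀) (fun x => extChartAt (𝓡 n) p₀ (γ x)) P a b := by
  obtain ⟨P, hP⟩ := h.piecewiseSmooth.exists_finset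
  have hI {x : ℝ} (hx : x ∈ Ioo a b) : x ∈ Ioo 0 ℓ := Ioo_subset_Ioo ha hb hx
  have hs' {x : ℝ} (hx : x ∈ Ioo a b) := hs (Ioo_subset_Icc_self hx)
  refine ⟨P, ((h.piecewiseSmooth.mono ha hb).chart hs).1, fun x hx hxP => ?_, fun x hx hxP => ?_⟩
  · exact (hasDerivAt_chart_comp (hP x (hI hx) hxP) (hs' hx)).differentiableAt
  · rw [localExpr_deriv (hP x (hI hx) hxP) (hs' hx)]
    exact h.unitSpeed x (hI hx) (hP x (hI hx) hxP)

theorem exists_forall_end_mem_chartBall [T2Space M] (hF : IsFinslerStructure F)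
    {x₀ : EuclideanSpace ℝ (Fin n)} (hx₀ : x₀ ∈ (extChartAt (𝓡 n) p₀).target) {δ : ℝ}
    (hδ : 0 < δ) : ∃ ε > 0, ∀ (γ : ℝ → M) (ℓ : ℝ), IsUnitCurve F γ ℓ → γ ℓ ∈ chartBall p₀ x₀ ε →
      ∀ u ∈ Icc 0 ℓ, ℓ - ε ≤ u → γ u ∈ chartBall p₀ x₀ δ := by
  obtain ⟨R, hR, m, hm, _, -, hRΩ, hbound⟩ := (hF.isLocalFinsler p₀).exists_bounds_closedBall hx₀
  set r := min δ R
  have hr : 0 < r := lt_min hδ hR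
  have hrR : r ≤ R := min_le_right _ _
  refine ⟨min (r / 2) (m * (r / 3)), by positivity, fun γ ℓ h hend u hu hul => ?_⟩
  have hend' := chartBall_mono (min_le_left _ _) hend
  have hlen : m⁻¹ * (ℓ - u) ≤ r / 3 := by
    rw [inv_mul_le_iff₀ hm]
    linarith [min_le_right (r / 2) (m * (r / 3))]
  refine chartBall_mono (min_le_left δ R) ?_
  by_contra hbad
  have hγc : ContinuousOn γ (Icc u ℓ) := (h.piecewiseSmooth.mono hu.1 le_rfl).1
  obtain ⟨t, ht, htbad, hafter⟩ := exists_last_exit hu.2 hγc (isOpen_chartBall p₀ x₀ r) hbad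
    (chartBall_mono (by linarith) hend')
  have hclosure : MapsTo γ (Icc t ℓ) (closure (chartBall p₀ x₀ r)) := by
    rw [← closure_Ioc ht.2.ne]
    refine hafter.closure_of_continuousOn (hγc.mono ?_)
    rw [closure_Ioc ht.2.ne]
    exact Icc_subset_Icc_left ht.1
  have hin := hclosure.mono_right (closure_chartBall_subset
    ((Metric.closedBall_subset_closedBall hrR).trans hRΩ))
  obtain ⟨P, hP⟩ := h.exists_isUnitPath_chart (hu.1.trans ht.1) le_rfl fun x hx => (hin hx).1
  have hshort := hP.norm_sub_le (fun x hx => Metric.closedBall_subset_closedBall hrR (hin hx).2)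
    hm (fun x hx y => (hbound x hx y).1) ht.2.le
  refine htbad ⟨(hin (left_mem_Icc.2 ht.2.le)).1, ?_⟩
  have hstep : m⁻¹ * (ℓ - t) ≤ m⁻¹ * (ℓ - u) := by gcongr; exact ht.1
  calc dist (extChartAt (𝓡 n) p₀ (γ t)) x₀
      ≤ dist (extChartAt (𝓡 n) p₀ (γ ℓ)) (extChartAt (𝓡 n) p₀ (γ t)) +
        dist (extChartAt (𝓡 n) p₀ (γ ℓ)) x₀ := dist_triangle_left _ _ _
    _ < r := by linarith [dist_eq_norm (extChartAt (𝓡 n) p₀ (γ ℓ)) (extChartAt (𝓡 n) p₀ (γ t)),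
        Metric.mem_ball.1 hend'.2]

theorem exists_fdist_variation (hF : IsFinslerStructure F)
    {x₀ v : EuclideanSpace ℝ (Fin n)} (hx₀ : x₀ ∈ (extChartAt (𝓡 n) p₀).target)
    (hv : localExpr F p₀ x₀ v = 1) {η : ℝ} (hη : 0 < η) :
    ∃ δ > 0, ∀ ε, 0 < ε → ε < δ → ∃ δ' > 0, ∀ (γ : ℝ → M) (ℓ : ℝ), IsUnitCurve F γ ℓ → ε ≤ ℓ →
      MapsTo γ (Icc (ℓ - ε) ℓ) (chartBall p₀ x₀ δ) →
      ‖extChartAt (𝓡 n) p₀ (γ ℓ) - extChartAt (𝓡 n) p₀ (γ (ℓ - ε)) - ε • v‖ ≤ δ * ε →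
      ∀ h : EuclideanSpace ℝ (Fin n), ‖h‖ < δ' →
      fdist F (γ (ℓ - ε)) ((extChartAt (𝓡 n) p₀).symm (extChartAt (𝓡 n) p₀ (γ ℓ) + h)) ≤
        ε + fderiv ℝ (localExpr F p₀ x₀) v h + η * ‖h‖ := by
  obtain ⟨δ, hδ, hvar⟩ := (hF.isLocalFinsler p₀).exists_variation hx₀ hv hη
  refine ⟨δ, hδ, fun ε hε hεδ => ?_⟩
  obtain ⟨δ', hδ', hvar⟩ := hvar ε hε hεδ
  refine ⟨δ', hδ', fun γ ℓ hγ hεℓ hs havg h hh => ?_⟩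
  have hsource : MapsTo γ (Icc (ℓ - ε) ℓ) (extChartAt (𝓡 n) p₀).source := fun x hx => (hs hx).1
  set c := fun x => extChartAt (𝓡 n) p₀ (γ x)
  set w : ℝ → EuclideanSpace ℝ (Fin n) := fun x => ((x - (ℓ - ε)) / ε) • h
  have hwderiv (x : ℝ) : HasDerivAt w ((1 / ε) • h) x :=
    (((hasDerivAt_id x).sub_const _).div_const ε).smul_const h
  obtain ⟨P, hP⟩ := hγ.exists_isUnitPath_chart (sub_nonneg.2 hεℓ) le_rfl hsource
  have hc : IsPiecewiseSmooth n c (ℓ - ε) ℓ :=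
    (hγ.piecewiseSmooth.mono (sub_nonneg.2 hεℓ) le_rfl).chart hsource
  obtain ⟨hΩ, hint⟩ := hvar c _ _ P (by ring) hP (fun x hx => (hs hx).2) havg h hh
  have hcw : IsPiecewiseSmooth n (fun x => c x + w x) (ℓ - ε) ℓ := by
    obtain ⟨hcont, Q, hQ⟩ := hc
    refine ⟨hcont.add (by fun_prop), Q, fun a b ha hab hb hcorner => ?_⟩
    exact ((hQ a b ha hab hb hcorner).contDiffOn.add (by fun_prop)).contMDiffOn
  calc fdist F (γ (ℓ - ε)) ((extChartAt (𝓡 n) p₀).symm (c ℓ + h))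
      ≤ ∫ x in (ℓ - ε)..ℓ, localExpr F p₀ (c x + w x) (deriv (fun x => c x + w x) x) := by
        have hle := fdist_le_integral hF (by linarith) hcw hΩ
        rwa [show w (ℓ - ε) = 0 by simp [w], show w ℓ = h by simp [w, hε.ne'], add_zero,
          (extChartAt (𝓡 n) p₀).left_inv (hsource ⟨le_rfl, by linarith⟩)] at hle
    _ = ∫ x in (ℓ - ε)..ℓ, localExpr F p₀ (c x + w x) (deriv c x + (1 / ε) • h) := by
        rw [intervalIntegral.integral_of_le (by linarith),
          intervalIntegral.integral_of_le (by linarith)]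
        refine integral_congr_ae (ae_restrict_Ioc_of_forall_notMem P fun x hx hxP => ?_)
        exact congrArg _ ((hP.differentiableAt x hx hxP).hasDerivAt.add (hwderiv x)).deriv
    _ ≤ ε + fderiv ℝ (localExpr F p₀ x₀) v h + η * ‖h‖ := hint

theorem IsUnitCurve.exists_terminal_velocity (hF : IsFinslerStructure F) {γ : ℝ → M} {ℓ : ℝ}
    (h : IsUnitCurve F γ ℓ) (hℓ : 0 < ℓ) (hs : γ ℓ ∈ (extChartAt (𝓡 n) p₀).source) :
    ∃ v, localExpr F p₀ (extChartAt (𝓡 n) p₀ (γ ℓ)) v = 1 ∧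
      HasDerivWithinAt (fun x => extChartAt (𝓡 n) p₀ (γ x)) v (Iic ℓ) ℓ := by
  obtain ⟨a, ha, haℓ, hsmooth⟩ := h.piecewiseSmooth.exists_left hℓ le_rfl
  have hmem : ℓ ∈ Icc a ℓ := right_mem_Icc.2 haℓ.le
  have hunit := IsUnitSpeed.velocityWithin_Icc hF haℓ hsmooth
    (fun x hx => h.unitSpeed x (Ioo_subset_Ioo_left ha hx)) hmem
  have hd := (hsmooth ℓ hmem).mdifferentiableWithinAt (by simp)
  refine ⟨_, ?_, (hasDerivWithinAt_chart_comp hd hs).mono_of_mem_nhdsWithin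
    (Icc_mem_nhdsLE haℓ)⟩
  rw [localExpr_chartDeriv hs]
  exact hunit

-- Off the cut locus `γ t` is the only point `z` with `d(K, z) = t` which lies between `K` and `p`.
theorem IsShortest.exists_forall_mem_of_abs_lt (hF : IsFinslerStructure F)
    (hmin : HasShortestCurves F) {K T O : Set M} (hK : IsCompact K) {γ : ℝ → M} {ℓ t : ℝ}
    (hγ : IsShortest F K p γ ℓ) (hcut : p ∉ cutLocus F K) (hT : IsCompact T) (hO : IsOpen O)
    (ht : γ t ∈ O) : ∃ κ > 0, ∀ z ∈ T,
      |fdistFrom F K z + fdist F z p - ℓ| + |fdistFrom F K z - t| < κ → z ∈ O := by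
  have hρ := continuous_fdistFrom hF hmin ⟨_, hγ.source⟩
  have hpos : ∀ z ∈ T \ O,
      0 < |fdistFrom F K z + fdist F z p - ℓ| + |fdistFrom F K z - t| := by
    intro z hz
    refine (add_nonneg (abs_nonneg _) (abs_nonneg _)).lt_of_ne' fun hsum => hz.2 ?_
    obtain ⟨hbetween, htime⟩ := (add_eq_zero_iff_of_nonneg (abs_nonneg _) (abs_nonneg _)).1 hsum
    rw [abs_eq_zero, sub_eq_zero] at hbetween htime
    rwa [hγ.eq_of_between hF hmin hK hcut (hbetween.trans hγ.length_eq_fdistFrom), htime]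
  obtain ⟨κ, hκ, hle⟩ := (hT.diff hO).exists_forall_le' (by
    have := continuous_fdist_left hF hmin p
    fun_prop) hpos
  exact ⟨κ, hκ, fun z hzT hz => by_contra fun hzO => hz.not_ge (hle z ⟨hzT, hzO⟩)⟩

theorem IsShortest.eventually_forall_isShortest_mem (hF : IsFinslerStructure F)
    (hmin : HasShortestCurves F) {K T O : Set M} (hK : IsCompact K) {γ : ℝ → M} {ℓ ε : ℝ}
    (hγ : IsShortest F K p γ ℓ) (hcut : p ∉ cutLocus F K) (hε : 0 ≤ ε) (hT : IsCompact T)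
    (hO : IsOpen O) (ht : γ (ℓ - ε) ∈ O)
    (hshort : ∀ᶠ q in 𝓝 p, ∀ σ ℓ', IsShortest F K q σ ℓ' → ε ≤ ℓ' ∧ σ (ℓ' - ε) ∈ T) :
    ∀ᶠ q in 𝓝 p, ∀ σ ℓ', IsShortest F K q σ ℓ' → σ (ℓ' - ε) ∈ O := by
  obtain ⟨κ, hκ, hmem⟩ := hγ.exists_forall_mem_of_abs_lt hF hmin hK hcut hT hO ht
  filter_upwards [hshort, (tendsto_fdist_left_right hF p).eventually_lt_const
    (by positivity : 0 < κ / 3)] with q hq hdist σ ℓ' hσ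
  obtain ⟨hεℓ, hσT⟩ := hq σ ℓ' hσ
  have hne : K.Nonempty := ⟨_, hγ.source⟩
  have hmem' : ℓ' - ε ∈ Icc 0 ℓ' := ⟨by linarith, by linarith⟩
  have hρz := hσ.fdistFrom_eq hF hmin hmem'
  have hzq := (hσ.isRay hF).fdist_eq hF hmin hne hmem'.1 hmem'.2 le_rfl
  rw [hσ.target, sub_sub_cancel] at hzq
  have hp := hγ.length_eq_fdistFrom
  have hq := hσ.length_eq_fdistFrom
  have hpq := fdistFrom_triangle hF hmin hne p q
  have hqp := fdistFrom_triangle hF hmin hne q p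
  have hnonneg := fdist_nonneg hF p q
  have hnonneg' := fdist_nonneg hF q p
  have htime : |fdistFrom F K (σ (ℓ' - ε)) - (ℓ - ε)| ≤ fdist F p q + fdist F q p := by
    rw [abs_le]
    constructor <;> linarith
  have hbetween : |fdistFrom F K (σ (ℓ' - ε)) + fdist F (σ (ℓ' - ε)) p - ℓ| ≤
      2 * (fdist F p q + fdist F q p) := by
    rw [abs_le]
    constructor <;> linarith [fdist_triangle hF hmin (σ (ℓ' - ε)) q p,
      fdist_triangle hF hmin (σ (ℓ' - ε)) p q]
  exact hmem _ hσT (by linarith)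

theorem IsShortest.eventually_tail_near [T2Space M] (hF : IsFinslerStructure F)
    (hmin : HasShortestCurves F) {K : Set M} (hK : IsCompact K) {γ : ℝ → M} {ℓ : ℝ}
    (hγ : IsShortest F K p γ ℓ) (hcut : p ∉ cutLocus F K) (hℓ : 0 < ℓ)
    (hp : p ∈ (extChartAt (𝓡 n) p₀).source) {v : EuclideanSpace ℝ (Fin n)}
    (hv : HasDerivWithinAt (fun x => extChartAt (𝓡 n) p₀ (γ x)) v (Iic ℓ) ℓ) {δ : ℝ}
    (hδ : 0 < δ) : ∀ᶠ ε in 𝓝[>] (0 : ℝ), ∀ᶠ q in 𝓝 p, ∀ σ ℓ', IsShortest F K q σ ℓ' → ε ≤ ℓ' ∧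
      MapsTo σ (Icc (ℓ' - ε) ℓ') (chartBall p₀ (extChartAt (𝓡 n) p₀ p) δ) ∧
      ‖extChartAt (𝓡 n) p₀ (σ ℓ') - extChartAt (𝓡 n) p₀ (σ (ℓ' - ε)) - ε • v‖ ≤ δ * ε := by
  have hx₀ := (extChartAt (𝓡 n) p₀).map_source hp
  obtain ⟨R, hR, hRΩ⟩ := Metric.nhds_basis_closedBall.mem_iff.1
    (extChartAt_target_mem_nhds_of_mem hx₀)
  obtain ⟨ε₀, hε₀, hend⟩ := exists_forall_end_mem_chartBall hF hx₀ (lt_min hδ hR)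
  filter_upwards [eventually_norm_sub_smul_le_of_hasDerivWithinAt hv (by positivity : 0 < δ / 3),
    Ioo_mem_nhdsGT (lt_min hε₀ hℓ)] with ε havg ⟨hε, hεlt⟩
  have hεε₀ : ε < ε₀ := hεlt.trans_le (min_le_left _ _)
  have hεℓ : ε < fdistFrom F K p :=
    (hεlt.trans_le (min_le_right _ _)).trans_eq hγ.length_eq_fdistFrom
  have htail : ∀ᶠ q in 𝓝 p, ∀ σ ℓ', IsShortest F K q σ ℓ' → ε ≤ ℓ' ∧
      MapsTo σ (Icc (ℓ' - ε) ℓ') (chartBall p₀ (extChartAt (𝓡 n) p₀ p) (min δ R)) := by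
    filter_upwards [chartBall_mem_nhds hp hε₀, (continuous_fdistFrom hF hmin
      ⟨_, hγ.source⟩).continuousAt.eventually_const_lt hεℓ] with q hq hρq σ ℓ' hσ
    rw [← hσ.length_eq_fdistFrom] at hρq
    refine ⟨hρq.le, fun u hu => hend σ ℓ' hσ.isUnitCurve (hσ.target ▸ hq) u ?_ ?_⟩
    · exact ⟨by linarith [hu.1], hu.2⟩
    · linarith [hu.1]
  have hleft {t : ℝ} : t - ε ∈ Icc (t - ε) t := ⟨le_rfl, by linarith⟩
  have hz₀ := ((htail.self_of_nhds γ ℓ hγ).2 hleft).1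
  filter_upwards [htail, chartBall_mem_nhds hp (by positivity : 0 < δ / 3 * ε),
    hγ.eventually_forall_isShortest_mem hF hmin hK hcut hε.le
      (isCompact_symm_image_closedBall hRΩ) (isOpen_chartBall _ _ _)
      (mem_chartBall_self hz₀ (by positivity : 0 < δ / 3 * ε)) (htail.mono fun q hq σ ℓ' hσ =>
        ⟨(hq σ ℓ' hσ).1, chartBall_subset_symm_image
          (chartBall_mono (min_le_right _ _) ((hq σ ℓ' hσ).2 hleft))⟩)]
    with q htail hq hz σ ℓ' hσ
  refine ⟨(htail σ ℓ' hσ).1, (htail σ ℓ' hσ).2.mono_right (chartBall_mono (min_le_left _ _)), ?_⟩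
  have hqnear := mem_ball_iff_norm.1 hq.2
  have hznear := mem_ball_iff_norm'.1 (hz σ ℓ' hσ).2
  rw [hγ.target] at havg
  rw [hσ.target]
  set x := extChartAt (𝓡 n) p₀ p
  set z₀ := extChartAt (𝓡 n) p₀ (γ (ℓ - ε))
  calc ‖extChartAt (𝓡 n) p₀ q - extChartAt (𝓡 n) p₀ (σ (ℓ' - ε)) - ε • v‖
      = ‖(extChartAt (𝓡 n) p₀ q - x) + (x - z₀ - ε • v) +
          (z₀ - extChartAt (𝓡 n) p₀ (σ (ℓ' - ε)))‖ := by congr 1; abel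
    _ ≤ δ / 3 * ε + δ / 3 * ε + δ / 3 * ε :=
        norm_add₃_le.trans (add_le_add_three hqnear.le havg hznear.le)
    _ = δ * ε := by ring

theorem exists_isUnitGradient_fdistFrom [T2Space M] (hF : IsFinslerStructure F)
    (hmin : HasShortestCurves F) {K : Set M} (hK : IsCompact K)
    (hp : p ∈ (extChartAt (𝓡 n) p₀).source) (hcut : p ∉ cutLocus F K)
    (hpos : 0 < fdistFrom F K p) : ∃ v, IsUnitGradient (localExpr F p₀)
      (fun x => fdistFrom F K ((extChartAt (𝓡 n) p₀).symm x)) (extChartAt (𝓡 n) p₀ p) v := by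
  set φ := extChartAt (𝓡 n) p₀
  have hne := nonempty_of_fdistFrom_pos hpos
  obtain ⟨γ, hγ⟩ := exists_isShortest hF hmin hK hne p
  obtain ⟨v, hv, hderiv⟩ := hγ.isUnitCurve.exists_terminal_velocity (p₀ := p₀) hF hpos
    (hγ.target.symm ▸ hp)
  rw [hγ.target] at hv
  refine ⟨v, hv, hasStrictFDerivAt_iff_isLittleO.2 (Asymptotics.isLittleO_iff.2 fun η hη => ?_)⟩
  set ξ := fderiv ℝ (localExpr F p₀ (φ p)) v
  obtain ⟨δ, hδ, hvar⟩ := exists_fdist_variation hF (φ.map_source hp) hv hη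
  obtain ⟨ε, htail, hε, hεδ⟩ := ((hγ.eventually_tail_near hF hmin hK hcut hpos hp hderiv hδ).and
    (Ioo_mem_nhdsGT hδ)).exists
  obtain ⟨δ', hδ', hvar⟩ := hvar ε hε hεδ
  -- Holding at all base points near `φ p`, this bound is two-sided: exchange `x` and `y`.
  have hone_sided : ∀ᶠ x in 𝓝 (φ p), ∀ y, ‖y - x‖ < δ' →
      fdistFrom F K (φ.symm y) - fdistFrom F K (φ.symm x) ≤ ξ (y - x) + η * ‖y - x‖ := by
    have hsymm : Tendsto φ.symm (𝓝 (φ p)) (𝓝 p) := by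
      have hcont := continuousAt_extChartAt_symm' hp
      rwa [ContinuousAt, (extChartAt (𝓡 n) p₀).left_inv hp] at hcont
    filter_upwards [hsymm.eventually htail, extChartAt_target_mem_nhds_of_mem (φ.map_source hp)]
      with x hx hxt y hyx
    obtain ⟨σ, hσ⟩ := exists_isShortest hF hmin hK hne (φ.symm x)
    obtain ⟨hεℓ, hmaps, havg⟩ := hx σ _ hσ
    have hle := hvar σ _ hσ.isUnitCurve hεℓ hmaps havg (y - x) hyx
    rw [hσ.target, φ.right_inv hxt, add_sub_cancel] at hle
    linarith [fdistFrom_triangle hF hmin hne (σ (fdistFrom F K (φ.symm x) - ε)) (φ.symm y),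
      hσ.fdistFrom_eq hF hmin (u := fdistFrom F K (φ.symm x) - ε)
        ⟨sub_nonneg.2 hεℓ, by linarith⟩]
  have hclose : ∀ᶠ w in 𝓝 (φ p, φ p), ‖w.1 - w.2‖ < δ' := by
    refine Tendsto.eventually_lt_const (by simpa using hδ') (Continuous.tendsto ?_ _)
    fun_prop
  filter_upwards [hclose, hone_sided.prod_nhds hone_sided] with ⟨x, y⟩ hxy ⟨hx, hy⟩
  have hxy' := hx y (norm_sub_rev x y ▸ hxy)
  rw [← neg_sub x y, map_neg, norm_neg] at hxy'
  rw [Real.norm_eq_abs, abs_le]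
  constructor <;> linarith [hy x hxy]

end Differentiability

/-! ### Tangent vectors of level sets -/

section LevelSets

theorem exists_curve_in_levelSet {V W : Type*} [NormedAddCommGroup V] [NormedSpace ℝ V]
    [CompleteSpace V] [NormedAddCommGroup W] [NormedSpace ℝ W] [FiniteDimensional ℝ W] {g : V → W}
    {g' : V →L[ℝ] W} {x₀ u : V} (hg : HasStrictFDerivAt g g' x₀) (hg' : g'.range = ⊤)
    (hu : g' u = 0) : ∃ c : ℝ → V, HasDerivAt c u 0 ∧ c 0 = x₀ ∧ ∀ᶠ t in 𝓝 0, g (c t) = g x₀ := by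
  let u' : g'.ker := ⟨u, hu⟩
  have hline : HasDerivAt (fun t : ℝ => t • u') u' 0 := by
    simpa using (hasDerivAt_id (0 : ℝ)).smul_const u'
  refine ⟨fun t => hg.implicitFunction g g' hg' (g x₀) (t • u'), ?_, ?_, ?_⟩
  · have himplicit := (hg.to_implicitFunction hg').hasFDerivAt
    rw [← zero_smul ℝ u'] at himplicit
    exact himplicit.comp_hasDerivAt 0 hline
  · simp only [zero_smul, hg.implicitFunction_apply_image hg']
  · have htendsto : Tendsto (fun t : ℝ => (g x₀, t • u')) (𝓝 0) (𝓝 (g x₀, 0)) :=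
      Continuous.tendsto' (by fun_prop) _ _ (by simp)
    exact htendsto.eventually (hg.map_implicitFunction_eq hg')

variable {n : ℕ} {M : Type*} [TopologicalSpace M] [ChartedSpace (EuclideanSpace ℝ (Fin n)) M]
  {p₀ p : M}

/-- The tangent vectors at `p` which are mapped to the kernel of `ξ` by the chart at `p₀`. -/
noncomputable def chartKer (p₀ p : M) (ξ : EuclideanSpace ℝ (Fin n) →L[ℝ] ℝ) :
    Submodule ℝ (TangentSpace (𝓡 n) p) :=
  LinearMap.ker (ξ.toLinearMap ∘ₗ (chartDeriv p₀ p).toLinearMap)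

theorem mem_chartKer {ξ : EuclideanSpace ℝ (Fin n) →L[ℝ] ℝ} {v : TangentSpace (𝓡 n) p} :
    v ∈ chartKer p₀ p ξ ↔ ξ (chartDeriv p₀ p v) = 0 :=
  LinearMap.mem_ker

variable [IsManifold (𝓡 n) ∞ M]

theorem finrank_chartKer_add_one (hp : p ∈ (extChartAt (𝓡 n) p₀).source)
    {ξ : EuclideanSpace ℝ (Fin n) →L[ℝ] ℝ} (hξ : ξ ≠ 0) :
    Module.finrank ℝ (chartKer p₀ p ξ) + 1 = n := by
  have : FiniteDimensional ℝ (TangentSpace (𝓡 n) p) :=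
    inferInstanceAs (FiniteDimensional ℝ (EuclideanSpace ℝ (Fin n)))
  have hne : ξ.toLinearMap ∘ₗ (chartDeriv p₀ p).toLinearMap ≠ 0 := by
    refine fun h => hξ (ContinuousLinearMap.ext fun w => ?_)
    obtain ⟨v, rfl⟩ := (chartDeriv_bijective hp).2 w
    exact congrArg (fun T => T v) h
  exact (Module.Dual.finrank_ker_add_one_of_ne_zero hne).trans
    (finrank_euclideanSpace_fin (𝕜 := ℝ) (n := n))

theorem tangentBundle_ext {z z' : TangentBundle (𝓡 n) M} (h : z.1 = z'.1)
    (hs : z.1 ∈ (extChartAt (𝓡 n) p₀).source)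
    (hd : chartDeriv p₀ z.1 z.2 = chartDeriv p₀ z'.1 z'.2) : z = z' := by
  obtain ⟨p, v⟩ := z
  obtain ⟨p', v'⟩ := z'
  obtain rfl : p = p' := h
  congr 1
  exact (chartDeriv_bijective hs).1 hd

theorem velocity_chart_symm_comp_eq {c : ℝ → EuclideanSpace ℝ (Fin n)} {x : ℝ}
    {v : TangentSpace (𝓡 n) p} (hc : HasDerivAt c (chartDeriv p₀ p v) x)
    (hx : c x ∈ (extChartAt (𝓡 n) p₀).target) (hp : (extChartAt (𝓡 n) p₀).symm (c x) = p) :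
    velocity (fun t => (extChartAt (𝓡 n) p₀).symm (c t)) x = ⟨p, v⟩ := by
  have hsource := (extChartAt (𝓡 n) p₀).map_target hx
  have hderiv := hasDerivAt_chart_comp (p₀ := p₀)
    (mdifferentiableAt_chart_symm_comp hc.differentiableAt hx) hsource
  refine tangentBundle_ext (p₀ := p₀) hp hsource (hderiv.unique (hc.congr_of_eventuallyEq ?_))
  filter_upwards [hc.continuousAt (extChartAt_target_mem_nhds_of_mem hx)] with t ht
  exact (extChartAt (𝓡 n) p₀).right_inv ht

theorem fderiv_chartDeriv_eq_zero_of_mem_tangentVectors {g : M → ℝ}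
    (hp : p ∈ (extChartAt (𝓡 n) p₀).source) {ξ : EuclideanSpace ℝ (Fin n) →L[ℝ] ℝ}
    (hξ : HasFDerivAt (fun x => g ((extChartAt (𝓡 n) p₀).symm x)) ξ (extChartAt (𝓡 n) p₀ p))
    {v : TangentSpace (𝓡 n) p} (hv : v ∈ tangentVectors (g ⁻¹' {g p}) p) :
    ξ (chartDeriv p₀ p v) = 0 := by
  obtain ⟨c, hc, hcS, hv⟩ := hv
  obtain rfl : c 0 = p := congrArg Bundle.TotalSpace.proj hv
  have hderiv := hasDerivAt_chart_comp hc hp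
  rw [show chartDeriv p₀ (c 0) (mfderiv 𝓘(ℝ, ℝ) (𝓡 n) c 0 (1 : ℝ)) = chartDeriv p₀ (c 0) v from
    congrArg (fun z : TangentBundle (𝓡 n) M => chartDeriv p₀ z.1 z.2) hv] at hderiv
  refine (hξ.comp_hasDerivAt (0 : ℝ) hderiv).unique
    ((hasDerivAt_const (0 : ℝ) (g (c 0))).congr_of_eventuallyEq ?_)
  filter_upwards [hcS, hc.continuousAt ((isOpen_extChartAt_source p₀).mem_nhds hp)] with t ht hts
  exact (congrArg g ((extChartAt (𝓡 n) p₀).left_inv hts)).trans ht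

theorem mem_tangentVectors_levelSet {g : M → ℝ} (hp : p ∈ (extChartAt (𝓡 n) p₀).source)
    {ξ : EuclideanSpace ℝ (Fin n) →L[ℝ] ℝ} (hξ : HasStrictFDerivAt
      (fun x => g ((extChartAt (𝓡 n) p₀).symm x)) ξ (extChartAt (𝓡 n) p₀ p)) (hξ0 : ξ ≠ 0)
    {v : TangentSpace (𝓡 n) p} :
    v ∈ tangentVectors (g ⁻¹' {g p}) p ↔ ξ (chartDeriv p₀ p v) = 0 := by
  refine ⟨fderiv_chartDeriv_eq_zero_of_mem_tangentVectors hp hξ.hasFDerivAt, fun hv => ?_⟩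
  have hsurj : Function.Surjective ξ := LinearMap.surjective fun h =>
    hξ0 (ContinuousLinearMap.coe_injective h)
  obtain ⟨c, hc, hc0, hcS⟩ := exists_curve_in_levelSet hξ (LinearMap.range_eq_top.2 hsurj) hv
  have hct : c 0 ∈ (extChartAt (𝓡 n) p₀).target := hc0 ▸ (extChartAt (𝓡 n) p₀).map_source hp
  refine ⟨fun t => (extChartAt (𝓡 n) p₀).symm (c t),
    mdifferentiableAt_chart_symm_comp hc.differentiableAt hct, ?_,
    velocity_chart_symm_comp_eq hc hct (by rw [hc0, (extChartAt (𝓡 n) p₀).left_inv hp])⟩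
  rwa [(extChartAt (𝓡 n) p₀).left_inv hp] at hcS

theorem hasTangentHyperplane_levelSet {g : M → ℝ} (hp : p ∈ (extChartAt (𝓡 n) p₀).source)
    {ξ : EuclideanSpace ℝ (Fin n) →L[ℝ] ℝ} (hξ : HasStrictFDerivAt
      (fun x => g ((extChartAt (𝓡 n) p₀).symm x)) ξ (extChartAt (𝓡 n) p₀ p)) (hξ0 : ξ ≠ 0) :
    HasTangentHyperplane (g ⁻¹' {g p}) p (chartKer p₀ p ξ) :=
  ⟨finrank_chartKer_add_one hp hξ0,
    Set.ext fun _ => (mem_tangentVectors_levelSet hp hξ hξ0).trans mem_chartKer.symm⟩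

end LevelSets

/-! ### Regularity of extremals -/

section Legendre

variable {V : Type*} [NormedAddCommGroup V] [NormedSpace ℝ V] {Ω : Set V} {f : V → V → ℝ}

/-- The vertical derivative of `f ^ 2 / 2`, which takes velocities to momenta. -/
noncomputable def legendre (f : V → V → ℝ) (z : V × V) : V →L[ℝ] ℝ :=
  f z.1 z.2 • fderiv ℝ (f z.1) z.2

theorem legendre_of_unit {x w : V} (hw : f x w = 1) : legendre f (x, w) = fderiv ℝ (f x) w := by
  rw [legendre, hw, one_smul]

namespace IsLocalFinsler

variable (hf : IsLocalFinsler Ω f) {x w : V} (hx : x ∈ Ω) (hw : w ≠ 0)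
include hf

theorem contDiffOn_fderiv : ContDiffOn ℝ ∞ (fderiv ℝ (Function.uncurry f)) (Ω ×ˢ {0}ᶜ) :=
  hf.smooth.fderiv_of_isOpen hf.isOpen_slit (by simp)

theorem contDiffOn_legendre : ContDiffOn ℝ ∞ (legendre f) (Ω ×ˢ {0}ᶜ) :=
  hf.smooth.smul <| (hf.contDiffOn_fderiv.clm_comp contDiffOn_const).congr fun _ hz =>
    hf.fderiv_fibre hz.1 hz.2

include hx hw

theorem contDiffAt_legendre : ContDiffAt ℝ ∞ (legendre f) (x, w) :=
  hf.contDiffOn_legendre.contDiffAt (hf.isOpen_slit.mem_nhds ⟨hx, hw⟩)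

theorem fderiv_legendre_apply (u : V) :
    fderiv ℝ (legendre f) (x, w) (0, u) u = fundamentalTensor (f x) w u u := by
  have hline : HasDerivAt (fun t : ℝ => (x, w + t • u)) (0, u) 0 := by
    simpa using (hasDerivAt_const (0 : ℝ) x).prodMk
      (((hasDerivAt_id (0 : ℝ)).smul_const u).const_add w)
  have hne : ∀ᶠ t : ℝ in 𝓝 0, w + t • u ≠ 0 := by
    have hc : ContinuousAt (fun t : ℝ => w + t • u) 0 := by fun_prop
    exact hc.eventually_ne (by simpa using hw)
  have hinner : deriv (fun t : ℝ => f x (w + t • u) ^ 2) =ᶠ[𝓝 0]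
      fun t => 2 * legendre f (x, w + t • u) u := by
    filter_upwards [hne] with t ht
    rw [(((hf.isMinkowski x hx).hasDerivAt_line ht).fun_pow 2).deriv]
    simp [legendre, mul_assoc]
  have hlegendre : HasFDerivAt (legendre f) (fderiv ℝ (legendre f) (x, w))
      (x, w + (0 : ℝ) • u) := by
    rw [zero_smul, add_zero]
    exact ((hf.contDiffAt_legendre hx hw).differentiableAt (by simp)).hasFDerivAt
  have houter : HasDerivAt (fun t : ℝ => 2 * legendre f (x, w + t • u) u)
      (2 * fderiv ℝ (legendre f) (x, w) (0, u) u) 0 := by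
    simpa using ((hlegendre.comp_hasDerivAt_of_eq (0 : ℝ) hline rfl).clm_apply
      (hasDerivAt_const (0 : ℝ) u)).const_mul 2
  have htensor := fundamentalTensor_line (f x) w u 0
  rw [zero_smul, add_zero, hinner.deriv_eq, houter.deriv] at htensor
  rw [htensor]
  ring

theorem injective_fst_prod_fderiv_legendre :
    Function.Injective ((ContinuousLinearMap.fst ℝ V V).prod (fderiv ℝ (legendre f) (x, w))) := by
  rw [injective_iff_map_eq_zero]
  rintro ⟨u₁, u₂⟩ hu
  obtain rfl : u₁ = 0 := congrArg Prod.fst hu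
  have hu₂ : fderiv ℝ (legendre f) (x, w) (0, u₂) = 0 := congrArg Prod.snd hu
  by_contra hne
  have hpos := (hf.isMinkowski x hx).posDef w hw u₂ fun h => hne (by rw [h, Prod.mk_zero_zero])
  rw [← hf.fderiv_legendre_apply hx hw, hu₂, _root_.zero_apply] at hpos
  exact hpos.false

theorem exists_legendre_inverse [FiniteDimensional ℝ V] : ∃ Ψ : V × (V →L[ℝ] ℝ) → V × V,
    ContDiffAt ℝ ∞ Ψ (x, legendre f (x, w)) ∧ ∀ᶠ z in 𝓝 (x, w), Ψ (z.1, legendre f z) = z := by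
  have hdual : Module.finrank ℝ (V →L[ℝ] ℝ) = Module.finrank ℝ V :=
    (LinearMap.toContinuousLinearMap (𝕜 := ℝ) (E := V) (F' := ℝ)).finrank_eq.symm.trans
      Subspace.dual_finrank_eq
  let e : (V × V) ≃L[ℝ] V × (V →L[ℝ] ℝ) := (LinearEquiv.ofInjectiveOfFinrankEq _
    (hf.injective_fst_prod_fderiv_legendre hx hw)
    (by rw [Module.finrank_prod, Module.finrank_prod, hdual])).toContinuousLinearEquiv
  have hsmooth : ContDiffAt ℝ ∞ (fun z => (z.1, legendre f z)) (x, w) :=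
    contDiffAt_fst.prodMk (hf.contDiffAt_legendre hx hw)
  have hderiv : HasFDerivAt (fun z => (z.1, legendre f z))
      (e : V × V →L[ℝ] V × (V →L[ℝ] ℝ)) (x, w) :=
    hasFDerivAt_fst.prodMk
      ((hf.contDiffAt_legendre hx hw).differentiableAt (by simp)).hasFDerivAt
  have := FiniteDimensional.complete ℝ (V × V)
  refine ⟨hsmooth.localInverse hderiv (by simp), hsmooth.to_localInverse hderiv (by simp), ?_⟩
  filter_upwards [(hsmooth.toOpenPartialHomeomorph _ hderiv (by simp)).open_source.mem_nhds
    (hsmooth.mem_toOpenPartialHomeomorph_source hderiv (by simp))] with z hz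
  exact (hsmooth.toOpenPartialHomeomorph _ hderiv (by simp)).left_inv hz

end IsLocalFinsler

end Legendre

section Extremals

theorem exists_Icc_mem_nhdsWithin {a b u₀ : ℝ} (hu₀ : u₀ ∈ Icc a b) {s : Set ℝ}
    (hs : s ∈ 𝓝[Icc a b] u₀) : ∃ a' b', a ≤ a' ∧ b' ≤ b ∧ u₀ ∈ Icc a' b' ∧ Icc a' b' ⊆ s ∧
      Icc a' b' ∈ 𝓝[Icc a b] u₀ := by
  obtain ⟨r, hr, hball⟩ := (nhdsWithin_hasBasis Metric.nhds_basis_closedBall _).mem_iff.1 hs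
  have heq : Icc (max a (u₀ - r)) (min b (u₀ + r)) = Metric.closedBall u₀ r ∩ Icc a b := by
    rw [Real.closedBall_eq_Icc, Icc_inter_Icc, sup_comm, inf_comm]
  refine ⟨max a (u₀ - r), min b (u₀ + r), le_max_left _ _, min_le_left _ _, ?_, ?_, ?_⟩
  · exact heq ▸ ⟨Metric.mem_closedBall_self hr.le, hu₀⟩
  · exact heq ▸ hball
  · exact heq ▸ inter_comm (Icc a b) _ ▸ inter_mem_nhdsWithin _ (Metric.closedBall_mem_nhds u₀ hr)

theorem contDiffWithinAt_of_hasDerivWithinAt {E : Type*} [NormedAddCommGroup E]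
    [NormedSpace ℝ E] [CompleteSpace E] {H : E → E} {Z : ℝ → E} {a b u₀ : ℝ} (hu₀ : u₀ ∈ Icc a b)
    (hH : ContDiffAt ℝ ∞ H (Z u₀))
    (hZ : ∀ᶠ u in 𝓝[Icc a b] u₀, HasDerivWithinAt Z (H (Z u)) (Icc a b) u) :
    ContDiffWithinAt ℝ ∞ Z (Icc a b) u₀ := by
  refine contDiffWithinAt_infty.2 fun k => ?_
  obtain ⟨U, hU, hHU⟩ := (hH.of_le (by exact_mod_cast le_top : (k : WithTop ℕ∞) ≤ ∞)).contDiffOn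
    (m := k) le_rfl (by simp)
  have hZU : ∀ᶠ u in 𝓝[Icc a b] u₀, Z u ∈ U :=
    (hZ.self_of_nhdsWithin hu₀).continuousWithinAt hU
  obtain ⟨a', b', ha, hb, hu₀', hsub, hmem⟩ := exists_Icc_mem_nhdsWithin hu₀ (hZ.and hZU)
  have hsmooth : ContDiffOn ℝ k Z (Icc a' b') :=
    ODE.contDiffOn_enat_Icc_of_hasDerivWithinAt (n := k) (f := fun _ => H) (u := U)
      (hHU.comp contDiffOn_snd fun _ hz => hz.2)
      (fun u hu => (hsub hu).1.mono (Icc_subset_Icc ha hb)) fun u hu => (hsub hu).2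
  exact (hsmooth u₀ hu₀').mono_of_mem_nhdsWithin hmem

variable {V : Type*} [NormedAddCommGroup V] [NormedSpace ℝ V]

/-- The Euler–Lagrange equation of `f` for the unit speed curve `c` with velocity `w`. The velocity
is a separate argument, so that it is available at the end points of the interval `J`. -/
structure IsUnitExtremal (f : V → V → ℝ) (c w : ℝ → V) (J : Set ℝ) : Prop where
  continuousOn : ContinuousOn w J
  unit : ∀ u ∈ J, f (c u) (w u) = 1
  hasDerivWithinAt : ∀ u ∈ J, HasDerivWithinAt c (w u) J u
  euler : ∀ u ∈ J, HasDerivWithinAt (fun u => fderiv ℝ (f (c u)) (w u))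
    ((fderiv ℝ (Function.uncurry f) (c u, w u)).comp (ContinuousLinearMap.inl ℝ V V)) J u

variable [FiniteDimensional ℝ V] {Ω : Set V} {f : V → V → ℝ}

-- Hamilton's equations: the vector field is smooth because the Legendre transformation is a local
-- diffeomorphism.
theorem IsUnitExtremal.exists_vectorField (hf : IsLocalFinsler Ω f) {c w : ℝ → V} {J : Set ℝ}
    (h : IsUnitExtremal f c w J) (hc : MapsTo c J Ω) {u₀ : ℝ} (hu₀ : u₀ ∈ J) :
    ∃ H : V × (V →L[ℝ] ℝ) → V × (V →L[ℝ] ℝ),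
      ContDiffAt ℝ ∞ H (c u₀, fderiv ℝ (f (c u₀)) (w u₀)) ∧
      ∀ᶠ u in 𝓝[J] u₀, HasDerivWithinAt (fun u => (c u, fderiv ℝ (f (c u)) (w u)))
        (H (c u, fderiv ℝ (f (c u)) (w u))) J u := by
  have hw₀ := hf.ne_zero_of_unit (hc hu₀) (h.unit u₀ hu₀)
  obtain ⟨Ψ, hΨ, hinv⟩ := hf.exists_legendre_inverse (hc hu₀) hw₀
  have hbase : Ψ (c u₀, legendre f (c u₀, w u₀)) = (c u₀, w u₀) := hinv.self_of_nhds
  rw [legendre_of_unit (h.unit u₀ hu₀)] at hΨ hbase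
  refine ⟨fun z => ((Ψ z).2,
    (fderiv ℝ (Function.uncurry f) (Ψ z)).comp (ContinuousLinearMap.inl ℝ V V)), ?_, ?_⟩
  · refine hΨ.snd.prodMk (ContDiffAt.clm_comp (ContDiffAt.comp _ ?_ hΨ) contDiffAt_const)
    rw [hbase]
    exact hf.contDiffOn_fderiv.contDiffAt (hf.isOpen_slit.mem_nhds ⟨hc hu₀, hw₀⟩)
  · have hcw : ContinuousWithinAt (fun u => (c u, w u)) J u₀ :=
      (h.hasDerivWithinAt u₀ hu₀).continuousWithinAt.prodMk (h.continuousOn u₀ hu₀)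
    filter_upwards [hcw.eventually hinv, self_mem_nhdsWithin] with u hu huJ
    rw [legendre_of_unit (h.unit u huJ)] at hu
    rw [hu]
    exact (h.hasDerivWithinAt u huJ).prodMk (h.euler u huJ)

theorem IsUnitExtremal.contDiffOn (hf : IsLocalFinsler Ω f) {c w : ℝ → V} {a b : ℝ}
    (h : IsUnitExtremal f c w (Icc a b)) (hc : MapsTo c (Icc a b) Ω) :
    ContDiffOn ℝ ∞ c (Icc a b) := fun u₀ hu₀ => by
  have := FiniteDimensional.complete ℝ V
  obtain ⟨H, hH, hsolves⟩ := h.exists_vectorField hf hc hu₀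
  exact (contDiffWithinAt_of_hasDerivWithinAt hu₀ hH hsolves).fst

end Extremals

section Gradients

theorem continuousOn_of_hasStrictFDerivAt {E G : Type*} [NormedAddCommGroup E] [NormedSpace ℝ E]
    [NormedAddCommGroup G] [NormedSpace ℝ G] {g : E → G} {g' : E → E →L[ℝ] G} {S : Set E}
    (hg : ∀ x ∈ S, HasStrictFDerivAt g (g' x) x) : ContinuousOn g' S := by
  intro x hx
  refine Metric.continuousWithinAt_iff'.2 fun ε hε => ?_
  lift ε to NNReal using hε.le
  have hremainder : HasStrictFDerivAt (fun y => g y - g' x y) 0 x :=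
    sub_self (g' x) ▸ (hg x hx).sub (g' x).hasStrictFDerivAt
  obtain ⟨U, hU, hlip⟩ := hremainder.exists_lipschitzOnWith_of_nnnorm_lt (ε / 2)
    (by simpa using hε)
  filter_upwards [mem_nhdsWithin_of_mem_nhds (eventually_mem_nhds_iff.2 hU),
    self_mem_nhdsWithin] with y hy hyS
  have hle := ((hg y hyS).hasFDerivAt.sub (g' x).hasFDerivAt).le_of_lipschitzOn hy hlip
  rw [dist_eq_norm]
  exact hle.trans_lt (by simpa using hε)

variable {V : Type*} [NormedAddCommGroup V] [NormedSpace ℝ V] {Ω : Set V} {f : V → V → ℝ}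
  {g : V → ℝ}

theorem IsUnitGradient.fderiv_ne_zero {x v : V} (h : IsUnitGradient f g x v)
    (hN : IsMinkowski (f x)) : fderiv ℝ (f x) v ≠ 0 := fun h0 => by
  have hself := hN.fderiv_self (hN.ne_zero_of_unit h.unit)
  rw [h0, h.unit] at hself
  exact zero_ne_one hself

theorem IsUnitGradient.eq_of_hasDerivWithinAt {c : ℝ → V} {s : Set ℝ} {u k : ℝ} {v w : V}
    (h : IsUnitGradient f g (c u) v) (hN : IsMinkowski (f (c u))) (hw : f (c u) w = 1)
    (hc : HasDerivWithinAt c w s u) (hs : UniqueDiffWithinAt ℝ s u) (hu : u ∈ s)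
    (hg : ∀ᶠ x in 𝓝[s] u, g (c x) = x + k) : w = v :=
  hN.eq_of_fderiv_eq_one h.unit hw <| hs.eq_deriv _
    (h.hasStrictFDerivAt.hasFDerivAt.comp_hasDerivWithinAt u hc)
    (((hasDerivWithinAt_id u s).add_const k).congr_of_eventuallyEq_of_mem hg hu)

theorem IsLocalFinsler.continuousOn_unitGradient [FiniteDimensional ℝ V]
    (hf : IsLocalFinsler Ω f) {S : Set V} (hS : S ⊆ Ω) {v : V → V}
    (hv : ∀ x ∈ S, IsUnitGradient f g x (v x)) : ContinuousOn v S := by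
  intro x hx
  obtain ⟨R, hR, -, -, -, -, hRΩ, -⟩ := hf.exists_bounds_closedBall (hS hx)
  have := FiniteDimensional.proper_real V
  have hunit : ∀ᶠ y in 𝓝[S] x, (y, v y) ∈ {z : V × V | z.1 ∈ Metric.closedBall x R ∧
      f z.1 z.2 = 1} := by
    filter_upwards [mem_nhdsWithin_of_mem_nhds (Metric.closedBall_mem_nhds x hR),
      self_mem_nhdsWithin] with y hy hyS using ⟨hy, (hv y hyS).unit⟩
  have hmomentum : Tendsto (fun y => fderiv ℝ (f y) (v y)) (𝓝[S] x) (𝓝 (fderiv ℝ (f x) (v x))) :=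
    continuousOn_of_hasStrictFDerivAt (fun y hy => (hv y hy).hasStrictFDerivAt) x hx
  have hpair : Tendsto (fun y => (y, v y)) (𝓝[S] x) (𝓝 (x, v x)) := by
    refine (hf.isCompact_unit (isCompact_closedBall x R) hRΩ).tendsto_nhds_of_unique_mapClusterPt
      hunit fun z hz hcluster => ?_
    obtain ⟨U, hU, hUz⟩ := mapClusterPt_iff_ultrafilter.1 hcluster
    have hzx : z.1 = x := tendsto_nhds_unique (continuousAt_fst.tendsto.comp hUz)
      (tendsto_id.mono_left (hU.trans nhdsWithin_le_nhds))
    obtain ⟨x', w⟩ := z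
    obtain rfl : x' = x := hzx
    have hN := hf.isMinkowski x' (hS hx)
    have hlim : fderiv ℝ (f x') w = fderiv ℝ (f x') (v x') :=
      tendsto_nhds_unique ((hf.continuousOn_fderiv_fibre.continuousAt (hf.isOpen_slit.mem_nhds
        ⟨hS hx, hN.ne_zero_of_unit hz.2⟩)).tendsto.comp hUz) (hmomentum.mono_left hU)
    rw [Prod.mk_right_inj]
    refine hN.eq_of_fderiv_eq_one (hv x' hx).unit hz.2 ?_
    rw [← hlim, hN.fderiv_self (hN.ne_zero_of_unit hz.2), hz.2]
  exact continuousAt_snd.tendsto.comp hpair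

end Gradients

section EulerLagrange

theorem hasDerivWithinAt_of_eq_add_integral {E : Type*} [NormedAddCommGroup E] [NormedSpace ℝ E]
    [CompleteSpace E] {c w : ℝ → E} {a b : ℝ} (hw : ContinuousOn w (Icc a b))
    (hc : ∀ u ∈ Icc a b, c u = c a + ∫ x in a..u, w x) :
    ∀ u ∈ Icc a b, HasDerivWithinAt c (w u) (Icc a b) u := by
  intro u hu
  have : Fact (u ∈ Icc a b) := ⟨hu⟩
  have hint : IntervalIntegrable w volume a u :=
    (hw.mono (uIcc_of_le hu.1 ▸ Icc_subset_Icc_right hu.2)).intervalIntegrable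
  have hderiv : HasDerivWithinAt (fun u => ∫ x in a..u, w x) (w u) (Icc a b) u :=
    intervalIntegral.integral_hasDerivWithinAt_right hint
      (hw.stronglyMeasurableAtFilter_nhdsWithin measurableSet_Icc u) (hw u hu)
  exact (hderiv.const_add (c a)).congr hc (hc u hu)

theorem hasDerivWithinAt_of_piecewise {E : Type*} [NormedAddCommGroup E] [NormedSpace ℝ E]
    [CompleteSpace E] {c w : ℝ → E} {a b : ℝ} {P : Finset ℝ} (hc : ContinuousOn c (Icc a b))
    (hw : ContinuousOn w (Icc a b)) (hd : ∀ x ∈ Ioo a b, x ∉ P → HasDerivAt c (w x) x) :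
    ∀ u ∈ Icc a b, HasDerivWithinAt c (w u) (Icc a b) u := by
  refine hasDerivWithinAt_of_eq_add_integral hw fun u hu => ?_
  have hsub : Icc a u ⊆ Icc a b := Icc_subset_Icc_right hu.2
  rw [integral_eq_of_hasDerivAt_off_countable_of_le c w hu.1 P.countable_toSet (hc.mono hsub)
    (fun x hx => hd x ⟨hx.1.1, hx.1.2.trans_le hu.2⟩ hx.2)
    (hw.mono (uIcc_of_le hu.1 ▸ hsub)).intervalIntegrable, add_sub_cancel]

variable {V : Type*} [NormedAddCommGroup V] [NormedSpace ℝ V] [FiniteDimensional ℝ V]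
  {Ω : Set V} {f : V → V → ℝ} {c w : ℝ → V} {a b : ℝ}

namespace IsLocalFinsler

variable (hf : IsLocalFinsler Ω f) (hc : ContinuousOn c (Icc a b)) (hw : ContinuousOn w (Icc a b))
  (hcΩ : MapsTo c (Icc a b) Ω) (hw0 : ∀ x ∈ Icc a b, w x ≠ 0)
include hf hc hw hcΩ hw0

theorem exists_bound_translate (e : V) : ∃ C, ∀ᶠ τ : ℝ in 𝓝 0, ∀ x ∈ Icc a b, c x + τ • e ∈ Ω ∧
    ‖fderiv ℝ (Function.uncurry f) (c x + τ • e, w x)‖ ≤ C := by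
  have := FiniteDimensional.proper_real V
  have hcompact : IsCompact ((fun x => (c x, w x)) '' Icc a b) :=
    isCompact_Icc.image_of_continuousOn (hc.prodMk hw)
  obtain ⟨δ, hδ, hsub⟩ := hcompact.exists_cthickening_subset_open hf.isOpen_slit
    (image_subset_iff.2 fun x hx => ⟨hcΩ hx, hw0 x hx⟩)
  obtain ⟨C, hC⟩ := hcompact.cthickening.exists_bound_of_continuousOn
    (hf.continuousOn_fderiv.mono hsub)
  have hsmall : ∀ᶠ τ : ℝ in 𝓝 0, ‖τ • e‖ ≤ δ := by
    have hcont : Continuous fun τ : ℝ => ‖τ • e‖ := by fun_prop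
    exact (hcont.tendsto 0).eventually_le_const (by simpa using hδ)
  refine ⟨C, hsmall.mono fun τ hτ x hx => ?_⟩
  have hmem : (c x + τ • e, w x) ∈ Metric.cthickening δ ((fun x => (c x, w x)) '' Icc a b) :=
    Metric.mem_cthickening_of_dist_le _ _ _ _ (mem_image_of_mem _ hx)
      (by simpa [Prod.dist_eq, hδ.le] using hτ)
  exact ⟨(hsub hmem).1, hC _ hmem⟩

theorem hasDerivAt_integral_translate (hab : a ≤ b) (e : V) :
    HasDerivAt (fun τ : ℝ => ∫ x in a..b, f (c x + τ • e) (w x))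
      (∫ x in a..b, fderiv ℝ (Function.uncurry f) (c x, w x) (e, 0)) 0 := by
  obtain ⟨C, hC⟩ := hf.exists_bound_translate hc hw hcΩ hw0 e
  have hmeas {φ : ℝ → ℝ} (hφ : ContinuousOn φ (Icc a b)) :
      AEStronglyMeasurable φ (volume.restrict (uIoc a b)) := by
    rw [uIoc_of_le hab]
    exact (hφ.mono Ioc_subset_Icc_self).aestronglyMeasurable measurableSet_Ioc
  have hsub : uIoc a b ⊆ Icc a b := uIoc_of_le hab ▸ Ioc_subset_Icc_self
  have hcont {τ : ℝ} (hτ : ∀ x ∈ Icc a b, c x + τ • e ∈ Ω) :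
      ContinuousOn (fun x => f (c x + τ • e) (w x)) (Icc a b) :=
    hf.continuousOn_uncurry.comp ((hc.add continuousOn_const).prodMk hw) fun x hx =>
      ⟨hτ x hx, mem_univ _⟩
  have hderiv (τ x : ℝ) (hτ : c x + τ • e ∈ Ω) (hx : w x ≠ 0) :
      HasDerivAt (fun τ : ℝ => f (c x + τ • e) (w x))
        (fderiv ℝ (Function.uncurry f) (c x + τ • e, w x) (e, 0)) τ := by
    have hline : HasDerivAt (fun τ : ℝ => (c x + τ • e, w x)) (e, 0) τ := by
      simpa using (((hasDerivAt_id τ).smul_const e).const_add (c x)).prodMk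
        (hasDerivAt_const τ (w x))
    exact (hf.hasFDerivAt hτ hx).comp_hasDerivAt τ hline
  have h0 : ∀ x ∈ Icc a b, c x + (0 : ℝ) • e ∈ Ω := fun x hx => by simpa using hcΩ hx
  have hmain := (intervalIntegral.hasDerivAt_integral_of_dominated_loc_of_deriv_le
    (μ := volume) (a := a) (b := b) (F := fun τ x => f (c x + τ • e) (w x))
    (F' := fun τ x => fderiv ℝ (Function.uncurry f) (c x + τ • e, w x) (e, 0))
    (bound := fun _ => C * ‖((e, 0) : V × V)‖) hC
    (hC.mono fun τ hτ => hmeas (hcont fun x hx => (hτ x hx).1))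
    ((hcont h0).mono (uIcc_of_le hab).subset).intervalIntegrable
    (hmeas ?_) (ae_of_all _ fun x hx τ hτ => ?_) intervalIntegrable_const
    (ae_of_all _ fun x hx τ hτ => hderiv τ x (hτ x (hsub hx)).1 (hw0 x (hsub hx)))).2
  · simpa using hmain
  · exact (hf.continuousOn_fderiv.comp ((hc.add continuousOn_const).prodMk hw)
      fun x hx => ⟨h0 x hx, hw0 x hx⟩).clm_apply continuousOn_const
  · exact ContinuousLinearMap.le_of_opNorm_le _ (hτ x (hsub hx)).2 _

end IsLocalFinsler

variable {g : V → ℝ}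

theorem IsLocalFinsler.integral_euler (hf : IsLocalFinsler Ω f) (hab : a ≤ b)
    (hc : ContinuousOn c (Icc a b)) (hw : ContinuousOn w (Icc a b)) (hcΩ : MapsTo c (Icc a b) Ω)
    (hgrad : ∀ x ∈ Icc a b, IsUnitGradient f g (c x) (w x)) (hgrowth : g (c b) - g (c a) = b - a)
    (hcal : ∀ e, ∀ᶠ τ : ℝ in 𝓝 0,
      g (c b + τ • e) - g (c a + τ • e) ≤ ∫ x in a..b, f (c x + τ • e) (w x)) :
    fderiv ℝ (f (c b)) (w b) - fderiv ℝ (f (c a)) (w a) = ∫ x in a..b,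
      (fderiv ℝ (Function.uncurry f) (c x, w x)).comp (ContinuousLinearMap.inl ℝ V V) := by
  have hw0 : ∀ x ∈ Icc a b, w x ≠ 0 := fun x hx => hf.ne_zero_of_unit (hcΩ hx) (hgrad x hx).unit
  have hint : IntervalIntegrable (fun x => (fderiv ℝ (Function.uncurry f) (c x, w x)).comp
      (ContinuousLinearMap.inl ℝ V V)) volume a b :=
    (((hf.continuousOn_fderiv.comp (hc.prodMk hw) fun x hx => ⟨hcΩ hx, hw0 x hx⟩).clm_comp
      continuousOn_const).mono (uIcc_of_le hab).subset).intervalIntegrable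
  ext e
  rw [ContinuousLinearMap.intervalIntegral_apply hint, _root_.sub_apply]
  have hend (x : ℝ) (hx : x ∈ Icc a b) :
      HasDerivAt (fun τ : ℝ => g (c x + τ • e)) (fderiv ℝ (f (c x)) (w x) e) 0 := by
    have hline : HasDerivAt (fun τ : ℝ => c x + τ • e) e 0 := by
      simpa using ((hasDerivAt_id (0 : ℝ)).smul_const e).const_add (c x)
    exact (hgrad x hx).hasStrictFDerivAt.hasFDerivAt.comp_hasDerivAt_of_eq (0 : ℝ) hline (by simp)
  -- By `hcal` the difference of the two sides is at most its value `0` at `τ = 0`.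
  have hdiff := ((hend b (right_mem_Icc.2 hab)).sub (hend a (left_mem_Icc.2 hab))).sub
    (hf.hasDerivAt_integral_translate hc hw hcΩ hw0 hab e)
  refine sub_eq_zero.1 (IsLocalMax.hasDerivAt_eq_zero ?_ hdiff)
  have hlength : ∫ x in a..b, f (c x) (w x) = b - a := by
    rw [intervalIntegral.integral_congr (g := fun _ => 1) fun x hx =>
      (hgrad x (uIcc_of_le hab ▸ hx)).unit]
    simp
  filter_upwards [hcal e] with τ hτ
  simpa [hlength, hgrowth] using hτ

theorem IsLocalFinsler.isUnitExtremal (hf : IsLocalFinsler Ω f) (hcΩ : MapsTo c (Icc a b) Ω)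
    (hc : ∀ x ∈ Icc a b, HasDerivWithinAt c (w x) (Icc a b) x) (hw : ContinuousOn w (Icc a b))
    (hgrad : ∀ x ∈ Icc a b, IsUnitGradient f g (c x) (w x))
    (hgrowth : ∀ u ∈ Icc a b, g (c u) - g (c a) = u - a)
    (hcal : ∀ u ∈ Icc a b, ∀ e, ∀ᶠ τ : ℝ in 𝓝 0,
      g (c u + τ • e) - g (c a + τ • e) ≤ ∫ x in a..u, f (c x + τ • e) (w x)) :
    IsUnitExtremal f c w (Icc a b) := by
  have hcc : ContinuousOn c (Icc a b) := fun x hx => (hc x hx).continuousWithinAt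
  refine ⟨hw, fun u hu => (hgrad u hu).unit, hc, hasDerivWithinAt_of_eq_add_integral ?_ ?_⟩
  · exact (hf.continuousOn_fderiv.comp (hcc.prodMk hw) fun x hx =>
      ⟨hcΩ hx, hf.ne_zero_of_unit (hcΩ hx) (hgrad x hx).unit⟩).clm_comp continuousOn_const
  · intro u hu
    have hsub : Icc a u ⊆ Icc a b := Icc_subset_Icc_right hu.2
    rw [← hf.integral_euler hu.1 (hcc.mono hsub) (hw.mono hsub) (hcΩ.mono_left hsub)
      (fun x hx => hgrad x (hsub hx)) (hgrowth u hu) (hcal u hu), add_sub_cancel]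

end EulerLagrange

/-! ### Rays and wavefronts -/

section Rays

theorem IsUnitPath.hasDerivWithinAt_unitGradient {V : Type*} [NormedAddCommGroup V]
    [NormedSpace ℝ V] [CompleteSpace V] {Ω : Set V} {f : V → V → ℝ} {g : V → ℝ} {c w : ℝ → V}
    {P : Finset ℝ} {a b : ℝ} (h : IsUnitPath f c P a b) (hf : IsLocalFinsler Ω f)
    (hcΩ : MapsTo c (Icc a b) Ω) (hw : ContinuousOn w (Icc a b))
    (hgrad : ∀ u ∈ Icc a b, IsUnitGradient f g (c u) (w u))
    (hgrowth : ∀ u ∈ Icc a b, g (c u) - g (c a) = u - a) :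
    ∀ u ∈ Icc a b, HasDerivWithinAt c (w u) (Icc a b) u := by
  refine hasDerivWithinAt_of_piecewise (P := P) h.continuousOn hw fun u hu huP => ?_
  have hmem := Ioo_subset_Icc_self hu
  have hderiv := (h.differentiableAt u hu huP).hasDerivAt
  rwa [(hgrad u hmem).eq_of_hasDerivWithinAt (k := g (c a) - a) (hf.isMinkowski _ (hcΩ hmem))
    (h.unit u hu huP) hderiv.hasDerivWithinAt uniqueDiffWithinAt_univ (mem_univ u) ?_] at hderiv
  rw [nhdsWithin_univ]
  filter_upwards [Icc_mem_nhds hu.1 hu.2] with x hx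
  linarith [hgrowth x hx]

variable {n : ℕ} {M : Type*} [TopologicalSpace M] [ChartedSpace (EuclideanSpace ℝ (Fin n)) M]
  [IsManifold (𝓡 n) ∞ M] {F : TangentBundle (𝓡 n) M → ℝ} {p₀ : M} {K : Set M}

theorem IsPiecewiseSmooth.add_const {c : ℝ → EuclideanSpace ℝ (Fin n)} {a b : ℝ}
    (hc : IsPiecewiseSmooth n c a b) (e : EuclideanSpace ℝ (Fin n)) :
    IsPiecewiseSmooth n (fun x => c x + e) a b := by
  obtain ⟨hcont, P, hP⟩ := hc
  exact ⟨hcont.add continuousOn_const, P, fun a' b' ha hab hb hcorner =>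
    ((hP a' b' ha hab hb hcorner).contDiffOn.add contDiffOn_const).contMDiffOn⟩

theorem eventually_fdistFrom_sub_le_integral (hF : IsFinslerStructure F)
    (hmin : HasShortestCurves F) (hne : K.Nonempty) {c : ℝ → EuclideanSpace ℝ (Fin n)} {a b : ℝ}
    (hab : a ≤ b) (hc : IsPiecewiseSmooth n c a b)
    (hs : MapsTo c (Icc a b) (extChartAt (𝓡 n) p₀).target) (e : EuclideanSpace ℝ (Fin n)) :
    ∀ᶠ τ : ℝ in 𝓝 0, fdistFrom F K ((extChartAt (𝓡 n) p₀).symm (c b + τ • e)) -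
      fdistFrom F K ((extChartAt (𝓡 n) p₀).symm (c a + τ • e)) ≤
        ∫ x in a..b, localExpr F p₀ (c x + τ • e) (deriv c x) := by
  have htarget : ∀ᶠ τ : ℝ in 𝓝 0, ∀ y ∈ c '' Icc a b,
      y + τ • e ∈ (extChartAt (𝓡 n) p₀).target := by
    refine (isCompact_Icc.image_of_continuousOn hc.1).eventually_forall_of_forall_eventually
      fun y hy => ?_
    have hcont : ContinuousAt (fun z : ℝ × EuclideanSpace ℝ (Fin n) => z.2 + z.1 • e) (0, y) := by
      fun_prop
    refine hcont.eventually_mem (extChartAt_target_mem_nhds_of_mem ?_)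
    simpa using hs.image_subset hy
  filter_upwards [htarget] with τ hτ
  have hle := fdist_le_integral hF hab (hc.add_const (τ • e)) fun x hx =>
    hτ _ (mem_image_of_mem c hx)
  simp only [deriv_add_const] at hle
  exact (sub_le_iff_le_add'.2 (fdistFrom_triangle hF hmin hne _ _)).trans hle

variable [T2Space M]

theorem exists_continuousOn_isUnitGradient (hF : IsFinslerStructure F)
    (hmin : HasShortestCurves F) (hK : IsCompact K) {γ : ℝ → M} {J : Set ℝ}
    (hγ : ContinuousOn γ J) (hs : MapsTo γ J (extChartAt (𝓡 n) p₀).source)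
    (hcut : ∀ u ∈ J, γ u ∉ cutLocus F K) (hpos : ∀ u ∈ J, 0 < fdistFrom F K (γ u)) :
    ∃ w, ContinuousOn w J ∧ ∀ u ∈ J, IsUnitGradient (localExpr F p₀)
      (fun x => fdistFrom F K ((extChartAt (𝓡 n) p₀).symm x)) (extChartAt (𝓡 n) p₀ (γ u))
      (w u) := by
  have hexists : ∀ x ∈ (fun u => extChartAt (𝓡 n) p₀ (γ u)) '' J, ∃ v,
      IsUnitGradient (localExpr F p₀)
        (fun x => fdistFrom F K ((extChartAt (𝓡 n) p₀).symm x)) x v := by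
    rintro _ ⟨u, hu, rfl⟩
    exact exists_isUnitGradient_fdistFrom hF hmin hK (hs hu) (hcut u hu) (hpos u hu)
  choose! v hv using hexists
  have hsub : (fun u => extChartAt (𝓡 n) p₀ (γ u)) '' J ⊆ (extChartAt (𝓡 n) p₀).target :=
    image_subset_iff.2 fun u hu => (extChartAt (𝓡 n) p₀).map_source (hs hu)
  exact ⟨_, ((hF.isLocalFinsler p₀).continuousOn_unitGradient hsub hv).comp
    ((continuousOn_extChartAt p₀).comp hγ hs) (mapsTo_image _ J),
    fun u hu => hv _ (mem_image_of_mem _ hu)⟩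

namespace IsRay

variable (hF : IsFinslerStructure F) (hmin : HasShortestCurves F) (hK : IsCompact K)
  {γ : ℝ → M} {ℓ : ℝ} (h : IsRay F K γ ℓ)
include hF hmin hK h

theorem exists_isUnitExtremal {a b : ℝ} (ha : 0 ≤ a) (hab : a ≤ b) (hb : b ≤ ℓ)
    (hs : MapsTo γ (Icc a b) (extChartAt (𝓡 n) p₀).source)
    (hcut : ∀ u ∈ Icc a b, γ u ∉ cutLocus F K) (hpos : ∀ u ∈ Icc a b, 0 < fdistFrom F K (γ u)) :
    ∃ w, IsUnitExtremal (localExpr F p₀) (fun u => extChartAt (𝓡 n) p₀ (γ u)) w (Icc a b) ∧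
      ∀ u ∈ Icc a b, IsUnitGradient (localExpr F p₀)
        (fun x => fdistFrom F K ((extChartAt (𝓡 n) p₀).symm x))
        (extChartAt (𝓡 n) p₀ (γ u)) (w u) := by
  set φ := extChartAt (𝓡 n) p₀
  set c := fun u => φ (γ u) with hc
  set g := fun x => fdistFrom F K (φ.symm x) with hg
  have hne := nonempty_of_fdistFrom_pos (hpos a (left_mem_Icc.2 hab))
  have hf := hF.isLocalFinsler p₀
  have hcΩ : MapsTo c (Icc a b) φ.target := fun u hu => φ.map_source (hs hu)
  obtain ⟨P, hpath⟩ := h.exists_isUnitPath_chart ha hb hs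
  obtain ⟨w, hw, hgrad⟩ := exists_continuousOn_isUnitGradient hF hmin hK
    (h.piecewiseSmooth.mono ha hb).1 hs hcut hpos
  have hgrowth : ∀ u ∈ Icc a b, g (c u) - g (c a) = u - a := fun u hu => by
    simp only [hg, hc, φ.left_inv (hs hu), φ.left_inv (hs (left_mem_Icc.2 hab))]
    rw [h.fdistFrom_eq hF hmin hne ⟨ha.trans hu.1, hu.2.trans hb⟩,
      h.fdistFrom_eq hF hmin hne ⟨ha, hab.trans hb⟩, add_sub_add_left_eq_sub]
  have hderiv := hpath.hasDerivWithinAt_unitGradient hf hcΩ hw hgrad hgrowth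
  refine ⟨w, hf.isUnitExtremal hcΩ hderiv hw hgrad hgrowth fun u hu e => ?_, hgrad⟩
  have hsub : Icc a u ⊆ Icc a b := Icc_subset_Icc_right hu.2
  filter_upwards [eventually_fdistFrom_sub_le_integral hF hmin hne hu.1
    ((h.piecewiseSmooth.mono ha (hu.2.trans hb)).chart (hs.mono_left hsub))
    (hcΩ.mono_left hsub) e] with τ hτ
  refine hτ.trans_eq (intervalIntegral.integral_congr_Ioo_of_le hu.1 fun x hx => ?_)
  have hx' : x ∈ Ioo a b := ⟨hx.1, hx.2.trans_le hu.2⟩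
  exact congrArg (localExpr F p₀ (c x + τ • e))
    ((hderiv x (Ioo_subset_Icc_self hx')).hasDerivAt (Icc_mem_nhds hx'.1 hx'.2)).deriv

theorem exists_isUnitGradient_velocity (hcut : ∀ u ∈ Icc 0 ℓ, γ u ∉ cutLocus F K)
    (hpos : ∀ u ∈ Icc 0 ℓ, 0 < fdistFrom F K (γ u)) {u : ℝ} (hu : u ∈ Icc 0 ℓ)
    (hs : γ u ∈ (extChartAt (𝓡 n) p₀).source) :
    ContDiffWithinAt ℝ ∞ (fun x => extChartAt (𝓡 n) p₀ (γ x)) (Icc 0 ℓ) u ∧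
    ∃ v, HasDerivWithinAt (fun x => extChartAt (𝓡 n) p₀ (γ x)) v (Icc 0 ℓ) u ∧
      IsUnitGradient (localExpr F p₀) (fun x => fdistFrom F K ((extChartAt (𝓡 n) p₀).symm x))
        (extChartAt (𝓡 n) p₀ (γ u)) v := by
  obtain ⟨a, b, ha, hb, hmem, hsource, hnhds⟩ := exists_Icc_mem_nhdsWithin hu
    (h.piecewiseSmooth.1 u hu ((isOpen_extChartAt_source p₀).mem_nhds hs))
  have hsub : Icc a b ⊆ Icc 0 ℓ := Icc_subset_Icc ha hb
  obtain ⟨w, hextremal, hgrad⟩ := h.exists_isUnitExtremal hF hmin hK ha (hmem.1.trans hmem.2) hb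
    hsource (fun x hx => hcut x (hsub hx)) fun x hx => hpos x (hsub hx)
  exact ⟨(hextremal.contDiffOn (hF.isLocalFinsler p₀) (fun x hx =>
      (extChartAt (𝓡 n) p₀).map_source (hsource hx)) u hmem).mono_of_mem_nhdsWithin hnhds,
    w u, (hextremal.hasDerivWithinAt u hmem).mono_of_mem_nhdsWithin hnhds, hgrad u hmem⟩

end IsRay

end Rays

section Wavefronts

variable {n : ℕ} {M : Type*} [TopologicalSpace M] [ChartedSpace (EuclideanSpace ℝ (Fin n)) M]
  {F : TangentBundle (𝓡 n) M → ℝ} {K : Set M}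

theorem wavefront_singleton (q : M) (τ : ℝ) :
    wavefront F ∅ {q} τ = fdistFrom F {q} ⁻¹' {τ} := by
  ext p
  simp [wavefront]

variable [IsManifold (𝓡 n) ∞ M]

theorem sub_le_fdist_of_mem_level (hF : IsFinslerStructure F) (hmin : HasShortestCurves F)
    (hne : K.Nonempty) {t₀ : ℝ} {p q : M} (hq : q ∈ fdistFrom F K ⁻¹' {t₀}) :
    fdistFrom F K p - t₀ ≤ fdist F q p := by
  obtain rfl : fdistFrom F K q = t₀ := hq
  exact sub_le_iff_le_add'.2 (fdistFrom_triangle hF hmin hne q p)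

theorem exists_isRay_from_level (hF : IsFinslerStructure F) (hmin : HasShortestCurves F)
    (hK : IsCompact K) (hne : K.Nonempty) {t₀ : ℝ} (ht₀ : 0 ≤ t₀) {p : M}
    (hp : t₀ ≤ fdistFrom F K p) : ∃ γ : ℝ → M, IsRay F K γ (fdistFrom F K p - t₀) ∧
      γ 0 ∈ fdistFrom F K ⁻¹' {t₀} ∧ γ (fdistFrom F K p - t₀) = p := by
  obtain ⟨γ, h⟩ := exists_isShortest hF hmin hK hne p
  have hstart : fdistFrom F K (γ t₀) = t₀ := h.fdistFrom_eq hF hmin ⟨ht₀, hp⟩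
  refine ⟨fun x => γ (x + t₀), ⟨h.isUnitCurve.segment ht₀ hp le_rfl, ?_⟩,
    (congrArg (fdistFrom F K ∘ γ) (zero_add t₀)).trans hstart,
    (congrArg γ (sub_add_cancel _ t₀)).trans h.target⟩
  rw [sub_add_cancel, zero_add, h.target, hstart, add_sub_cancel]

theorem exists_mem_level_fdist_eq (hF : IsFinslerStructure F) (hmin : HasShortestCurves F)
    (hK : IsCompact K) (hne : K.Nonempty) {t₀ : ℝ} (ht₀ : 0 ≤ t₀) {p : M}
    (hp : t₀ ≤ fdistFrom F K p) :
    ∃ q ∈ fdistFrom F K ⁻¹' {t₀}, fdist F q p = fdistFrom F K p - t₀ := by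
  obtain ⟨γ, h, h0, hℓ⟩ := exists_isRay_from_level hF hmin hK hne ht₀ hp
  have hdist := h.fdist_eq hF hmin hne le_rfl h.nonneg le_rfl
  rw [hℓ, sub_zero] at hdist
  exact ⟨γ 0, h0, hdist⟩

theorem fdistFrom_level (hF : IsFinslerStructure F) (hmin : HasShortestCurves F)
    (hK : IsCompact K) (hne : K.Nonempty) {t₀ : ℝ} (ht₀ : 0 ≤ t₀) {p : M}
    (hp : t₀ ≤ fdistFrom F K p) :
    fdistFrom F (fdistFrom F K ⁻¹' {t₀}) p = fdistFrom F K p - t₀ := by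
  obtain ⟨q, hq, hqp⟩ := exists_mem_level_fdist_eq hF hmin hK hne ht₀ hp
  exact ((fdistFrom_le hF hq p).trans_eq hqp).antisymm
    (le_fdistFrom ⟨q, hq⟩ fun _ ha => sub_le_fdist_of_mem_level hF hmin hne ha)

theorem wavefront_level (hF : IsFinslerStructure F) (hmin : HasShortestCurves F)
    (hK : IsCompact K) (hne : K.Nonempty) {t₀ t : ℝ} (ht₀ : 0 ≤ t₀) (ht : t₀ ≤ t) :
    wavefront F (fdistFrom F K ⁻¹' Iio t₀) (fdistFrom F K ⁻¹' {t₀}) (t - t₀) =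
      fdistFrom F K ⁻¹' {t} := by
  ext p
  simp only [wavefront, mem_ofPred_eq, mem_preimage, mem_Iio, not_lt, mem_singleton_iff]
  constructor
  · rintro ⟨hp, hdist⟩
    rwa [fdistFrom_level hF hmin hK hne ht₀ hp, sub_left_inj] at hdist
  · rintro rfl
    exact ⟨ht, fdistFrom_level hF hmin hK hne ht₀ ht⟩

theorem level_eq_envelope_points (hF : IsFinslerStructure F) (hmin : HasShortestCurves F)
    (hK : IsCompact K) (hne : K.Nonempty) {t₀ t : ℝ} (ht₀ : 0 ≤ t₀) (ht : t₀ ≤ t) :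
    fdistFrom F K ⁻¹' {t} = {p | p ∉ fdistFrom F K ⁻¹' Iio t₀ ∧
      (∃ q ∈ fdistFrom F K ⁻¹' {t₀}, p ∈ wavefront F ∅ {q} (t - t₀)) ∧
      ∀ q ∈ fdistFrom F K ⁻¹' {t₀}, ∀ τ < t - t₀, p ∉ wavefront F ∅ {q} τ} := by
  ext p
  simp only [wavefront_singleton, mem_ofPred_eq, mem_preimage (a := p), mem_Iio, not_lt,
    mem_singleton_iff, fdistFrom_singleton]
  constructor
  · rintro rfl
    exact ⟨ht, exists_mem_level_fdist_eq hF hmin hK hne ht₀ ht, fun q hq τ hτ hqp =>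
      (hqp ▸ hτ).not_ge (sub_le_fdist_of_mem_level hF hmin hne hq)⟩
  · rintro ⟨hp, ⟨q, hq, hqp⟩, hfirst⟩
    obtain ⟨q', hq', hqp'⟩ := exists_mem_level_fdist_eq hF hmin hK hne ht₀ hp
    have hle : fdistFrom F K p - t₀ ≤ t - t₀ :=
      (sub_le_fdist_of_mem_level hF hmin hne hq).trans_eq hqp
    have hge : t - t₀ ≤ fdistFrom F K p - t₀ :=
      (not_lt.1 fun hlt => hfirst q' hq' _ hlt rfl).trans_eq hqp'
    exact sub_left_inj.1 (hle.antisymm hge)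

theorem exists_isShortest_from_level (hF : IsFinslerStructure F) (hmin : HasShortestCurves F)
    (hK : IsCompact K) (hne : K.Nonempty) {t₀ : ℝ} (ht₀ : 0 ≤ t₀) {p : M}
    (hp : t₀ ≤ fdistFrom F K p) :
    ∃ γ, IsShortest F (fdistFrom F K ⁻¹' {t₀}) p γ (fdistFrom F K p - t₀) := by
  obtain ⟨γ, h, h0, hℓ⟩ := exists_isRay_from_level hF hmin hK hne ht₀ hp
  exact ⟨γ, h.isShortest h0 hℓ (fdistFrom_level hF hmin hK hne ht₀ hp).symm⟩

theorem IsShortest.length_eq_of_level (hF : IsFinslerStructure F) (hmin : HasShortestCurves F)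
    (hK : IsCompact K) (hne : K.Nonempty) {t₀ : ℝ} (ht₀ : 0 ≤ t₀) {p : M}
    (hp : t₀ ≤ fdistFrom F K p) {γ : ℝ → M} {ℓ : ℝ}
    (h : IsShortest F (fdistFrom F K ⁻¹' {t₀}) p γ ℓ) : ℓ = fdistFrom F K p - t₀ :=
  h.length_eq_fdistFrom.trans (fdistFrom_level hF hmin hK hne ht₀ hp)

theorem IsShortest.isRay_of_level (hF : IsFinslerStructure F) (hmin : HasShortestCurves F)
    (hK : IsCompact K) (hne : K.Nonempty) {t₀ : ℝ} (ht₀ : 0 ≤ t₀) {p : M}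
    (hp : t₀ ≤ fdistFrom F K p) {γ : ℝ → M} {ℓ : ℝ}
    (h : IsShortest F (fdistFrom F K ⁻¹' {t₀}) p γ ℓ) : IsRay F K γ ℓ where
  toIsUnitCurve := h.isUnitCurve
  growth := by
    have h0 : fdistFrom F K (γ 0) = t₀ := h.source
    rw [h.target, h0, h.length_eq_of_level hF hmin hK hne ht₀ hp, add_sub_cancel]

theorem IsRay.fdistFrom_mem_Icc (hF : IsFinslerStructure F) (hmin : HasShortestCurves F)
    (hne : K.Nonempty) {γ : ℝ → M} {ℓ u : ℝ} (h : IsRay F K γ ℓ) (hu : u ∈ Icc 0 ℓ) :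
    fdistFrom F K (γ u) ∈ Icc (fdistFrom F K (γ 0)) (fdistFrom F K (γ ℓ)) := by
  rw [h.fdistFrom_eq hF hmin hne hu, h.growth]
  exact ⟨le_add_of_nonneg_right hu.1, add_le_add_right hu.2 _⟩

theorem IsRay.velocity_eq_of_isUnitGradient (hF : IsFinslerStructure F)
    (hmin : HasShortestCurves F) (hne : K.Nonempty) {γ : ℝ → M} {ℓ u : ℝ} (h : IsRay F K γ ℓ)
    (hℓ : 0 < ℓ) (hu : u ∈ Icc 0 ℓ) {p₀ : M} (hs : γ u ∈ (extChartAt (𝓡 n) p₀).source)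
    {v w : EuclideanSpace ℝ (Fin n)}
    (hv : HasDerivWithinAt (fun x => extChartAt (𝓡 n) p₀ (γ x)) v (Icc 0 ℓ) u)
    (hunit : localExpr F p₀ (extChartAt (𝓡 n) p₀ (γ u)) v = 1)
    (hw : IsUnitGradient (localExpr F p₀) (fun x => fdistFrom F K ((extChartAt (𝓡 n) p₀).symm x))
      (extChartAt (𝓡 n) p₀ (γ u)) w) : v = w := by
  refine hw.eq_of_hasDerivWithinAt (k := fdistFrom F K (γ 0))
    ((hF.isLocalFinsler p₀).isMinkowski _ ((extChartAt (𝓡 n) p₀).map_source hs)) hunit hv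
    (uniqueDiffOn_Icc hℓ u hu) hu ?_
  filter_upwards [h.piecewiseSmooth.1 u hu ((isOpen_extChartAt_source p₀).mem_nhds hs),
    self_mem_nhdsWithin] with x hx hxI
  rw [(extChartAt (𝓡 n) p₀).left_inv hx, h.fdistFrom_eq hF hmin hne hxI, add_comm]

theorem IsUnitGradient.hasTangentHyperplane (hF : IsFinslerStructure F) {g : M → ℝ} {p₀ p : M}
    (hp : p ∈ (extChartAt (𝓡 n) p₀).source) {v : EuclideanSpace ℝ (Fin n)}
    (h : IsUnitGradient (localExpr F p₀) (fun x => g ((extChartAt (𝓡 n) p₀).symm x))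
      (extChartAt (𝓡 n) p₀ p) v) :
    HasTangentHyperplane (g ⁻¹' {g p}) p
      (chartKer p₀ p (fderiv ℝ (localExpr F p₀ (extChartAt (𝓡 n) p₀ p)) v)) :=
  hasTangentHyperplane_levelSet hp h.hasStrictFDerivAt <| h.fderiv_ne_zero <|
    (hF.isLocalFinsler p₀).isMinkowski _ ((extChartAt (𝓡 n) p₀).map_source hp)

variable [T2Space M]

theorem exists_hasTangentHyperplane_level (hF : IsFinslerStructure F)
    (hmin : HasShortestCurves F) (hK : IsCompact K) {p : M} (hcut : p ∉ cutLocus F K)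
    (hpos : 0 < fdistFrom F K p) : ∃ H : Submodule ℝ (TangentSpace (𝓡 n) p),
      HasTangentHyperplane (fdistFrom F K ⁻¹' {fdistFrom F K p}) p H := by
  have hp := mem_extChartAt_source (I := 𝓡 n) p
  obtain ⟨v, hv⟩ := exists_isUnitGradient_fdistFrom hF hmin hK hp hcut hpos
  exact ⟨_, hv.hasTangentHyperplane hF hp⟩

theorem IsRay.areTangentAt (hF : IsFinslerStructure F) (hmin : HasShortestCurves F) {L : Set M}
    (hK : IsCompact K) (hL : IsCompact L) {γ : ℝ → M} {ℓ : ℝ} (hγK : IsRay F K γ ℓ)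
    (hγL : IsRay F L γ ℓ) (hℓ : 0 < ℓ) (hcut : ∀ u ∈ Icc 0 ℓ, γ u ∉ cutLocus F K)
    (hpos : ∀ u ∈ Icc 0 ℓ, 0 < fdistFrom F K (γ u)) (hcutL : γ ℓ ∉ cutLocus F L) :
    AreTangentAt n (fdistFrom F L ⁻¹' {fdistFrom F L (γ ℓ)})
      (fdistFrom F K ⁻¹' {fdistFrom F K (γ ℓ)}) (γ ℓ) := by
  have hp := mem_extChartAt_source (I := 𝓡 n) (γ ℓ)
  have hend : ℓ ∈ Icc 0 ℓ := right_mem_Icc.2 hℓ.le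
  have hposL : 0 < fdistFrom F L (γ ℓ) := by
    rw [hγL.growth]
    exact add_pos_of_nonneg_of_pos (fdistFrom_nonneg hF L _) hℓ
  obtain ⟨-, v, hv, hgrad⟩ := hγK.exists_isUnitGradient_velocity hF hmin hK hcut hpos hend hp
  obtain ⟨w, hw⟩ := exists_isUnitGradient_fdistFrom hF hmin hL hp hcutL hposL
  obtain rfl : v = w := hγL.velocity_eq_of_isUnitGradient hF hmin
    (nonempty_of_fdistFrom_pos hposL) hℓ hend hp hv hgrad.unit hw
  exact ⟨rfl, rfl, _, hw.hasTangentHyperplane hF hp, hgrad.hasTangentHyperplane hF hp⟩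

theorem areTangentAt_level (hF : IsFinslerStructure F) (hmin : HasShortestCurves F)
    (hK : IsCompact K) {p q : M} (hpos : 0 < fdistFrom F K q) (hqp : 0 < fdist F q p)
    (hbetween : fdistFrom F K q + fdist F q p = fdistFrom F K p)
    (hcut : ∀ z, fdistFrom F K z ∈ Icc (fdistFrom F K q) (fdistFrom F K p) → z ∉ cutLocus F K) :
    AreTangentAt n (fdistFrom F {q} ⁻¹' {fdistFrom F {q} p})
      (fdistFrom F K ⁻¹' {fdistFrom F K p}) p := by
  have hne := nonempty_of_fdistFrom_pos hpos
  obtain ⟨γ, h, rfl, hp⟩ := hmin.exists_unitCurve q p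
  generalize hℓ : fdist F (γ 0) p = ℓ at h hp hqp hbetween
  obtain rfl := hp
  have hγK : IsRay F K γ ℓ := ⟨h, hbetween.symm⟩
  have hγq : IsShortest F {γ 0} (γ ℓ) γ ℓ :=
    h.isShortest (mem_singleton _) rfl (by rw [fdistFrom_singleton, hℓ])
  exact hγK.areTangentAt hF hmin hK isCompact_singleton (hγq.isRay hF) hqp
    (fun u hu => hcut _ (hγK.fdistFrom_mem_Icc hF hmin hne hu))
    (fun u hu => hpos.trans_le (hγK.fdistFrom_mem_Icc hF hmin hne hu).1)
    (notMem_cutLocus_singleton hF hmin hK hne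
      (hcut _ ⟨hbetween ▸ le_add_of_nonneg_right hqp.le, le_rfl⟩) (hℓ.symm ▸ hbetween))

theorem isEnvelope_level (hF : IsFinslerStructure F) (hmin : HasShortestCurves F)
    (hK : IsCompact K) (hne : K.Nonempty) {t₀ t : ℝ} (ht₀ : 0 < t₀) (ht : t₀ < t)
    (hcut : ∀ z, fdistFrom F K z ∈ Icc t₀ t → z ∉ cutLocus F K) :
    IsEnvelope F (fdistFrom F K ⁻¹' Iio t₀) (fdistFrom F K ⁻¹' {t₀}) (t - t₀)
      (fdistFrom F K ⁻¹' {t}) := by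
  refine ⟨level_eq_envelope_points hF hmin hK hne ht₀.le ht.le, ?_⟩
  rintro p rfl q rfl hqp
  rw [wavefront_singleton] at hqp ⊢
  have hdist : fdist F q p = fdistFrom F K p - fdistFrom F K q :=
    (fdistFrom_singleton q p).symm.trans hqp
  rw [← hdist, ← fdistFrom_singleton]
  exact areTangentAt_level hF hmin hK ht₀ (hdist ▸ sub_pos.2 ht)
    (by rw [hdist, add_sub_cancel]) hcut

namespace IsRay

variable (hF : IsFinslerStructure F) (hmin : HasShortestCurves F) (hK : IsCompact K) {γ : ℝ → M}
  {ℓ : ℝ} (h : IsRay F K γ ℓ) (hcut : ∀ u ∈ Icc 0 ℓ, γ u ∉ cutLocus F K)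
  (hpos : ∀ u ∈ Icc 0 ℓ, 0 < fdistFrom F K (γ u))
include hF hmin hK h hcut hpos

theorem contMDiffOn : ContMDiffOn 𝓘(ℝ, ℝ) (𝓡 n) ∞ γ (Icc 0 ℓ) := fun u hu => by
  have hsmooth := (h.exists_isUnitGradient_velocity hF hmin hK hcut hpos hu
    (mem_extChartAt_source (I := 𝓡 n) (γ u))).1
  exact contMDiffWithinAt_iff_target.2 ⟨h.piecewiseSmooth.1 u hu, hsmooth.contMDiffWithinAt⟩

theorem isUnitGradient_velocityWithin (hℓ : 0 < ℓ) {u : ℝ} (hu : u ∈ Icc 0 ℓ) :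
    IsUnitGradient (localExpr F (γ u))
      (fun x => fdistFrom F K ((extChartAt (𝓡 n) (γ u)).symm x)) (extChartAt (𝓡 n) (γ u) (γ u))
      (chartDeriv (γ u) (γ u) (velocityWithin (n := n) γ (Icc 0 ℓ) u).2) := by
  have hs := mem_extChartAt_source (I := 𝓡 n) (γ u)
  obtain ⟨-, v, hv, hgrad⟩ := h.exists_isUnitGradient_velocity hF hmin hK hcut hpos hu hs
  have hdiff := (h.contMDiffOn hF hmin hK hcut hpos u hu).mdifferentiableWithinAt (by simp)
  rwa [(uniqueDiffOn_Icc hℓ u hu).eq_deriv _ hv (hasDerivWithinAt_chart_comp hdiff hs)] at hgrad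

theorem isGeodesic (hℓ : 0 < ℓ) : IsGeodesic F γ ℓ where
  smooth := h.contMDiffOn hF hmin hK hcut hpos
  unitSpeed u hu := (localExpr_chartDeriv (mem_extChartAt_source (I := 𝓡 n) (γ u)) _).symm.trans
    (h.isUnitGradient_velocityWithin hF hmin hK hcut hpos hℓ hu).unit
  minimizing u v hu huv hv := by
    have hne := nonempty_of_fdistFrom_pos (hpos 0 (left_mem_Icc.2 hℓ.le))
    rw [h.length_eq hu huv hv, h.fdist_eq hF hmin hne hu huv hv]

theorem isOrthogonalTo_level (hℓ : 0 < ℓ) {u : ℝ} (hu : u ∈ Icc 0 ℓ) :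
    IsOrthogonalTo F (velocityWithin γ (Icc 0 ℓ) u)
      (fdistFrom F K ⁻¹' {fdistFrom F K (γ u)}) := by
  have hs := mem_extChartAt_source (I := 𝓡 n) (γ u)
  have hgrad := h.isUnitGradient_velocityWithin hF hmin hK hcut hpos hℓ hu
  have hN := (hF.isLocalFinsler (γ u)).isMinkowski _ ((extChartAt (𝓡 n) (γ u)).map_source hs)
  have hv := hN.ne_zero_of_unit hgrad.unit
  refine ⟨fun h0 => hv ?_, rfl, fun z hz => ?_⟩
  · exact (congrArg (chartDeriv (γ u) (γ u)) h0).trans (_root_.map_zero _)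
  · have hz := (mem_tangentVectors_levelSet hs hgrad.hasStrictFDerivAt
      (hgrad.fderiv_ne_zero hN)).1 hz
    refine (fundamentalTensor_chart (F := F) hs _ _ z).trans ?_
    exact (hN.fundamentalTensor_left_self hv _).trans (mul_eq_zero_of_right _ hz)

end IsRay

end Wavefronts

end Finsler

theorem theorem3p1 {n : ℕ} {M : Type*} [TopologicalSpace M] [T2Space M]
    [ChartedSpace (EuclideanSpace ℝ (Fin n)) M] [IsManifold (𝓡 n) ∞ M]
    (F : TangentBundle (𝓡 n) M → ℝ) (hF : Finsler.IsFinslerStructure F)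
    -- any two points are joined by a shortest unit speed curve
    (hmin : ∀ p q : M, ∃ (γ : ℝ → M) (ℓ : ℝ), Finsler.IsShortest F {p} q γ ℓ)
    (A : Set M) (hA : IsCompact A)
    (ρ : M → ℝ) (hρ : ∀ p, ρ p = Finsler.fdistFrom F A p)
    (U : Set M) (s r : ℝ) (hs : 0 < s) (hsr : s < r) (hU : ρ '' U = Icc s r)
    (hcut : ∀ p ∈ ρ ⁻¹' Icc s r, p ∉ Finsler.cutLocus F A) :
    -- the wave with front `ρ⁻¹(s)` at time `0` has front `ρ⁻¹(t)` at time `t - s`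
    (∀ t ∈ Icc s r,
      Finsler.wavefront F (ρ ⁻¹' Iio s) (ρ ⁻¹' {s}) (t - s) = ρ ⁻¹' {t}) ∧
    -- Huygens' envelope principle
    (∀ t₀ ∈ Icc s r, ∀ t ∈ Ioc t₀ r,
      Finsler.IsEnvelope F (ρ ⁻¹' Iio t₀) (ρ ⁻¹' {t₀}) (t - t₀) (ρ ⁻¹' {t})) ∧
    -- the fronts have tangent hyperplanes
    (∀ t ∈ Icc s r, ∀ p ∈ ρ ⁻¹' {t}, ∃ H : Submodule ℝ (TangentSpace (𝓡 n) p),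
      Finsler.HasTangentHyperplane (ρ ⁻¹' {t}) p H) ∧
    -- wave rays exist, are geodesics, and are orthogonal to every front they meet
    (∀ t ∈ Ioc s r, ∀ q ∈ ρ ⁻¹' {t},
      (∃ γ : ℝ → M, Finsler.IsShortest F (ρ ⁻¹' {s}) q γ (t - s)) ∧
      ∀ (γ : ℝ → M) (ℓ : ℝ), Finsler.IsShortest F (ρ ⁻¹' {s}) q γ ℓ →
        ℓ = t - s ∧ Finsler.IsGeodesic F γ ℓ ∧
        ∀ u ∈ Icc 0 ℓ, Finsler.IsOrthogonalTo F (Finsler.velocityWithin γ (Icc 0 ℓ) u)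
          (ρ ⁻¹' {s + u})) := by
  obtain rfl : ρ = Finsler.fdistFrom F A := funext hρ
  obtain ⟨p₀, -, hp₀⟩ := hU.symm ▸ left_mem_Icc.2 hsr.le
  have hne : A.Nonempty := Finsler.nonempty_of_fdistFrom_pos (hp₀.symm ▸ hs)
  refine ⟨fun t ht => Finsler.wavefront_level hF hmin hA hne hs.le ht.1, fun t₀ ht₀ t ht =>
    Finsler.isEnvelope_level hF hmin hA hne (hs.trans_le ht₀.1) ht.1 fun z hz =>
      hcut z (Icc_subset_Icc ht₀.1 ht.2 hz), ?_, ?_⟩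
  · rintro t ht p rfl
    exact Finsler.exists_hasTangentHyperplane_level hF hmin hA (hcut p ht) (hs.trans_le ht.1)
  · rintro t ht q rfl
    refine ⟨Finsler.exists_isShortest_from_level hF hmin hA hne hs.le ht.1.le, fun γ ℓ h => ?_⟩
    have hℓ := h.length_eq_of_level hF hmin hA hne hs.le ht.1.le
    have hℓ0 : 0 < ℓ := hℓ ▸ sub_pos.2 ht.1
    have hray := h.isRay_of_level hF hmin hA hne hs.le ht.1.le
    have hlevel : ∀ u ∈ Icc 0 ℓ, Finsler.fdistFrom F A (γ u) = s + u := fun u hu =>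
      (hray.fdistFrom_eq hF hmin hne hu).trans (congrArg (· + u) h.source)
    have hband : ∀ u ∈ Icc 0 ℓ, Finsler.fdistFrom F A (γ u) ∈ Icc s r := fun u hu => by
      rw [hlevel u hu]
      exact ⟨le_add_of_nonneg_right hu.1, by linarith [hu.2, ht.2]⟩
    have hcut' : ∀ u ∈ Icc 0 ℓ, γ u ∉ Finsler.cutLocus F A := fun u hu => hcut _ (hband u hu)
    have hpos : ∀ u ∈ Icc 0 ℓ, 0 < Finsler.fdistFrom F A (γ u) := fun u hu =>
      hs.trans_le (hband u hu).1
    exact ⟨hℓ, hray.isGeodesic hF hmin hA hcut' hpos hℓ0, fun u hu =>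
      hlevel u hu ▸ hray.isOrthogonalTo_level hF hmin hA hcut' hpos hℓ0 hu⟩
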